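/- Let $m\in\mathbb N$ and consider parameters $\pmb\Lambda_-=\operatorname{diag}(\mu_j)_{j=1}^m\in C^1([0,1];\mathbb R^{m\times m})$, $\lambda\in C^1([0,1]^2;\mathbb R)$, $\sigma\in C([0,1];L^2([0,1]^2;\mathbb R))$, $\mathbf W=(W_1,\dots,W_m)\in C([0,1];L^2([0,1];\mathbb R^{1\times m}))$, $\pmb\Theta=(\Theta_j)_{j=1}^m\in C([0,1];L^2([0,1];\mathbb R^m))$, $\pmb\Psi\in C([0,1];\mathbb R^{m\times m})$ with $\Psi_{j,j}=0$ for all $j$, and $\mathbf R=(R_j)_{j=1}^m\in L^2([0,1];\mathbb R^m)$, such that $\lambda>0$ and $\mu_j>0$ everywhere and $\min_{[0,1]}\mu_j>\max_{[0,1]}\mu_{j+1}$ for $j=1,\dots,m-1$. Let $\mathcal T=\{0\le\xi\le x\le1\}$, and let $\mathbf M\in L^\infty(\mathcal T;L^2([0,1];\mathbb R^{1\times m}))$, $\mathbf N\in L^\infty(\mathcal T;\mathbb R^{m\times m})$ be a (weak) solution, with bounded traces on the edges of $\mathcal T$, of the observer kernel equations $$\lambda(x,y)\mathbf M_x(x,\xi,y)-\mathbf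 M_\xi(x,\xi,y)\pmb\Lambda_-(\xi)-\mathbf M(x,\xi,y)\pmb\Lambda_-'(\xi)=\int_0^1\sigma(x,y,\eta)\mathbf M(x,\xi,\eta)\,d\eta+\mathbf W(x,y)\mathbf N(x,\xi),$$ $$\pmb\Lambda_-(x)\mathbf N_x(x,\xi)+\mathbf N_\xi(x,\xi)\pmb\Lambda_-(\xi)+\mathbf N(x,\xi)\pmb\Lambda_-'(\xi)=-\int_0^1\pmb\Theta(x,y)\mathbf M(x,\xi,y)\,dy-\pmb\Psi(x)\mathbf N(x,\xi),$$ with boundary conditions $\mathbf W(x,y)=\mathbf M(x,x,y)\pmb\Lambda_-(x)+\lambda(x,y)\mathbf M(x,x,y)$, $\pmb\Psi(x)=\mathbf N(x,x)\pmb\Lambda_-(x)-\pmb\Lambda_-(x)\mathbf N(x,x)$, $N_{i,j}(1,\xi)=\int_0^1R_i(y)M_j(1,\xi,y)\,dy$ for $i\ge j$, and $N_{i,j}(x,0)=n_{i,j}(x)$ for $i<j$, where the functions $n_{i,j}$ are arbitrary. Put $\mathbf P_+(x,y)=\mathbf M(x,0,y)\pmb\Lambda_-(0)$ and $\mathbf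 P_-(x)=\mathbf N(x,0)\pmb\Lambda_-(0)$. Then the estimation error dynamics $$\tilde u_t(t,x,y)+\lambda(x,y)\tilde u_x(t,x,y)+\mathbf P_+(x,y)\tilde{\mathbf v}(t,0)=\int_0^1\sigma(x,y,\eta)\tilde u(t,x,\eta)\,d\eta+\mathbf W(x,y)\tilde{\mathbf v}(t,x),$$ $$\tilde{\mathbf v}_t(t,x)-\pmb\Lambda_-(x)\tilde{\mathbf v}_x(t,x)+\mathbf P_-(x)\tilde{\mathbf v}(t,0)=\int_0^1\pmb\Theta(x,y)\tilde u(t,x,y)\,dy+\pmb\Psi(x)\tilde{\mathbf v}(t,x),$$ $$\tilde u(t,0,y)=0,\qquad\tilde{\mathbf v}(t,1)=\int_0^1\mathbf R(y)\tilde u(t,1,y)\,dy,$$ are exponentially stable on $E_c=L^2([0,1];L^2([0,1];\mathbb R))\times L^2([0,1];\mathbb R^m)$ (with its Hilbert norm): there are constants $C,c>0$ such that for every $z_0\in E_c$ there is a unique weak solution $z=(\tilde u,\tilde{\mathbf v})\in C([0,\infty);E_c)$ with $z(0)=z_0$, and it satisfies $\|z(t)\|_{E_c}\le Ce^{-ct}\|z_0\|_{E_c}$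 for all $t\ge0$. -/

import Mathlib

open MeasureTheory Set

noncomputable section

namespace ContinuumPDE

/-! ### Spaces -/

/-- Lebesgue measure on the unit interval, as a measure on the line. -/
abbrev muI : Measure ℝ := volume.restrict (Icc 0 1)

/-- The real Hilbert space `L²([0,1]; ℝ)`. -/
abbrev H : Type := Lp ℝ 2 muI

/-- The state space `E_c = L²([0,1]; L²([0,1]; ℝ)) × L²([0,1]; ℝᵐ)` with the Hilbert space structure
`⟨(u₁, v₁), (u₂, v₂)⟩ = ∫ (∫ u₁ u₂ dy + ∑ⱼ v₁ʲ v₂ʲ) dx`. -/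
abbrev Ec (m : ℕ) : Type :=
  WithLp 2 (Lp H 2 muI × Lp (EuclideanSpace ℝ (Fin m)) 2 muI)

/-- `f` is (the continuous representative of) an element of `H¹([0,1]; X)` whose weak derivative
is `f'`. -/
def IsH1 {X : Type*} [NormedAddCommGroup X] [NormedSpace ℝ X] (f f' : ℝ → X) : Prop :=
  MemLp f' 2 muI ∧ ∀ x ∈ Icc (0 : ℝ) 1, f x = f 0 + ∫ s in (0 : ℝ)..x, f' s

/-! ### Weak solutions and exponential stability of linear evolution equations -/

section Evolution

variable {E : Type*} [NormedAddCommGroup E] [InnerProductSpace ℝ E]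

/-- For the graph `G` of a linear operator `A` on `E`: `φ` lies in the domain of the adjoint `A*`
and `A* φ = ψ`. -/
def InAdjointGraph (G : Set (E × E)) (φ ψ : E) : Prop :=
  ∀ z w : E, (z, w) ∈ G → inner ℝ w φ = inner ℝ z ψ

/-- `z ∈ C([0,∞); E)` is a weak solution of `ż = A z`, `z(0) = z₀`, where `G` is the graph of `A`:
tested with any `φ` in the domain of `A*`, it satisfies `d/dt ⟨z, φ⟩ = ⟨z, A* φ⟩` in the
integrated sense. -/
def IsWeakSolution (G : Set (E × E)) (z₀ : E) (z : ℝ → E) : Prop :=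
  ContinuousOn z (Ici 0) ∧ z 0 = z₀ ∧
    ∀ φ ψ : E, InAdjointGraph G φ ψ → ∀ t : ℝ, 0 ≤ t →
      inner ℝ (z t) φ = inner ℝ z₀ φ + ∫ s in (0 : ℝ)..t, inner ℝ (z s) ψ

/-- Exponential stability of `ż = A z` on `E` (`G` is the graph of `A`): every initial
condition has one and only one weak solution in `C([0,∞); E)`, and it decays exponentially, with
constants that do not depend on the initial condition. -/
def IsExponentiallyStable (G : Set (E × E)) : Prop :=
  ∃ C : ℝ, 0 < C ∧ ∃ c : ℝ, 0 < c ∧ ∀ z₀ : E, ∃ z : ℝ → E,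
    IsWeakSolution G z₀ z ∧
    (∀ z' : ℝ → E, IsWeakSolution G z₀ z' → EqOn z' z (Ici 0)) ∧
    ∀ t : ℝ, 0 ≤ t → ‖z t‖ ≤ C * Real.exp (-c * t) * ‖z₀‖

end Evolution

/-! ### The parameters of the continuum system -/

/-- The parameters of the continuum system
`u_t + λ u_x = ∫ σ u dη + W v`, `v_t - Λ₋ v_x = ∫ Θ u dy + Ψ v`,
`u(t,0,y) = Q(y) v(t,0)`, `v(t,1) = ∫ R(y) u(t,1,y) dy + U(t)`, with `Λ₋ = diag(μ₁, …, μ_m)`. -/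
structure Params (m : ℕ) where
  /-- `lam x y = λ(x,y)` -/
  lam : ℝ → ℝ → ℝ
  /-- `mu j x = μ_j(x)` -/
  mu : Fin m → ℝ → ℝ
  /-- `sigma x (y, η) = σ(x,y,η)` -/
  sigma : ℝ → Lp ℝ 2 (muI.prod muI)
  /-- `Theta j x y = Θ_j(x,y)` -/
  Theta : Fin m → ℝ → H
  /-- `Psi x i j = Ψ_{i,j}(x)` -/
  Psi : ℝ → Matrix (Fin m) (Fin m) ℝ
  /-- `W j x y = W_j(x,y)` -/
  W : Fin m → ℝ → H
  /-- `Q j y = Q_j(y)` -/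
  Q : Fin m → H
  /-- `R j y = R_j(y)` -/
  R : Fin m → H

/-- The standing assumption on the parameters. -/
structure Params.Standing {m : ℕ} (p : Params m) : Prop where
  lam_C1 : ContDiffOn ℝ 1 (fun q : ℝ × ℝ => p.lam q.1 q.2) (Icc 0 1 ×ˢ Icc 0 1)
  mu_C1 : ∀ j, ContDiffOn ℝ 1 (p.mu j) (Icc 0 1)
  sigma_cont : ContinuousOn p.sigma (Icc 0 1)
  Theta_cont : ∀ j, ContinuousOn (p.Theta j) (Icc 0 1)
  Psi_cont : ContinuousOn p.Psi (Icc 0 1)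
  W_cont : ∀ j, ContinuousOn (p.W j) (Icc 0 1)
  lam_pos : ∀ x ∈ Icc (0 : ℝ) 1, ∀ y ∈ Icc (0 : ℝ) 1, 0 < p.lam x y
  mu_pos : ∀ j, ∀ x ∈ Icc (0 : ℝ) 1, 0 < p.mu j x
  /-- `min μ_i > max μ_j` for `i < j` -/
  mu_order : ∀ i j, i < j → ∀ x ∈ Icc (0 : ℝ) 1, ∀ x' ∈ Icc (0 : ℝ) 1, p.mu j x' < p.mu i x
  Psi_diag : ∀ j, ∀ x ∈ Icc (0 : ℝ) 1, p.Psi x j j = 0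

/-! ### The observer kernel equations on the triangle `0 ≤ ξ ≤ x ≤ 1` -/

/-- `λ(x,y) ∂ₓM_j - ∂_ξ (M_j μ_j(ξ)) = ∫ σ(x,y,η) M_j(x,ξ,η) dη + ∑ₗ W_ℓ(x,y) N_{ℓ,j}(x,ξ)`
in the weak sense (tested with `C¹` functions of `(x,ξ,y)` that need not vanish on the edges of the
triangle); the values of `M_j` on the three edges `x = 1`, `ξ = x`, `ξ = 0` are its traces. -/
def WeakKernelM {m : ℕ} (p : Params m) (M : Fin m → ℝ → ℝ → H)
    (N : ℝ → ℝ → Matrix (Fin m) (Fin m) ℝ) (j : Fin m) : Prop :=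
  ∀ φ : ℝ → ℝ → ℝ → ℝ, ContDiff ℝ 1 (fun q : ℝ × ℝ × ℝ => φ q.1 q.2.1 q.2.2) →
    (∫ x in (0 : ℝ)..1, ∫ ξ in (0 : ℝ)..x, ∫ y, M j x ξ y *
        (-derivWithin (fun s => p.lam s y * φ s ξ y) (Icc 0 1) x
          + p.mu j ξ * deriv (fun s => φ x s y) ξ) ∂muI)
      + (∫ ξ in (0 : ℝ)..1, ∫ y, p.lam 1 y * M j 1 ξ y * φ 1 ξ y ∂muI)
      - (∫ x in (0 : ℝ)..1, ∫ y, (p.lam x y + p.mu j x) * M j x x y * φ x x y ∂muI)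
      + (∫ x in (0 : ℝ)..1, ∫ y, p.mu j 0 * M j x 0 y * φ x 0 y ∂muI)
    = ∫ x in (0 : ℝ)..1, ∫ ξ in (0 : ℝ)..x, ∫ y,
        ((∫ η, p.sigma x (y, η) * M j x ξ η ∂muI) + ∑ l, p.W l x y * N x ξ l j) * φ x ξ y ∂muI

/-- `μ_i(x) ∂ₓN_{i,j} + ∂_ξ (N_{i,j} μ_j(ξ))
  = -∫ Θ_i(x,y) M_j(x,ξ,y) dy - ∑ₗ Ψ_{i,ℓ}(x) N_{ℓ,j}(x,ξ)`
in the weak sense; the values of `N_{i,j}` on the three edges are its traces. -/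
def WeakKernelN {m : ℕ} (p : Params m) (M : Fin m → ℝ → ℝ → H)
    (N : ℝ → ℝ → Matrix (Fin m) (Fin m) ℝ) (i j : Fin m) : Prop :=
  ∀ φ : ℝ → ℝ → ℝ, ContDiff ℝ 1 (fun q : ℝ × ℝ => φ q.1 q.2) →
    (∫ x in (0 : ℝ)..1, ∫ ξ in (0 : ℝ)..x, N x ξ i j *
        (-derivWithin (fun s => p.mu i s * φ s ξ) (Icc 0 1) x
          - p.mu j ξ * deriv (fun s => φ x s) ξ))
      + (∫ ξ in (0 : ℝ)..1, p.mu i 1 * N 1 ξ i j * φ 1 ξ)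
      - (∫ x in (0 : ℝ)..1, (p.mu i x - p.mu j x) * N x x i j * φ x x)
      - (∫ x in (0 : ℝ)..1, p.mu j 0 * N x 0 i j * φ x 0)
    = ∫ x in (0 : ℝ)..1, ∫ ξ in (0 : ℝ)..x,
        (-(∫ y, p.Theta i x y * M j x ξ y ∂muI) - ∑ l, p.Psi x i l * N x ξ l j) * φ x ξ

/-- `M ∈ L^∞(𝒯; L²([0,1]; ℝ^{1×m}))` and `N ∈ L^∞(𝒯; ℝ^{m×m})` solve the observer kernel
equations, with the boundary data `n_{i,j}` (`i < j`) in the artificial boundary condition. -/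
structure IsObserverKernel {m : ℕ} (p : Params m) (n : Fin m → Fin m → ℝ → ℝ)
    (M : Fin m → ℝ → ℝ → H) (N : ℝ → ℝ → Matrix (Fin m) (Fin m) ℝ) : Prop where
  M_meas : ∀ j, StronglyMeasurable (fun q : ℝ × ℝ => M j q.1 q.2)
  N_meas : ∀ i j, Measurable (fun q : ℝ × ℝ => N q.1 q.2 i j)
  bounded : ∃ C : ℝ, ∀ x ∈ Icc (0 : ℝ) 1, ∀ ξ ∈ Icc (0 : ℝ) x,
    (∀ j, ‖M j x ξ‖ ≤ C) ∧ ∀ i j, |N x ξ i j| ≤ C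
  eq_M : ∀ j, WeakKernelM p M N j
  eq_N : ∀ i j, WeakKernelN p M N i j
  /-- `W(x,y) = M(x,x,y) Λ₋(x) + λ(x,y) M(x,x,y)` -/
  diag_M : ∀ j, ∀ᵐ x ∂muI, ∀ᵐ y ∂muI,
    p.W j x y = M j x x y * p.mu j x + p.lam x y * M j x x y
  /-- `Ψ(x) = N(x,x) Λ₋(x) - Λ₋(x) N(x,x)` -/
  diag_N : ∀ i j, ∀ᵐ x ∂muI, p.Psi x i j = N x x i j * p.mu j x - p.mu i x * N x x i j
  /-- `N_{i,j}(1,ξ) = ∫ R_i(y) M_j(1,ξ,y) dy` for `i ≥ j` -/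
  right_N : ∀ i j, j ≤ i → ∀ᵐ ξ ∂muI, N 1 ξ i j = ∫ y, p.R i y * M j 1 ξ y ∂muI
  /-- `N_{i,j}(x,0) = n_{i,j}(x)` for `i < j` -/
  bottom_N : ∀ i j, i < j → ∀ᵐ x ∂muI, N x 0 i j = n i j x

/-! ### The estimation error dynamics -/

/-- The output injection gain `P₊(x,y) = M(x,0,y) Λ₋(0)`. -/
def gainPlus {m : ℕ} (p : Params m) (M : Fin m → ℝ → ℝ → H) (j : Fin m) (x : ℝ) : H :=
  p.mu j 0 • M j x 0

/-- The output injection gain `P₋(x) = N(x,0) Λ₋(0)`. -/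
def gainMinus {m : ℕ} (p : Params m) (N : ℝ → ℝ → Matrix (Fin m) (Fin m) ℝ) (x : ℝ) :
    Matrix (Fin m) (Fin m) ℝ :=
  N x 0 * Matrix.diagonal (fun j => p.mu j 0)

/-- The graph of the operator of the estimation error dynamics with output injection gains
`P₊, P₋`: the pairs `((u, v), (f, g))` in `E_c × E_c` with `u, v` of class `H¹` in `x`,
`u(0,·) = 0`, `v(1) = ∫ R(y) u(1,y) dy`, and
`f = -λ u_x - P₊ v(0) + ∫ σ u dη + W v`, `g = Λ₋ v_x - P₋ v(0) + ∫ Θ u dy + Ψ v`. -/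
def errorGraph {m : ℕ} (p : Params m) (Pplus : Fin m → ℝ → H)
    (Pminus : ℝ → Matrix (Fin m) (Fin m) ℝ) : Set (Ec m × Ec m) :=
  {zw | ∃ (u u' : ℝ → H) (v v' : ℝ → EuclideanSpace ℝ (Fin m)),
    IsH1 u u' ∧ IsH1 v v' ∧
    (∀ᵐ x ∂muI, zw.1.fst x = u x) ∧ (∀ᵐ x ∂muI, zw.1.snd x = v x) ∧
    u 0 = 0 ∧ (∀ j, v 1 j = ∫ y, p.R j y * u 1 y ∂muI) ∧
    (∀ᵐ x ∂muI, ∀ᵐ y ∂muI,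
      zw.2.fst x y = -p.lam x y * u' x y - (∑ j, Pplus j x y * v 0 j)
        + (∫ η, p.sigma x (y, η) * u x η ∂muI) + ∑ j, p.W j x y * v x j) ∧
    (∀ᵐ x ∂muI, ∀ i,
      zw.2.snd x i = p.mu i x * v' x i - (∑ j, Pminus x i j * v 0 j)
        + (∫ y, p.Theta i x y * u x y ∂muI) + ∑ j, p.Psi x i j * v x j)}

end ContinuumPDE

end

/-! Write the state as `y = (u, v)`, the transport matrix as `a = diag(λ, -Λ₋)`, the zeroth order
coupling as `b` and the injection gain as `P`. The generator is then `-a y' + b y - P v(0)`, with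
`u(0) = 0` and `v(1) = ∫ R u(1)`. Let `k = (M, N)`. Integrated against a function `β` of `ξ`, the
kernel equations and their diagonal conditions say that `a (∫₀ˣ k β)' = b β - P β(0) - ∫₀ˣ k Λ₋ β' +
b ∫₀ˣ k β` (`kint_eq`).

Substitute `y = z + ∫₀ˣ k β` with `z = (α, β)`. All terms in `β` and `β(0)` cancel, and the target
generator is `-a z' + h`, where `h + ∫₀ˣ k h₂ = b (α, 0)` and `h₂` is the second component of `h`
(`IsGen.exists_target`). So `h` is a causal function of `α` alone, and `α` evolves independently of
`β` with zero inflow. The inflow of `β` at `x = 1` is `∫ R α(1) - ∫ G β`, where `G = N(1,·) - ∫ R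
M(1,·)` is strictly upper triangular because of the condition at `x = 1` for `i ≥ j`. The target is
therefore a cascade from `α` through `β_m`, and so on up to `β_1`.

For such a cascade the quadratic functional `∫ A e^{-κx} λ⁻¹ |α|² + ∑ B_j e^x μ_j⁻¹ |β_j|²` is
strictly decreasing when `κ` is large, `B_j` grows geometrically in `j`, and `A` is large after that
(`exists_dissipative_weight`). The square root of the weight composed with the inverse
transformation is a linear homeomorphism `S`, and the generator is strictly dissipative in the norm
`‖S ·‖` (`exists_dissipative`).

The resolvent equation is a linear ODE in `x`. It is solved by shooting: `v(0)` is a vector of `m`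
unknowns, the condition at `x = 1` gives `m` equations, and dissipativity makes this square system
injective, hence solvable (`exists_isGen_resolvent`). A Lumer–Phillips argument with Yosida
approximations then gives existence, uniqueness and decay of weak solutions
(`isExponentiallyStable_of_dissipative`). -/

noncomputable section

namespace ContinuumPDE

open Filter Topology

set_option linter.unusedSectionVars false

/-! ### Lumer–Phillips generation and weak solutions in Hilbert space. -/

section Semigroup

variable {E : Type*} [NormedAddCommGroup E] [InnerProductSpace ℝ E]

/-- The resolvent of a dissipative relation with full range, as a bounded operator. -/
lemma exists_resolvent (G : Submodule ℝ (E × E)) {c s : ℝ} (hc : 0 < c) (hs : 0 < s)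
    (hdiss : ∀ z w, (z, w) ∈ G → inner ℝ w z ≤ -c * ‖z‖ ^ 2)
    (hrange : ∀ f, ∃ z w, (z, w) ∈ G ∧ s • z - w = f) :
    ∃ R : E →L[ℝ] E, (∀ f, (R f, s • R f - f) ∈ G) ∧ (∀ z w, (z, w) ∈ G → R (s • z - w) = z) ∧
      ∀ f, s * ‖R f‖ ≤ ‖f‖ := by
  -- Pairing `s z - w` with `z` even gives the factor `s + c`; the factor `s` is enough for the
  -- sequel.
  have bound : ∀ z w, (z, w) ∈ G → s * ‖z‖ ≤ ‖s • z - w‖ := by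
    intro z w h
    have h1 := hdiss z w h
    have h2 : inner ℝ (s • z - w) z = s * ‖z‖ ^ 2 - inner ℝ w z := by
      rw [inner_sub_left, real_inner_smul_left, real_inner_self_eq_norm_sq]
    have h3 := real_inner_le_norm (s • z - w) z
    rcases (norm_nonneg z).eq_or_lt with h0 | h0
    · rw [← h0]; simp
    · have : s * ‖z‖ * ‖z‖ ≤ ‖s • z - w‖ * ‖z‖ := by nlinarith [sq_nonneg ‖z‖]
      exact le_of_mul_le_mul_right this h0
  have uniq : ∀ z w z' w', (z, w) ∈ G → (z', w') ∈ G → s • z - w = s • z' - w' → z = z' := by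
    intro z w z' w' h h' e
    have hd : (z - z', w - w') ∈ G := G.sub_mem h h'
    have hb := bound _ _ hd
    have : s • (z - z') - (w - w') = 0 := by
      rw [smul_sub]; rw [sub_eq_zero.symm] at e; rw [← e]; abel
    rw [this, norm_zero] at hb
    have : ‖z - z'‖ ≤ 0 := by
      by_contra hcon
      push Not at hcon
      nlinarith
    exact sub_eq_zero.1 (norm_le_zero_iff.1 this)
  choose r w hr hrf using hrange
  have hw : ∀ f, w f = s • r f - f := fun f => by
    nth_rewrite 3 [← hrf f]; abel
  have hmem : ∀ f, (r f, s • r f - f) ∈ G := fun f => hw f ▸ hr f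
  have hinv : ∀ z w, (z, w) ∈ G → r (s • z - w) = z := by
    intro z w h
    refine uniq _ _ _ _ (hmem _) h ?_
    abel
  let Rl : E →ₗ[ℝ] E :=
    { toFun := r
      map_add' := fun f g => by
        have := hinv (r f + r g) _ (G.add_mem (hmem f) (hmem g))
        rw [← this]; congr 1; module
      map_smul' := fun a f => by
        have := hinv (a • r f) _ (G.smul_mem a (hmem f))
        rw [RingHom.id_apply, ← this]; congr 1; module }
  refine ⟨Rl.mkContinuous s⁻¹ ?_, hmem, hinv, ?_⟩
  · intro f
    have := bound _ _ (hmem f)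
    rw [sub_sub_cancel] at this
    change ‖r f‖ ≤ s⁻¹ * ‖f‖
    rw [inv_mul_eq_div, le_div_iff₀ hs]; linarith
  · intro f
    have := bound _ _ (hmem f)
    rwa [sub_sub_cancel] at this

variable [CompleteSpace E]

lemma hasDerivAt_exp_apply (A : E →L[ℝ] E) (y : E) (t : ℝ) :
    HasDerivAt (fun t : ℝ => NormedSpace.exp (t • A) y) (A (NormedSpace.exp (t • A) y)) t := by
  have h := hasDerivAt_exp_smul_const' (𝕂 := ℝ) A t
  exact h.clm_apply (hasDerivAt_const t y) |>.congr_deriv (by simp)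

/-- Exponential decay of `exp (tA)` for a bounded dissipative operator `A`. -/
lemma norm_exp_apply_le (A : E →L[ℝ] E) {c : ℝ} (hA : ∀ x, inner ℝ (A x) x ≤ -c * ‖x‖ ^ 2)
    (y : E) {t : ℝ} (ht : 0 ≤ t) : ‖NormedSpace.exp (t • A) y‖ ≤ Real.exp (-c * t) * ‖y‖ := by
  set f : ℝ → E := fun t => NormedSpace.exp (t • A) y with hf
  have hd : ∀ t, HasDerivAt (fun t => Real.exp (2 * c * t) * ‖f t‖ ^ 2)
      (Real.exp (2 * c * t) * (2 * c) * ‖f t‖ ^ 2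
        + Real.exp (2 * c * t) * (2 * inner ℝ (f t) (A (f t)))) t := by
    intro t
    have h1 : HasDerivAt (fun t : ℝ => Real.exp (2 * c * t)) (Real.exp (2 * c * t) * (2 * c)) t := by
      simpa using ((hasDerivAt_id t).const_mul (2 * c)).exp
    exact h1.mul (hasDerivAt_exp_apply A y t).norm_sq
  -- The derivative is `2 e^{2ct} (c ‖f‖² + ⟪A f, f⟫)`, which is nonpositive by dissipativity.
  have hanti : Antitone (fun t => Real.exp (2 * c * t) * ‖f t‖ ^ 2) := by
    refine antitone_of_deriv_nonpos (fun t => (hd t).differentiableAt) (fun t => ?_)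
    rw [(hd t).deriv]
    have := hA (f t)
    rw [real_inner_comm] at this
    nlinarith [Real.exp_pos (2 * c * t)]
  have h0 := hanti ht
  simp only [hf, zero_smul, NormedSpace.exp_zero, mul_zero, Real.exp_zero, one_mul,
    one_apply_eq_self] at h0
  have e : Real.exp (2 * c * t) = Real.exp (c * t) ^ 2 := by
    rw [← Real.exp_nat_mul]; ring_nf
  rw [e, ← mul_pow] at h0
  have h1 := (sq_le_sq₀ (by positivity) (by positivity)).1 h0
  have : Real.exp (-c * t) = (Real.exp (c * t))⁻¹ := by rw [← Real.exp_neg]; ring_nf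
  rw [this, inv_mul_eq_div, le_div_iff₀ (Real.exp_pos _)]
  linarith


/-- The path `s ↦ exp(tB) exp(s(A - B)) y` joins `exp(tB) y` to `exp(tA) y`. By commutativity its
velocity is `exp(sA) exp((t-s)B) (A - B) y`, and both exponentials are contractions for `0 ≤ s ≤ t`.
Commutativity is what makes the bound depend only on `A y - B y`. -/
lemma norm_exp_sub_exp_apply_le {A B : E →L[ℝ] E} (hAB : Commute A B)
    (hA : ∀ (y : E) (t : ℝ), 0 ≤ t → ‖NormedSpace.exp (t • A) y‖ ≤ ‖y‖)
    (hB : ∀ (y : E) (t : ℝ), 0 ≤ t → ‖NormedSpace.exp (t • B) y‖ ≤ ‖y‖)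
    (y : E) {t : ℝ} (ht : 0 ≤ t) :
    ‖NormedSpace.exp (t • A) y - NormedSpace.exp (t • B) y‖ ≤ ‖A y - B y‖ * t := by
  let _ : NormedAlgebra ℚ (E →L[ℝ] E) := NormedAlgebra.restrictScalars ℚ ℝ _
  set f : ℝ → E := fun s => NormedSpace.exp (t • B) (NormedSpace.exp (s • (A - B)) y) with hf
  have hd : ∀ s ∈ Icc 0 t, HasDerivWithinAt f
      (NormedSpace.exp (t • B) ((A - B) (NormedSpace.exp (s • (A - B)) y))) (Icc 0 t) s := by
    intro s _
    exact ((NormedSpace.exp (t • B)).hasFDerivAt.comp_hasDerivAt s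
      (hasDerivAt_exp_apply (A - B) y s)).hasDerivWithinAt
  have key : ∀ s ∈ Ico 0 t,
      ‖NormedSpace.exp (t • B) ((A - B) (NormedSpace.exp (s • (A - B)) y))‖ ≤ ‖A y - B y‖ := by
    intro s hs
    have e1 : (A - B) * NormedSpace.exp (s • (A - B)) = NormedSpace.exp (s • (A - B)) * (A - B) :=
      ((Commute.refl (A - B)).smul_right s).exp_right.eq
    have e2 : NormedSpace.exp (t • B) * NormedSpace.exp (s • (A - B))
        = NormedSpace.exp (s • A) * NormedSpace.exp ((t - s) • B) := by
      rw [← NormedSpace.exp_add_of_commute, ← NormedSpace.exp_add_of_commute]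
      · congr 1; module
      · exact (hAB.smul_left s).smul_right (t - s)
      · exact (((hAB.symm.sub_right (Commute.refl B))).smul_left t).smul_right s
    have e3 : NormedSpace.exp (t • B) ((A - B) (NormedSpace.exp (s • (A - B)) y))
        = NormedSpace.exp (s • A) (NormedSpace.exp ((t - s) • B) ((A - B) y)) := by
      have h1 := DFunLike.congr_fun e1 y
      have h2 := DFunLike.congr_fun e2 ((A - B) y)
      simp only [mul_apply_eq_comp] at h1 h2
      rw [h1, h2]
    rw [e3]
    refine (hA _ _ hs.1).trans ((hB _ _ (sub_nonneg.2 hs.2.le)).trans ?_)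
    simp
  have := norm_image_sub_le_of_norm_deriv_le_segment' hd key t (right_mem_Icc.2 ht)
  have e0 : f 0 = NormedSpace.exp (t • B) y := by simp [hf]
  have e1 : f t = NormedSpace.exp (t • A) y := by
    have : NormedSpace.exp (t • B) * NormedSpace.exp (t • (A - B)) = NormedSpace.exp (t • A) := by
      rw [← NormedSpace.exp_add_of_commute]
      · congr 1; module
      · exact (((hAB.symm.sub_right (Commute.refl B))).smul_left t).smul_right t
    rw [← this]; rfl
  rwa [e0, e1, sub_zero] at this

/-- Yosida approximations of a maximal dissipative relation: bounded dissipative commuting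
operators `A n`, with contractions `J n → 1` such that `(J n x, A n x)` lies in the relation. -/
lemma exists_yosida (G : Submodule ℝ (E × E)) {c : ℝ} (hc : 0 < c)
    (hdiss : ∀ z w, (z, w) ∈ G → inner ℝ w z ≤ -c * ‖z‖ ^ 2)
    (hsv : ∀ w, (0, w) ∈ G → w = 0)
    (hrange : ∀ s : ℝ, 0 < s → ∀ f, ∃ z w, (z, w) ∈ G ∧ s • z - w = f) :
    ∃ (A J : ℕ → E →L[ℝ] E),
      (∀ n x, inner ℝ (A n x) x ≤ -(min c 1 / 2) * ‖x‖ ^ 2) ∧ (∀ n k, Commute (A n) (A k)) ∧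
      (∀ n x, (J n x, A n x) ∈ G) ∧ (∀ n x, ‖J n x‖ ≤ ‖x‖) ∧
      (∀ x, Tendsto (fun n => J n x) atTop (𝓝 x)) ∧
      ∀ z w, (z, w) ∈ G → Tendsto (fun n => A n z) atTop (𝓝 w) := by
  -- Starting at `1` has two uses: `s 0 = 1` gives the resolvent used for density, and `s n ≥ 1`
  -- makes the dissipation constant uniform in `n`.
  let s : ℕ → ℝ := fun n => n + 1
  have hs : ∀ n, 0 < s n := fun n => by positivity
  have hs1 : ∀ n, 1 ≤ s n := fun n => by simp [s]
  choose R hR1 hR2 hR3 using fun n => exists_resolvent G hc (hs n) hdiss (hrange (s n) (hs n))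
  have hJ : ∀ n x, ‖(s n • R n) x‖ ≤ ‖x‖ := fun n x => by
    rw [smul_apply, norm_smul, Real.norm_of_nonneg (hs n).le]; exact hR3 n x
  -- If `x` is orthogonal to the domain and `z = R 0 x`, then `(z, z - x)` is in `G` and `⟪z - x, z⟫
  -- = ‖z‖²`. Dissipativity forces `z = 0`, hence `(0, -x) ∈ G`, and single-valuedness gives `x =
  -- 0`. Density is thus a consequence and not an assumption.
  have hdense : Dense ((G.map (LinearMap.fst ℝ E E) : Submodule ℝ E) : Set E) := by
    rw [Submodule.dense_iff_topologicalClosure_eq_top, Submodule.topologicalClosure_eq_top_iff,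
      Submodule.eq_bot_iff]
    intro x hx
    rw [Submodule.mem_orthogonal] at hx
    have h0 := hR1 0 x
    have hx0 := hx (R 0 x) ⟨_, h0, rfl⟩
    have h1 := hdiss _ _ h0
    have es : s 0 = 1 := by simp [s]
    rw [es, one_smul] at h0 h1
    rw [inner_sub_left, real_inner_self_eq_norm_sq, real_inner_comm, hx0] at h1
    have h2 : R 0 x = 0 := by
      have : ‖R 0 x‖ ^ 2 ≤ 0 := by nlinarith [sq_nonneg ‖R 0 x‖]
      exact norm_eq_zero.1 (pow_eq_zero_iff two_ne_zero |>.1 (le_antisymm this (sq_nonneg _)))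
    rw [h2, zero_sub] at h0
    exact neg_eq_zero.1 (hsv _ h0)
  have hRlim : ∀ w, Tendsto (fun n => R n w) atTop (𝓝 0) := by
    intro w
    have : Tendsto (fun n : ℕ => (s n)⁻¹ * ‖w‖) atTop (𝓝 0) := by
      have h := (tendsto_natCast_atTop_atTop (R := ℝ)).atTop_add
        (tendsto_const_nhds (x := (1 : ℝ)))
      simpa using (tendsto_inv_atTop_zero.comp h).mul_const ‖w‖
    refine squeeze_zero_norm (fun n => ?_) this
    rw [inv_mul_eq_div, le_div_iff₀ (hs n), mul_comm]; exact hR3 n w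
  have hJlim : ∀ x, Tendsto (fun n => (s n • R n) x) atTop (𝓝 x) := by
    intro x
    rw [Metric.tendsto_atTop]
    intro ε hε
    obtain ⟨z, hz, ⟨⟨z, w⟩, hzw, rfl⟩⟩ := Metric.dense_iff.1 hdense x (ε / 3) (by positivity)
    obtain ⟨N, hN⟩ := Metric.tendsto_atTop.1 (hRlim w) (ε / 3) (by positivity)
    refine ⟨N, fun n hn => ?_⟩
    have h1 := hN n hn
    have h2 := hR2 n z w hzw
    rw [map_sub, map_smul] at h2
    simp only [LinearMap.fst_apply, Metric.mem_ball, dist_eq_norm, sub_zero] at *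
    have : (s n • R n) x - x = (s n • R n) (x - z) + R n w + (z - x) := by
      rw [map_sub, smul_apply, smul_apply]
      nth_rewrite 2 [← h2]; abel
    rw [this]
    have h3 := (hJ n (x - z))
    rw [norm_sub_rev] at h3
    calc _ ≤ ‖(s n • R n) (x - z)‖ + ‖R n w‖ + ‖z - x‖ := norm_add₃_le
      _ < ε := by linarith
  have hA : ∀ n x, (s n • R n) x ∈ Set.univ ∧
      ((s n • R n) x, (s n • (s n • R n - 1)) x) ∈ G := by
    intro n x
    exact ⟨trivial, G.smul_mem (s n) (hR1 n x)⟩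
  have hRcomm : ∀ n k, Commute (R n) (R k) := by
    intro n k
    -- Resolvent identity; exchanging `n` and `k` in it yields commutation because `s n ≠ s k`.
    have key : ∀ n k f, R k f = (s n - s k) • R n (R k f) + R n f := by
      intro n k f
      have := hR2 n _ _ (hR1 k f)
      rw [map_sub, map_smul, map_sub, map_smul] at this
      nth_rewrite 1 [← this]; module
    rcases eq_or_ne n k with rfl | hnk
    · exact Commute.refl _
    ext f
    have h1 := key n k f
    have h2 := key k n f
    have h3 : (s n - s k) • (R n (R k f) - R k (R n f)) = 0 := by
      have : (s n - s k) • (R n (R k f) - R k (R n f))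
        = ((s n - s k) • R n (R k f) + R n f) + ((s k - s n) • R k (R n f) + R k f)
          - R n f - R k f := by module
      rw [this, ← h1, ← h2]; abel
    have h4 : s n - s k ≠ 0 := by simpa [s, sub_eq_zero] using hnk
    exact sub_eq_zero.1 ((smul_eq_zero.1 h3).resolve_left h4)
  refine ⟨fun n => s n • (s n • R n - 1), fun n => s n • R n, ?_, ?_, fun n x => (hA n x).2, hJ,
    hJlim, ?_⟩
  -- With `z = R n x` and `w = s z - x`, one has `x = s z - w` and `A n x = s w`. Hence `⟪A n x, x⟫
  -- = s² ⟪w, z⟫ - s ‖w‖² ≤ -min(c,1) (‖s z‖² + ‖w‖²)`, and the parallelogram bound `‖s z - w‖² ≤ 2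
  -- (‖s z‖² + ‖w‖²)` accounts for the factor `1/2`.
  · intro n x
    have h := hdiss _ _ (hR1 n x)
    have hs' := hs1 n
    obtain ⟨w, hw⟩ : ∃ w, w = s n • R n x - x := ⟨_, rfl⟩
    have e1 : (s n • (s n • R n - 1)) x = s n • w := by simp [hw]
    rw [← hw] at h
    rw [e1, show x = s n • R n x - w by rw [hw]; abel]
    generalize R n x = z at h
    have ha := hs n
    generalize s n = a at *
    rw [real_inner_smul_left, inner_sub_right, real_inner_smul_right, real_inner_self_eq_norm_sq,
      norm_sub_sq_real, norm_smul, real_inner_smul_left, Real.norm_of_nonneg ha.le]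
    have hm1 : min c 1 ≤ c := min_le_left _ _
    have hm2 : min c 1 ≤ 1 := min_le_right _ _
    have hm3 : 0 < min c 1 := lt_min hc one_pos
    have hcs : inner ℝ w z = inner ℝ z w := real_inner_comm _ _
    have hy' : 0 ≤ (a * ‖z‖) ^ 2 + 2 * (a * inner ℝ z w) + ‖w‖ ^ 2 := by
      have := sq_nonneg ‖a • z + w‖
      rw [norm_add_sq_real, norm_smul, real_inner_smul_left, Real.norm_of_nonneg ha.le] at this
      exact this
    rw [hcs] at h ⊢
    have p1 : a * (a * inner ℝ z w) ≤ -c * (a * ‖z‖) ^ 2 := by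
      have := mul_le_mul_of_nonneg_left h (mul_nonneg ha.le ha.le)
      nlinarith
    have p2 : ‖w‖ ^ 2 ≤ a * ‖w‖ ^ 2 := le_mul_of_one_le_left (sq_nonneg _) hs'
    have p3 : min c 1 * (a * ‖z‖) ^ 2 ≤ c * (a * ‖z‖) ^ 2 :=
      mul_le_mul_of_nonneg_right hm1 (sq_nonneg _)
    have p4 : min c 1 * ‖w‖ ^ 2 ≤ ‖w‖ ^ 2 := mul_le_of_le_one_left (sq_nonneg _) hm2
    have p5 := mul_nonneg hm3.le hy'
    nlinarith
  · intro n k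
    have h1 : Commute (s n • R n) (s k • R k) := ((hRcomm n k).smul_left _).smul_right _
    have h2 : Commute (s n • R n - 1) (s k • R k - 1) :=
      ((h1.sub_left (Commute.one_left _))).sub_right (Commute.one_right _)
    exact (h2.smul_left _).smul_right _
  · intro z w hzw
    refine (hJlim w).congr (fun n => ?_)
    have h2 := hR2 n z w hzw
    rw [map_sub, map_smul] at h2
    simp only [smul_apply, sub_apply, one_apply_eq_self]
    exact congrArg _ (sub_eq_of_eq_add' (sub_eq_iff_eq_add.1 h2)).symm


/-- A maximal dissipative relation on a Hilbert space generates an exponentially stable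
evolution. -/
theorem isExponentiallyStable_of_dissipative (G : Submodule ℝ (E × E)) {c : ℝ} (hc : 0 < c)
    (hdiss : ∀ z w, (z, w) ∈ G → inner ℝ w z ≤ -c * ‖z‖ ^ 2)
    (hsv : ∀ w, (0, w) ∈ G → w = 0)
    (hrange : ∀ s : ℝ, 0 < s → ∀ f, ∃ z w, (z, w) ∈ G ∧ s • z - w = f) :
    IsExponentiallyStable (G : Set (E × E)) := by
  obtain ⟨A, J, hA, hcomm, hJA, hJ, hJlim, hAlim⟩ := exists_yosida G hc hdiss hsv hrange
  obtain ⟨R, hR1, hR2, -⟩ := exists_resolvent G hc one_pos hdiss (hrange 1 one_pos)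
  simp only [one_smul] at hR1 hR2
  set c' := min c 1 / 2
  have hc' : 0 < c' := by have := lt_min hc one_pos; positivity
  have hexp : ∀ n y t, 0 ≤ t → ‖NormedSpace.exp (t • A n) y‖ ≤ Real.exp (-c' * t) * ‖y‖ :=
    fun n y t ht => norm_exp_apply_le (A n) (hA n) y ht
  have hcontr : ∀ n y (t : ℝ), 0 ≤ t → ‖NormedSpace.exp (t • A n) y‖ ≤ ‖y‖ := fun n y t ht =>
    (hexp n y t ht).trans (mul_le_of_le_one_left (norm_nonneg _)
      (Real.exp_le_one_iff.2 (by nlinarith)))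
  refine ⟨1, one_pos, c', hc', fun z₀ => ?_⟩
  -- Approximate `z₀` by the domain element `y = J K z₀`, at a cost of `2 ‖z₀ - y‖` by
  -- contractivity. On `y` the difference of exponentials is at most `T ‖A n y - A k y‖`, which is
  -- small since `A n y` converges.
  have hcau : ∀ T : ℝ, 0 ≤ T →
      UniformCauchySeqOn (fun n t => NormedSpace.exp (t • A n) z₀) atTop (Icc 0 T) := by
    intro T hT
    rw [Metric.uniformCauchySeqOn_iff]
    intro ε hε
    obtain ⟨K, hK⟩ := Metric.tendsto_atTop.1 (hJlim z₀) (ε / 4) (by positivity)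
    have hy := hK K le_rfl
    rw [dist_eq_norm, norm_sub_rev] at hy
    set y := J K z₀
    have hcs := (hAlim _ _ (hJA K z₀)).cauchySeq
    obtain ⟨N, hN⟩ := Metric.cauchySeq_iff.1 hcs (ε / (4 * (T + 1))) (by positivity)
    refine ⟨N, fun n hn k hk t ht => ?_⟩
    have h1 := norm_exp_sub_exp_apply_le (hcomm n k) (hcontr n) (hcontr k) y ht.1
    have h2 := hN n hn k hk
    rw [dist_eq_norm] at h2
    have h3 : ‖A n y - A k y‖ * t ≤ ε / 4 := by
      have h3' : ε / (4 * (T + 1)) * (T + 1) = ε / 4 := by field_simp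
      rw [← h3']
      exact mul_le_mul h2.le (by linarith [ht.2]) ht.1 (by positivity)
    have e : NormedSpace.exp (t • A n) z₀ - NormedSpace.exp (t • A k) z₀
        = NormedSpace.exp (t • A n) (z₀ - y) - NormedSpace.exp (t • A k) (z₀ - y)
          + (NormedSpace.exp (t • A n) y - NormedSpace.exp (t • A k) y) := by
      rw [map_sub, map_sub]; abel
    rw [dist_eq_norm, e]
    have h4 := hcontr n (z₀ - y) t ht.1
    have h5 := hcontr k (z₀ - y) t ht.1
    calc _ ≤ _ := norm_add_le _ _
      _ ≤ _ := add_le_add_left (norm_sub_le _ _) _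
      _ < ε := by linarith
  have hlim : ∀ t : ℝ, ∃ l, 0 ≤ t →
      Tendsto (fun n => NormedSpace.exp (t • A n) z₀) atTop (𝓝 l) := by
    intro t
    by_cases ht : 0 ≤ t
    · obtain ⟨l, hl⟩ := cauchySeq_tendsto_of_complete
        ((hcau t ht).cauchySeq (right_mem_Icc.2 ht))
      exact ⟨l, fun _ => hl⟩
    · exact ⟨0, fun h => absurd h ht⟩
  choose z hz using hlim
  have hunif : ∀ T : ℝ, 0 ≤ T →
      TendstoUniformlyOn (fun n t => NormedSpace.exp (t • A n) z₀) z atTop (Icc 0 T) :=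
    fun T hT => (hcau T hT).tendstoUniformlyOn_of_tendsto fun t ht => hz t ht.1
  have hAc : ∀ n, Continuous fun t : ℝ => NormedSpace.exp (t • A n) z₀ := fun n =>
    continuous_iff_continuousAt.2 fun t => (hasDerivAt_exp_apply (A n) z₀ t).continuousAt
  have hcont : ContinuousOn z (Ici 0) := by
    intro t ht
    have h1 : ContinuousOn z (Icc 0 (t + 1)) :=
      (hunif (t + 1) (by linarith [mem_Ici.1 ht])).continuousOn
        (Frequently.of_forall fun n => (hAc n).continuousOn)
    refine (h1 t ⟨ht, by linarith⟩).mono_of_mem_nhdsWithin ?_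
    rw [mem_nhdsWithin]
    exact ⟨Iio (t + 1), isOpen_Iio, by simp, fun s hs => ⟨hs.2, hs.1.le⟩⟩
  have hz0 : z 0 = z₀ := tendsto_nhds_unique (hz 0 le_rfl) (by simp)
  have hweak : IsWeakSolution (G : Set (E × E)) z₀ z := by
    refine ⟨hcont, hz0, fun φ ψ hφ t ht => ?_⟩
    -- Since `(J n e, A n e)` lies in `G`, the adjoint relation turns `⟪A n e, φ⟫` into `⟪J n e,
    -- ψ⟫`. This expression has a limit, whereas `A n e` need not converge.
    have hn : ∀ n, inner ℝ (NormedSpace.exp (t • A n) z₀) φ = inner ℝ z₀ φ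
        + ∫ s in (0 : ℝ)..t, inner ℝ (J n (NormedSpace.exp (s • A n) z₀)) ψ := by
      intro n
      have hd : ∀ s ∈ uIcc 0 t, HasDerivAt (fun s : ℝ => inner ℝ (NormedSpace.exp (s • A n) z₀) φ)
          (inner ℝ (J n (NormedSpace.exp (s • A n) z₀)) ψ) s := by
        intro s _
        rw [← hφ _ _ (hJA n _)]
        simpa using (hasDerivAt_exp_apply (A n) z₀ s).inner ℝ (hasDerivAt_const s φ)
      have hi : IntervalIntegrable
          (fun s : ℝ => inner ℝ (J n (NormedSpace.exp (s • A n) z₀)) ψ) volume 0 t :=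
        (((J n).continuous.comp (hAc n)).inner continuous_const).intervalIntegrable _ _
      rw [intervalIntegral.integral_eq_sub_of_hasDerivAt hd hi]
      simp
    have hL : Tendsto (fun n => inner ℝ (NormedSpace.exp (t • A n) z₀) φ) atTop
        (𝓝 (inner ℝ (z t) φ)) := (hz t ht).inner tendsto_const_nhds
    refine tendsto_nhds_unique hL ?_
    simp_rw [hn]
    refine tendsto_const_nhds.add ?_
    refine intervalIntegral.tendsto_integral_filter_of_dominated_convergence
      (fun _ => ‖z₀‖ * ‖ψ‖) ?_ ?_ (by simp) ?_
    · exact Eventually.of_forall fun n =>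
        (((J n).continuous.comp (hAc n)).inner continuous_const).aestronglyMeasurable
    · refine Eventually.of_forall fun n => ae_of_all _ fun s hs => ?_
      rw [uIoc_of_le ht] at hs
      exact (norm_inner_le_norm _ _).trans (mul_le_mul_of_nonneg_right
        ((hJ n _).trans (hcontr n _ _ hs.1.le)) (norm_nonneg _))
    · refine ae_of_all _ fun s hs => ?_
      rw [uIoc_of_le ht] at hs
      refine Tendsto.inner ?_ tendsto_const_nhds
      -- Split `J n e_n = J n (e_n - z) + J n z`: contractivity handles the first term, strong
      -- convergence of `J n` the second.
      have h1 : Tendsto (fun n => J n (NormedSpace.exp (s • A n) z₀ - z s)) atTop (𝓝 0) := by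
        refine squeeze_zero_norm (fun n => hJ n _) ?_
        have := ((hz s hs.1.le).sub_const (z s)).norm
        rwa [sub_self, norm_zero] at this
      have h2 := h1.add (hJlim (z s))
      rw [zero_add] at h2
      refine h2.congr fun n => ?_
      rw [map_sub]; abel
  refine ⟨z, hweak, ?_, ?_⟩
  · intro z' hz'
    set d : ℝ → E := fun t => z' t - z t
    have hdc : ContinuousOn d (Ici 0) := hz'.1.sub hcont
    -- A weak solution may leave the domain, so uniqueness is proved for the smoothed difference `R
    -- d`. Vectors `R* χ` are admissible test functions, with `A* R* χ = R* χ - χ`, and they show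
    -- that `R d` is differentiable with derivative `R d - d`.
    have hdint : ∀ t, 0 ≤ t → R (d t) = ∫ s in (0 : ℝ)..t, (R (d s) - d s) := by
      intro t ht
      refine ext_inner_right ℝ fun χ => ?_
      have hadj : InAdjointGraph (G : Set (E × E)) (ContinuousLinearMap.adjoint R χ)
          (ContinuousLinearMap.adjoint R χ - χ) := by
        intro a b hab
        rw [ContinuousLinearMap.adjoint_inner_right, inner_sub_right,
          ContinuousLinearMap.adjoint_inner_right, ← inner_sub_left]
        have := hR2 a b hab
        rw [map_sub] at this
        rw [← sub_eq_iff_eq_add'.2 (sub_eq_iff_eq_add.1 this)]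
      have e1 := hz'.2.2 _ _ hadj t ht
      have e2 := hweak.2.2 _ _ hadj t ht
      have hsub : uIcc 0 t ⊆ Ici 0 := by rw [uIcc_of_le ht]; exact Icc_subset_Ici_self
      have i1 : ∀ (f : ℝ → E) (ψ : E), ContinuousOn f (Ici 0) →
          IntervalIntegrable (fun s => inner ℝ (f s) ψ) volume 0 t := fun f ψ hf =>
        ((hf.mono hsub).inner continuousOn_const).intervalIntegrable
      have i2 : IntervalIntegrable (fun s => R (d s) - d s) volume 0 t :=
        (((R.continuous.comp_continuousOn hdc).sub hdc).mono hsub).intervalIntegrable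
      have e3 : inner ℝ (∫ s in (0 : ℝ)..t, (R (d s) - d s)) χ
          = ∫ s in (0 : ℝ)..t, inner ℝ (d s) (ContinuousLinearMap.adjoint R χ - χ) := by
        rw [real_inner_comm, ← innerSL_apply_apply ℝ,
          ← ContinuousLinearMap.intervalIntegral_comp_comm _ i2]
        refine intervalIntegral.integral_congr fun s _ => ?_
        simp only [innerSL_apply_apply]
        rw [real_inner_comm, inner_sub_left, inner_sub_right,
          ContinuousLinearMap.adjoint_inner_right]
      rw [e3, ← ContinuousLinearMap.adjoint_inner_right]
      simp only [d, inner_sub_left _ _ (ContinuousLinearMap.adjoint R χ), e1, e2]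
      simp only [inner_sub_left (z' _) (z _)]
      rw [intervalIntegral.integral_sub (i1 _ _ hz'.1) (i1 _ _ hcont)]
      ring
    have hderiv : ∀ t ∈ Ioi (0 : ℝ), HasDerivAt (fun t => ‖R (d t)‖ ^ 2)
        (2 * inner ℝ (R (d t)) (R (d t) - d t)) t := by
      intro t ht
      have hct : ContinuousOn (fun s => R (d s) - d s) (Ici 0) :=
        (R.continuous.comp_continuousOn hdc).sub hdc
      have hI : HasDerivAt (fun t => ∫ s in (0 : ℝ)..t, (R (d s) - d s)) (R (d t) - d t) t := by
        refine intervalIntegral.integral_hasDerivAt_right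
          ((hct.mono ?_).intervalIntegrable) ?_ (hct.continuousAt (Ici_mem_nhds ht))
        · rw [uIcc_of_le (mem_Ioi.1 ht).le]; exact Icc_subset_Ici_self
        · exact (hct.mono Ioi_subset_Ici_self).stronglyMeasurableAtFilter isOpen_Ioi _ ht
      refine (hI.congr_of_eventuallyEq ?_).norm_sq
      filter_upwards [Ioi_mem_nhds ht] with s hs using hdint s (mem_Ioi.1 hs).le
    -- The pair `(R d, R d - d)` lies in `G`, so dissipativity gives the sign of the derivative.
    -- Once `R d = 0`, the pair reads `(0, -d)` and single-valuedness yields `d = 0`.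
    have hanti : AntitoneOn (fun t => ‖R (d t)‖ ^ 2) (Ici 0) := by
      refine antitoneOn_of_deriv_nonpos (convex_Ici 0)
        ((R.continuous.comp_continuousOn hdc).norm.pow 2) ?_ ?_
      · rw [interior_Ici]
        exact fun t ht => (hderiv t ht).differentiableAt.differentiableWithinAt
      · rw [interior_Ici]
        intro t ht
        rw [(hderiv t ht).deriv, real_inner_comm]
        have := hdiss _ _ (hR1 (d t))
        nlinarith [sq_nonneg ‖R (d t)‖]
    intro t ht
    have h0 : d 0 = 0 := by simp [d, hz0, hz'.2.1]
    have h1 := hanti (mem_Ici.2 le_rfl) ht ht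
    simp only [h0, map_zero, norm_zero] at h1
    have h2 : R (d t) = 0 := by
      rw [← norm_eq_zero, ← pow_eq_zero_iff two_ne_zero]
      exact le_antisymm (by simpa using h1) (sq_nonneg _)
    have h3 := hR1 (d t)
    rw [h2, zero_sub] at h3
    exact sub_eq_zero.1 (neg_eq_zero.1 (hsv _ h3))
  · intro t ht
    rw [one_mul]
    exact le_of_tendsto (hz t ht).norm (Eventually.of_forall fun n => hexp n z₀ t ht)

/-- Exponential stability is invariant under a linear homeomorphism of the state space. -/
theorem IsExponentiallyStable.of_equiv {F : Type*} [NormedAddCommGroup F] [InnerProductSpace ℝ F]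
    [CompleteSpace F] (S : F ≃L[ℝ] E) {G : Set (F × F)}
    (h : IsExponentiallyStable {q : E × E | (S.symm q.1, S.symm q.2) ∈ G}) :
    IsExponentiallyStable G := by
  obtain ⟨C, hC, c, hc, h⟩ := h
  set G' : Set (E × E) := {q : E × E | (S.symm q.1, S.symm q.2) ∈ G}
  have hadj : ∀ φ ψ, InAdjointGraph G' φ ψ →
      InAdjointGraph G (ContinuousLinearMap.adjoint (S : F →L[ℝ] E) φ)
        (ContinuousLinearMap.adjoint (S : F →L[ℝ] E) ψ) := by
    intro φ ψ h z w hzw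
    rw [ContinuousLinearMap.adjoint_inner_right, ContinuousLinearMap.adjoint_inner_right]
    exact h (S z) (S w) (by simpa [G'] using hzw)
  have hadj' : ∀ φ ψ, InAdjointGraph G φ ψ →
      InAdjointGraph G' (ContinuousLinearMap.adjoint (S.symm : E →L[ℝ] F) φ)
        (ContinuousLinearMap.adjoint (S.symm : E →L[ℝ] F) ψ) := by
    intro φ ψ h z w hzw
    rw [ContinuousLinearMap.adjoint_inner_right, ContinuousLinearMap.adjoint_inner_right]
    exact h _ _ hzw
  -- The summand `1` keeps the constant positive when the space is trivial and the operator norms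
  -- vanish.
  refine ⟨‖(S.symm : E →L[ℝ] F)‖ * C * ‖(S : F →L[ℝ] E)‖ + 1, by positivity, c, hc, fun z₀ => ?_⟩
  obtain ⟨z, hz, huniq, hdec⟩ := h (S z₀)
  refine ⟨fun t => S.symm (z t), ⟨S.symm.continuous.comp_continuousOn hz.1, by simp [hz.2.1], ?_⟩,
    ?_, ?_⟩
  · intro φ ψ hφ t ht
    have := hz.2.2 _ _ (hadj' φ ψ hφ) t ht
    simp only [ContinuousLinearMap.adjoint_inner_right] at this
    simpa using this
  · intro z' hz' t ht
    have : IsWeakSolution G' (S z₀) fun t => S (z' t) := by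
      refine ⟨S.continuous.comp_continuousOn hz'.1, by simp [hz'.2.1], fun φ ψ hφ t ht => ?_⟩
      have := hz'.2.2 _ _ (hadj φ ψ hφ) t ht
      simp only [ContinuousLinearMap.adjoint_inner_right] at this
      exact this
    have h1 := huniq _ this ht
    change z' t = S.symm (z t)
    rw [← h1]; simp
  · intro t ht
    have h1 := (S.symm : E →L[ℝ] F).le_opNorm (z t)
    have h2 := (S : F →L[ℝ] E).le_opNorm z₀
    have h3 := hdec t ht
    change ‖S.symm (z t)‖ ≤ _
    have he := Real.exp_pos (-c * t)
    calc ‖S.symm (z t)‖ ≤ ‖(S.symm : E →L[ℝ] F)‖ * (C * Real.exp (-c * t)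
          * (‖(S : F →L[ℝ] E)‖ * ‖z₀‖)) := h1.trans (mul_le_mul_of_nonneg_left
            (h3.trans (mul_le_mul_of_nonneg_left h2 (by positivity))) (norm_nonneg _))
      _ ≤ _ := by nlinarith [mul_nonneg he.le (norm_nonneg z₀)]

end Semigroup

/-! ### Vector-valued absolutely continuous functions and their product rule. -/

section Primitive

variable {X Y Z : Type*} [NormedAddCommGroup X] [NormedSpace ℝ X] [NormedAddCommGroup Y]
  [NormedSpace ℝ Y] [NormedAddCommGroup Z] [NormedSpace ℝ Z]

lemma integrable_bilin {μ : Measure ℝ} (B : X →L[ℝ] Y →L[ℝ] Z) {f : ℝ → X} {g : ℝ → Y} {K : ℝ}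
    (hf : Integrable f μ) (hg : AEStronglyMeasurable g μ) (hK : ∀ᵐ s ∂μ, ‖g s‖ ≤ K) :
    Integrable (fun s => B (f s) (g s)) μ := by
  refine Integrable.mono' (hf.norm.const_mul (‖B‖ * K))
    (B.aestronglyMeasurable_comp₂ hf.aestronglyMeasurable hg) ?_
  filter_upwards [hK] with s hs
  calc ‖B (f s) (g s)‖ ≤ ‖B‖ * ‖f s‖ * ‖g s‖ := B.le_opNorm₂ _ _
    _ ≤ ‖B‖ * ‖f s‖ * K := by gcongr
    _ = ‖B‖ * K * ‖f s‖ := by ring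

variable [CompleteSpace X] [CompleteSpace Y] [CompleteSpace Z]

/-- Integration by parts for the primitives of two integrable functions. -/
lemma bilin_integral_integral (B : X →L[ℝ] Y →L[ℝ] Z) {f : ℝ → X} {g : ℝ → Y} {x : ℝ}
    (hx : 0 ≤ x) (hf : IntervalIntegrable f volume 0 x) (hg : IntervalIntegrable g volume 0 x) :
    B (∫ s in (0 : ℝ)..x, f s) (∫ t in (0 : ℝ)..x, g t)
      = (∫ s in (0 : ℝ)..x, B (f s) (∫ t in (0 : ℝ)..s, g t))
        + ∫ t in (0 : ℝ)..x, B (∫ s in (0 : ℝ)..t, f s) (g t) := by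
  rw [intervalIntegrable_iff_integrableOn_Ioc_of_le hx] at hf hg
  set ν := (volume : Measure ℝ).restrict (Ioc 0 x)
  have hint : Integrable (fun p : ℝ × ℝ => B (f p.1) (g p.2)) (ν.prod ν) := by
    refine Integrable.mono' ((hf.norm.mul_prod hg.norm).const_mul ‖B‖)
      (B.aestronglyMeasurable_comp₂ hf.aestronglyMeasurable.comp_fst
        hg.aestronglyMeasurable.comp_snd) (ae_of_all _ fun p => ?_)
    rw [← mul_assoc]; exact B.le_opNorm₂ _ _
  -- By Fubini the left side is an integral over the square `(0,x]²`. The triangles `t ≤ s` and `s <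
  -- t` give the two terms on the right.
  have hS : MeasurableSet {p : ℝ × ℝ | p.2 ≤ p.1} := measurableSet_le measurable_snd measurable_fst
  have h1 : B (∫ s, f s ∂ν) (∫ t, g t ∂ν) = ∫ p, B (f p.1) (g p.2) ∂(ν.prod ν) := by
    rw [integral_prod _ hint, ← B.flip_apply, ← ContinuousLinearMap.integral_comp_comm _ hf]
    refine integral_congr_ae (ae_of_all _ fun s => ?_)
    simp only [B.flip_apply]
    exact (ContinuousLinearMap.integral_comp_comm _ hg).symm
  have h2 : ∫ p in {p : ℝ × ℝ | p.2 ≤ p.1}, B (f p.1) (g p.2) ∂(ν.prod ν)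
      = ∫ s, B (f s) (∫ t in (0 : ℝ)..s, g t) ∂ν := by
    rw [← integral_indicator hS, integral_prod _ (hint.indicator hS)]
    refine setIntegral_congr_fun measurableSet_Ioc fun s hs => ?_
    have : (fun t => ({p : ℝ × ℝ | p.2 ≤ p.1}.indicator
        (fun p : ℝ × ℝ => B (f p.1) (g p.2))) (s, t)) = (Iic s).indicator fun t => B (f s) (g t) := by
      ext t; simp [indicator]
    simp only [this]
    rw [integral_indicator measurableSet_Iic, Measure.restrict_restrict measurableSet_Iic,
      intervalIntegral.integral_of_le hs.1.le,
      show Iic s ∩ Ioc 0 x = Ioc 0 s by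
        ext t; simp only [mem_inter_iff, mem_Iic, mem_Ioc]
        exact ⟨fun h => ⟨h.2.1, h.1⟩, fun h => ⟨h.2, h.1, h.2.trans hs.2⟩⟩]
    exact ContinuousLinearMap.integral_comp_comm _ (hg.mono_set (Ioc_subset_Ioc_right hs.2))
  have h3 : ∫ p in {p : ℝ × ℝ | p.2 ≤ p.1}ᶜ, B (f p.1) (g p.2) ∂(ν.prod ν)
      = ∫ t, B (∫ s in (0 : ℝ)..t, f s) (g t) ∂ν := by
    rw [← integral_indicator hS.compl, integral_prod_symm _ (hint.indicator hS.compl)]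
    refine setIntegral_congr_fun measurableSet_Ioc fun t ht => ?_
    have : (fun s => ({p : ℝ × ℝ | p.2 ≤ p.1}ᶜ.indicator
        (fun p : ℝ × ℝ => B (f p.1) (g p.2))) (s, t)) = (Iio t).indicator fun s => B (f s) (g t) := by
      ext s; simp [indicator]
    simp only [this]
    rw [integral_indicator measurableSet_Iio, Measure.restrict_restrict measurableSet_Iio,
      intervalIntegral.integral_of_le ht.1.le,
      show Iio t ∩ Ioc 0 x = Ioo 0 t by
        ext s; simp only [mem_inter_iff, mem_Iio, mem_Ioc, mem_Ioo]
        exact ⟨fun h => ⟨h.2.1, h.1⟩, fun h => ⟨h.2, h.1, h.2.le.trans ht.2⟩⟩]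
    rw [← integral_Ioc_eq_integral_Ioo, ← B.flip_apply]
    rw [← ContinuousLinearMap.integral_comp_comm _ (hf.mono_set (Ioc_subset_Ioc_right ht.2))]
    rfl
  simp only [intervalIntegral.integral_of_le hx]
  rw [h1, ← integral_add_compl hS hint, h2, h3]

/-- `f` is absolutely continuous on `[0,1]` with derivative `f'`. -/
def IsPrim (f f' : ℝ → X) : Prop :=
  IntervalIntegrable f' volume 0 1 ∧ ∀ x ∈ Icc (0 : ℝ) 1, f x = f 0 + ∫ s in (0 : ℝ)..x, f' s

lemma IsH1.isPrim {f f' : ℝ → X} (h : IsH1 f f') : IsPrim f f' := by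
  refine ⟨?_, h.2⟩
  rw [intervalIntegrable_iff_integrableOn_Icc_of_le zero_le_one]
  exact h.1.integrable one_le_two

lemma IsPrim.intervalIntegrable {f f' : ℝ → X} (h : IsPrim f f') {x : ℝ} (hx : x ∈ Icc (0 : ℝ) 1) :
    IntervalIntegrable f' volume 0 x :=
  h.1.mono_set (by rw [uIcc_of_le hx.1, uIcc_of_le zero_le_one]; exact Icc_subset_Icc_right hx.2)

lemma IsPrim.continuousOn {f f' : ℝ → X} (h : IsPrim f f') : ContinuousOn f (Icc 0 1) := by
  have h1 := intervalIntegral.continuousOn_primitive_interval' h.1 (left_mem_uIcc)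
  rw [uIcc_of_le zero_le_one] at h1
  exact (continuousOn_const.add h1).congr h.2

lemma IsPrim.integrableOn {f f' : ℝ → X} (h : IsPrim f f') : Integrable f' muI := by
  rw [← IntegrableOn, ← intervalIntegrable_iff_integrableOn_Icc_of_le zero_le_one]; exact h.1

/-- The product rule for absolutely continuous functions. -/
lemma IsPrim.bilin (B : X →L[ℝ] Y →L[ℝ] Z) {f f' : ℝ → X} {g g' : ℝ → Y}
    (hf : IsPrim f f') (hg : IsPrim g g') :
    IsPrim (fun x => B (f x) (g x)) (fun x => B (f' x) (g x) + B (f x) (g' x)) := by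
  obtain ⟨K, hK⟩ := (isCompact_Icc.image_of_continuousOn hg.continuousOn).isBounded.exists_norm_le
  obtain ⟨K', hK'⟩ := (isCompact_Icc.image_of_continuousOn hf.continuousOn).isBounded.exists_norm_le
  have i1 : Integrable (fun x => B (f' x) (g x)) muI :=
    integrable_bilin B hf.integrableOn (hg.continuousOn.aestronglyMeasurable measurableSet_Icc)
      ((ae_restrict_iff' measurableSet_Icc).2 (ae_of_all _ fun s hs => hK _ ⟨s, hs, rfl⟩))
  have i2 : Integrable (fun x => B (f x) (g' x)) muI :=
    integrable_bilin B.flip hg.integrableOn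
      (hf.continuousOn.aestronglyMeasurable measurableSet_Icc)
      ((ae_restrict_iff' measurableSet_Icc).2 (ae_of_all _ fun s hs => hK' _ ⟨s, hs, rfl⟩))
  refine ⟨?_, fun x hx => ?_⟩
  · rw [intervalIntegrable_iff_integrableOn_Icc_of_le zero_le_one]; exact i1.add i2
  have sub : Ioc 0 x ⊆ Icc 0 1 := fun s hs => ⟨hs.1.le, hs.2.trans hx.2⟩
  have j1 : IntervalIntegrable (fun x => B (f' x) (g x)) volume 0 x := by
    rw [intervalIntegrable_iff_integrableOn_Ioc_of_le hx.1]; exact IntegrableOn.mono_set i1 sub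
  have j2 : IntervalIntegrable (fun x => B (f x) (g' x)) volume 0 x := by
    rw [intervalIntegrable_iff_integrableOn_Ioc_of_le hx.1]; exact IntegrableOn.mono_set i2 sub
  have hfi := hf.intervalIntegrable hx
  have hgi := hg.intervalIntegrable hx
  have k1 : IntervalIntegrable (fun s => B (f' s) (g 0)) volume 0 x :=
    ⟨(B.flip (g 0)).integrable_comp hfi.1, (B.flip (g 0)).integrable_comp hfi.2⟩
  have k2 : IntervalIntegrable (fun s => B (f 0) (g' s)) volume 0 x :=
    ⟨(B (f 0)).integrable_comp hgi.1, (B (f 0)).integrable_comp hgi.2⟩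
  have e1 : ∀ s ∈ uIcc 0 x, B (f' s) (∫ t in (0 : ℝ)..s, g' t) = B (f' s) (g s) - B (f' s) (g 0) := by
    intro s hs
    rw [uIcc_of_le hx.1] at hs
    rw [hg.2 s ⟨hs.1, hs.2.trans hx.2⟩, map_add]; abel
  have e2 : ∀ s ∈ uIcc 0 x, B (∫ t in (0 : ℝ)..s, f' t) (g' s) = B (f s) (g' s) - B (f 0) (g' s) := by
    intro s hs
    rw [uIcc_of_le hx.1] at hs
    rw [hf.2 s ⟨hs.1, hs.2.trans hx.2⟩, map_add, add_apply]; abel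
  have key := bilin_integral_integral B hx.1 hfi hgi
  rw [intervalIntegral.integral_congr e1, intervalIntegral.integral_congr e2,
    intervalIntegral.integral_sub j1 k1, intervalIntegral.integral_sub j2 k2] at key
  have k3 : ∫ s in (0 : ℝ)..x, B (f' s) (g 0) = B (∫ s in (0 : ℝ)..x, f' s) (g 0) :=
    ContinuousLinearMap.intervalIntegral_comp_comm (B.flip (g 0)) hfi
  have k4 : ∫ s in (0 : ℝ)..x, B (f 0) (g' s) = B (f 0) (∫ s in (0 : ℝ)..x, g' s) :=
    ContinuousLinearMap.intervalIntegral_comp_comm (B (f 0)) hgi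
  beta_reduce
  rw [intervalIntegral.integral_add j1 j2, hf.2 x hx, hg.2 x hx]
  simp only [map_add, add_apply]
  rw [key, k3, k4]; abel

lemma isPrim_of_hasDerivAt {f f' : ℝ → X} (h : ∀ x, HasDerivAt f (f' x) x) (hf' : Continuous f') :
    IsPrim f f' := by
  refine ⟨hf'.intervalIntegrable _ _, fun x _ => ?_⟩
  rw [intervalIntegral.integral_eq_sub_of_hasDerivAt (fun y _ => h y) (hf'.intervalIntegrable _ _)]
  abel

end Primitive

/-! ### Multiplication operators, Volterra operators and weighted estimates in `L²`. -/

section LTwo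

lemma ae_muI {P : ℝ → Prop} : (∀ᵐ x ∂muI, P x) ↔ ∀ᵐ x, x ∈ Icc (0 : ℝ) 1 → P x :=
  ae_restrict_iff' measurableSet_Icc

lemma ae_muI_of_forall {P : ℝ → Prop} (h : ∀ x ∈ Icc (0 : ℝ) 1, P x) : ∀ᵐ x ∂muI, P x :=
  ae_muI.2 (ae_of_all _ h)

lemma integral_muI {X : Type*} [NormedAddCommGroup X] [NormedSpace ℝ X] (f : ℝ → X) :
    ∫ x, f x ∂muI = ∫ x in (0 : ℝ)..1, f x := by
  rw [intervalIntegral.integral_of_le zero_le_one, integral_Icc_eq_integral_Ioc]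

lemma integrable_muI {X : Type*} [NormedAddCommGroup X] {f : ℝ → X} :
    Integrable f muI ↔ IntervalIntegrable f volume 0 1 :=
  (intervalIntegrable_iff_integrableOn_Icc_of_le zero_le_one).symm

lemma intervalIntegrable_of_muI {X : Type*} [NormedAddCommGroup X] {f : ℝ → X}
    (hf : Integrable f muI) {x : ℝ} (hx : x ∈ Icc (0 : ℝ) 1) : IntervalIntegrable f volume 0 x := by
  rw [intervalIntegrable_iff_integrableOn_Ioc_of_le hx.1]
  exact IntegrableOn.mono_set hf fun s hs => ⟨hs.1.le, hs.2.trans hx.2⟩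

/-- Two functions equal a.e. on `[0,1]` have equal integrals over `[0,x]`. -/
lemma integral_congr_muI {X : Type*} [NormedAddCommGroup X] [NormedSpace ℝ X] {f g : ℝ → X}
    (h : ∀ᵐ s ∂muI, f s = g s) {x : ℝ} (hx : x ∈ Icc (0 : ℝ) 1) :
    ∫ s in (0 : ℝ)..x, f s = ∫ s in (0 : ℝ)..x, g s := by
  refine intervalIntegral.integral_congr_ae ?_
  filter_upwards [ae_muI.1 h] with s hs hsx
  rw [uIoc_of_le hx.1] at hsx
  exact hs ⟨hsx.1.le, hsx.2.trans hx.2⟩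

lemma integral_mono_muI {f g : ℝ → ℝ} (hf : Integrable f muI) (hg : Integrable g muI)
    {x : ℝ} (h : ∀ᵐ s ∂muI, s ≤ x → f s ≤ g s) (hx : x ∈ Icc (0 : ℝ) 1) :
    ∫ s in (0 : ℝ)..x, f s ≤ ∫ s in (0 : ℝ)..x, g s := by
  refine intervalIntegral.integral_mono_ae_restrict hx.1 (intervalIntegrable_of_muI hf hx)
    (intervalIntegrable_of_muI hg hx) ?_
  refine (ae_restrict_iff' measurableSet_Icc).2 ?_
  filter_upwards [ae_muI.1 h] with s hs hsx using hs ⟨hsx.1, hsx.2.trans hx.2⟩ hsx.2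

lemma integral_mono_right {f : ℝ → ℝ} (hf : Integrable f muI) (h0 : ∀ s, 0 ≤ f s) {x y : ℝ}
    (hx : 0 ≤ x) (hxy : x ≤ y) (hy : y ≤ 1) :
    ∫ s in (0 : ℝ)..x, f s ≤ ∫ s in (0 : ℝ)..y, f s :=
  intervalIntegral.integral_mono_interval le_rfl hx hxy (ae_of_all _ h0)
    (intervalIntegrable_of_muI hf ⟨hx.trans hxy, hy⟩)

variable {X Y Z : Type*} [NormedAddCommGroup X] [InnerProductSpace ℝ X] [CompleteSpace X]
  [NormedAddCommGroup Y] [InnerProductSpace ℝ Y] [CompleteSpace Y]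
  [NormedAddCommGroup Z] [InnerProductSpace ℝ Z] [CompleteSpace Z]

lemma integrable_norm_sq {f : ℝ → X} (hf : MemLp f 2 muI) :
    Integrable (fun x => ‖f x‖ ^ 2) muI := hf.integrable_norm_pow two_ne_zero

lemma norm_sq_eq_integral (f : Lp X 2 muI) : ‖f‖ ^ 2 = ∫ s in (0 : ℝ)..1, ‖f s‖ ^ 2 := by
  rw [← real_inner_self_eq_norm_sq, L2.inner_def, integral_muI]
  simp

/-- A bounded measurable field of operators. -/
def IsMult (B : ℝ → Z →L[ℝ] Y) : Prop :=
  AEStronglyMeasurable B muI ∧ ∃ C, ∀ᵐ x ∂muI, ‖B x‖ ≤ C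

lemma IsMult.of_continuousOn {B : ℝ → Z →L[ℝ] Y} (hB : ContinuousOn B (Icc 0 1)) : IsMult B := by
  obtain ⟨K, hK⟩ := (isCompact_Icc.image_of_continuousOn hB).isBounded.exists_norm_le
  exact ⟨hB.aestronglyMeasurable measurableSet_Icc, K,
    ae_muI_of_forall fun s hs => hK _ ⟨s, hs, rfl⟩⟩

lemma IsMult.memLp {B : ℝ → Z →L[ℝ] Y} (h : IsMult B) {f : ℝ → Z} (hf : MemLp f 2 muI) :
    MemLp (fun x => B x (f x)) 2 muI := by
  obtain ⟨C, hC⟩ := h.2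
  refine hf.of_le_mul (c := C) ((ContinuousLinearMap.id ℝ (Z →L[ℝ] Y)).aestronglyMeasurable_comp₂
    h.1 hf.1) ?_
  filter_upwards [hC] with x hx
  exact (B x).le_of_opNorm_le hx _

/-- Common constructor for the multiplication, Volterra and Hilbert–Schmidt operators: each is given
by a formula whose linearity holds only almost everywhere. -/
lemma exists_clm (F : Lp Z 2 muI → ℝ → Y) (C : ℝ) (hF : ∀ f, MemLp (F f) 2 muI)
    (hadd : ∀ f g, F (f + g) =ᵐ[muI] F f + F g) (hsmul : ∀ (c : ℝ) f, F (c • f) =ᵐ[muI] c • F f)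
    (hbd : ∀ f, ‖(hF f).toLp‖ ≤ C * ‖f‖) :
    ∃ T : Lp Z 2 muI →L[ℝ] Lp Y 2 muI, ∀ f, T f =ᵐ[muI] F f := by
  let T : Lp Z 2 muI →ₗ[ℝ] Lp Y 2 muI :=
    { toFun := fun f => (hF f).toLp
      map_add' := fun f g => by
        rw [← MemLp.toLp_add]; exact (MemLp.toLp_eq_toLp_iff _ _).2 (hadd f g)
      map_smul' := fun c f => by
        rw [RingHom.id_apply, ← MemLp.toLp_const_smul]
        exact (MemLp.toLp_eq_toLp_iff _ _).2 (hsmul c f) }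
  exact ⟨T.mkContinuous C hbd, fun f => (hF f).coeFn_toLp⟩

lemma IsMult.exists_op {B : ℝ → Z →L[ℝ] Y} (h : IsMult B) :
    ∃ T : Lp Z 2 muI →L[ℝ] Lp Y 2 muI, ∀ f, T f =ᵐ[muI] fun x => B x (f x) := by
  obtain ⟨C, hC⟩ := h.2
  refine exists_clm (fun f x => B x (f x)) C (fun f => h.memLp (Lp.memLp f)) ?_ ?_ ?_
  · intro f g
    filter_upwards [Lp.coeFn_add f g] with x hx
    rw [Pi.add_apply, hx, Pi.add_apply, map_add]
  · intro c f
    filter_upwards [Lp.coeFn_smul c f] with x hx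
    simp [hx]
  · intro f
    refine Lp.norm_le_mul_norm_of_ae_le_mul ?_
    filter_upwards [hC, (h.memLp (Lp.memLp f)).coeFn_toLp] with x hx hx'
    rw [hx']
    exact (B x).le_of_opNorm_le hx _

/-- The multiplication operator by a field of operators. -/
def IsMult.op {B : ℝ → Z →L[ℝ] Y} (h : IsMult B) : Lp Z 2 muI →L[ℝ] Lp Y 2 muI :=
  h.exists_op.choose

lemma IsMult.op_ae {B : ℝ → Z →L[ℝ] Y} (h : IsMult B) (f : Lp Z 2 muI) :
    h.op f =ᵐ[muI] fun x => B x (f x) := h.exists_op.choose_spec f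

/-- A bounded measurable operator-valued kernel on the triangle `0 ≤ ξ ≤ x ≤ 1`. -/
def IsKer (k : ℝ → ℝ → Z →L[ℝ] Y) : Prop :=
  StronglyMeasurable (Function.uncurry k) ∧
    ∃ C, 0 ≤ C ∧ ∀ x ∈ Icc (0 : ℝ) 1, ∀ ξ ∈ Icc 0 x, ‖k x ξ‖ ≤ C

lemma IsKer.integrable {k : ℝ → ℝ → Z →L[ℝ] Y} (h : IsKer k) {f : ℝ → Z} (hf : MemLp f 2 muI)
    {x : ℝ} (hx : x ∈ Icc (0 : ℝ) 1) :
    IntervalIntegrable (fun ξ => k x ξ (f ξ)) volume 0 x := by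
  obtain ⟨C, hC0, hC⟩ := h.2
  rw [intervalIntegrable_iff_integrableOn_Ioc_of_le hx.1]
  have hfi : IntegrableOn f (Ioc 0 x) volume :=
    IntegrableOn.mono_set (hf.integrable one_le_two) fun s hs => ⟨hs.1.le, hs.2.trans hx.2⟩
  refine Integrable.mono' (hfi.norm.const_mul C)
    ((ContinuousLinearMap.id ℝ (Z →L[ℝ] Y)).aestronglyMeasurable_comp₂
      (h.1.comp_measurable measurable_prodMk_left).aestronglyMeasurable hfi.aestronglyMeasurable) ?_
  rw [ae_restrict_iff' measurableSet_Ioc]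
  exact ae_of_all _ fun s hs => (k x s).le_of_opNorm_le (hC x hx s ⟨hs.1.le, hs.2⟩) _

/-- Cauchy–Schwarz on an interval of length at most one, obtained from the nonnegativity of the
integral of `(‖f‖ - a)²` with `a = ∫ ‖f‖`. -/
lemma sq_integral_norm_le {f : ℝ → Z} (hf : MemLp f 2 muI) {x : ℝ} (hx : x ∈ Icc (0 : ℝ) 1) :
    (∫ s in (0 : ℝ)..x, ‖f s‖) ^ 2 ≤ ∫ s in (0 : ℝ)..x, ‖f s‖ ^ 2 := by
  set a := ∫ s in (0 : ℝ)..x, ‖f s‖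
  have i1 := intervalIntegrable_of_muI (integrable_norm_sq hf) hx
  have i2 := intervalIntegrable_of_muI (hf.integrable one_le_two).norm hx
  have h0 : 0 ≤ ∫ s in (0 : ℝ)..x, (‖f s‖ - a) ^ 2 :=
    intervalIntegral.integral_nonneg hx.1 fun s _ => sq_nonneg _
  have h1 : ∫ s in (0 : ℝ)..x, (‖f s‖ - a) ^ 2
      = (∫ s in (0 : ℝ)..x, ‖f s‖ ^ 2) - 2 * a * a + a ^ 2 * x := by
    have : ∀ s, (‖f s‖ - a) ^ 2 = ‖f s‖ ^ 2 - 2 * a * ‖f s‖ + a ^ 2 := fun s => by ring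
    simp_rw [this]
    rw [intervalIntegral.integral_add (i1.sub (i2.const_mul _)) (by simp),
      intervalIntegral.integral_sub i1 (i2.const_mul _), intervalIntegral.integral_const_mul]
    simp [a, mul_comm]
  nlinarith [sq_nonneg a, hx.2]

/-- The Volterra integral operator of a bounded kernel is bounded pointwise. -/
lemma IsKer.norm_sq_le {k : ℝ → ℝ → Z →L[ℝ] Y} (h : IsKer k) : ∃ C, 0 ≤ C ∧
    ∀ f : ℝ → Z, MemLp f 2 muI → ∀ x ∈ Icc (0 : ℝ) 1,
      ‖∫ ξ in (0 : ℝ)..x, k x ξ (f ξ)‖ ^ 2 ≤ C * ∫ s in (0 : ℝ)..x, ‖f s‖ ^ 2 := by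
  obtain ⟨C, hC0, hC⟩ := h.2
  refine ⟨C ^ 2, by positivity, fun f hf x hx => ?_⟩
  have i2 := intervalIntegrable_of_muI (hf.integrable one_le_two).norm hx
  have h1 : ‖∫ ξ in (0 : ℝ)..x, k x ξ (f ξ)‖ ≤ C * ∫ s in (0 : ℝ)..x, ‖f s‖ := by
    rw [← intervalIntegral.integral_const_mul]
    refine intervalIntegral.norm_integral_le_of_norm_le hx.1 (ae_of_all _ fun s hs => ?_)
      (i2.const_mul C)
    exact (k x s).le_of_opNorm_le (hC x hx s ⟨hs.1.le, hs.2⟩) _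
  have h2 := sq_integral_norm_le hf hx
  have h3 := pow_le_pow_left₀ (norm_nonneg _) h1 2
  rw [mul_pow] at h3
  exact h3.trans (mul_le_mul_of_nonneg_left h2 (by positivity))

lemma IsKer.memLp {k : ℝ → ℝ → Z →L[ℝ] Y} (h : IsKer k) {f : ℝ → Z} (hf : MemLp f 2 muI) :
    MemLp (fun x => ∫ ξ in (0 : ℝ)..x, k x ξ (f ξ)) 2 muI := by
  obtain ⟨C, hC0, hC⟩ := h.norm_sq_le
  -- A strongly measurable representative makes the integrand jointly measurable on the triangle, so
  -- that the parametric integral is measurable in `x`.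
  set g := hf.1.mk f
  have hg : StronglyMeasurable g := hf.1.stronglyMeasurable_mk
  have hS : MeasurableSet {p : ℝ × ℝ | p.2 ≤ p.1} := measurableSet_le measurable_snd measurable_fst
  have hm : StronglyMeasurable ({p : ℝ × ℝ | p.2 ≤ p.1}.indicator
      fun p : ℝ × ℝ => k p.1 p.2 (g p.2)) := by
    refine StronglyMeasurable.indicator ?_ hS
    exact (isBoundedBilinearMap_apply (𝕜 := ℝ) (E := Z) (F := Y)).continuous.comp_stronglyMeasurable
      (h.1.prodMk (hg.comp_measurable measurable_snd))
  have hmeas : AEStronglyMeasurable (fun x => ∫ ξ in (0 : ℝ)..x, k x ξ (f ξ)) muI := by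
    refine ⟨_, hm.integral_prod_right' (ν := muI), ae_muI_of_forall fun x hx => ?_⟩
    have e1 : (fun ξ => {p : ℝ × ℝ | p.2 ≤ p.1}.indicator
        (fun p : ℝ × ℝ => k p.1 p.2 (g p.2)) (x, ξ)) = (Iic x).indicator fun ξ => k x ξ (g ξ) := by
      ext t; simp [indicator]
    beta_reduce
    rw [e1, integral_indicator measurableSet_Iic, Measure.restrict_restrict measurableSet_Iic,
      show Iic x ∩ Icc 0 1 = Icc 0 x by
        ext t; simp only [mem_inter_iff, mem_Iic, mem_Icc]
        exact ⟨fun h => ⟨h.2.1, h.1⟩, fun h => ⟨h.2, h.1, h.2.trans hx.2⟩⟩,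
      integral_Icc_eq_integral_Ioc, ← intervalIntegral.integral_of_le hx.1]
    refine integral_congr_muI ?_ hx
    filter_upwards [hf.1.ae_eq_mk] with s hs
    rw [hs]
  refine MemLp.of_bound hmeas (Real.sqrt (C * ∫ s in (0 : ℝ)..1, ‖f s‖ ^ 2))
    (ae_muI_of_forall fun x hx => ?_)
  refine Real.le_sqrt_of_sq_le ((hC f hf x hx).trans (mul_le_mul_of_nonneg_left ?_ hC0))
  exact integral_mono_right (integrable_norm_sq hf) (fun _ => sq_nonneg _) hx.1 hx.2 le_rfl

lemma IsKer.exists_op {k : ℝ → ℝ → Z →L[ℝ] Y} (h : IsKer k) :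
    ∃ T : Lp Z 2 muI →L[ℝ] Lp Y 2 muI,
      ∀ f, T f =ᵐ[muI] fun x => ∫ ξ in (0 : ℝ)..x, k x ξ (f ξ) := by
  obtain ⟨C, hC0, hC⟩ := h.norm_sq_le
  refine exists_clm (fun f x => ∫ ξ in (0 : ℝ)..x, k x ξ (f ξ)) (Real.sqrt C)
    (fun f => h.memLp (Lp.memLp f)) ?_ ?_ ?_
  · intro f g
    refine ae_muI_of_forall fun x hx => ?_
    rw [Pi.add_apply, ← intervalIntegral.integral_add (h.integrable (Lp.memLp f) hx)
      (h.integrable (Lp.memLp g) hx)]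
    refine integral_congr_muI ?_ hx
    filter_upwards [Lp.coeFn_add f g] with s hs
    rw [hs, Pi.add_apply, map_add]
  · intro c f
    refine ae_muI_of_forall fun x hx => ?_
    rw [Pi.smul_apply, ← intervalIntegral.integral_smul]
    refine integral_congr_muI ?_ hx
    filter_upwards [Lp.coeFn_smul c f] with s hs
    simp [hs]
  · intro f
    refine (sq_le_sq₀ (norm_nonneg _) (by positivity)).1 ?_
    rw [mul_pow, Real.sq_sqrt hC0, norm_sq_eq_integral, norm_sq_eq_integral]
    have hm := h.memLp (Lp.memLp f)
    calc _ ≤ ∫ s in (0 : ℝ)..1, C * ∫ s in (0 : ℝ)..1, ‖f s‖ ^ 2 := by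
          refine integral_mono_muI (integrable_norm_sq (Lp.memLp _)) (integrable_const _) ?_
            (right_mem_Icc.2 zero_le_one)
          filter_upwards [hm.coeFn_toLp, ae_muI_of_forall fun x hx => hx] with x hx hx' _
          rw [hx]
          refine (hC f (Lp.memLp f) x hx').trans (mul_le_mul_of_nonneg_left ?_ hC0)
          exact integral_mono_right (integrable_norm_sq (Lp.memLp f)) (fun _ => sq_nonneg _)
            hx'.1 hx'.2 le_rfl
      _ = _ := by simp

/-- The Volterra integral operator of a bounded kernel. -/
def IsKer.op {k : ℝ → ℝ → Z →L[ℝ] Y} (h : IsKer k) : Lp Z 2 muI →L[ℝ] Lp Y 2 muI :=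
  h.exists_op.choose

lemma IsKer.op_ae {k : ℝ → ℝ → Z →L[ℝ] Y} (h : IsKer k) (f : Lp Z 2 muI) :
    h.op f =ᵐ[muI] fun x => ∫ ξ in (0 : ℝ)..x, k x ξ (f ξ) := h.exists_op.choose_spec f

/-- Operators of Volterra type. -/
def IsVolt (V : Lp Z 2 muI →L[ℝ] Lp Y 2 muI) : Prop :=
  ∃ C, 0 ≤ C ∧ ∀ f : Lp Z 2 muI, ∀ᵐ x ∂muI, ‖V f x‖ ^ 2 ≤ C * ∫ s in (0 : ℝ)..x, ‖f s‖ ^ 2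

/-- Operators whose values on `[0,x]` are controlled by the argument on `[0,x]`. -/
def IsCausal (V : Lp Z 2 muI →L[ℝ] Lp Y 2 muI) : Prop :=
  ∃ C, 0 ≤ C ∧ ∀ f : Lp Z 2 muI, ∀ x ∈ Icc (0 : ℝ) 1,
    ∫ s in (0 : ℝ)..x, ‖V f s‖ ^ 2 ≤ C * ∫ s in (0 : ℝ)..x, ‖f s‖ ^ 2

lemma IsKer.isVolt {k : ℝ → ℝ → Z →L[ℝ] Y} (h : IsKer k) : IsVolt h.op := by
  obtain ⟨C, hC0, hC⟩ := h.norm_sq_le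
  refine ⟨C, hC0, fun f => ?_⟩
  filter_upwards [h.op_ae f, ae_muI_of_forall fun x hx => hx] with x hx hx'
  rw [hx]; exact hC f (Lp.memLp f) x hx'

lemma IsMult.isCausal {B : ℝ → Z →L[ℝ] Y} (h : IsMult B) : IsCausal h.op := by
  obtain ⟨C, hC⟩ := h.2
  refine ⟨C ^ 2, by positivity, fun f x hx => ?_⟩
  rw [← intervalIntegral.integral_const_mul]
  refine integral_mono_muI (integrable_norm_sq (Lp.memLp _))
    ((integrable_norm_sq (Lp.memLp _)).const_mul _) ?_ hx
  filter_upwards [h.op_ae f, hC] with s hs hs' _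
  rw [hs, ← mul_pow]
  exact pow_le_pow_left₀ (norm_nonneg _) ((B s).le_of_opNorm_le hs' _) 2

lemma integral_sq_nonneg (f : ℝ → Z) {x : ℝ} (hx : 0 ≤ x) :
    0 ≤ ∫ s in (0 : ℝ)..x, ‖f s‖ ^ 2 :=
  intervalIntegral.integral_nonneg hx fun _ _ => sq_nonneg _

lemma IsVolt.isCausal {V : Lp Z 2 muI →L[ℝ] Lp Y 2 muI} (h : IsVolt V) : IsCausal V := by
  obtain ⟨C, hC0, hC⟩ := h
  refine ⟨C, hC0, fun f x hx => ?_⟩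
  set F := ∫ s in (0 : ℝ)..x, ‖f s‖ ^ 2
  have hF : 0 ≤ F := integral_sq_nonneg _ hx.1
  calc ∫ s in (0 : ℝ)..x, ‖V f s‖ ^ 2 ≤ ∫ s in (0 : ℝ)..x, C * F := by
        refine integral_mono_muI (integrable_norm_sq (Lp.memLp _)) (integrable_const _) ?_ hx
        filter_upwards [hC f, ae_muI_of_forall fun x hx => hx] with s hs hs' hsx
        exact hs.trans (mul_le_mul_of_nonneg_left (integral_mono_right
          (integrable_norm_sq (Lp.memLp f)) (fun _ => sq_nonneg _) hs'.1 hsx hx.2) hC0)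
    _ = x * (C * F) := by simp; ring
    _ ≤ _ := mul_le_of_le_one_left (by positivity) hx.2

/-- Together with `IsVolt.mult_comp` and `IsVolt.add`, this stability property recognises the
operators of the linear integral equations below as Volterra operators, so that they are solvable
without smallness. -/
lemma IsVolt.comp_causal {V : Lp Z 2 muI →L[ℝ] Lp Y 2 muI} (hV : IsVolt V)
    {U : Lp X 2 muI →L[ℝ] Lp Z 2 muI} (hU : IsCausal U) : IsVolt (V ∘L U) := by
  obtain ⟨C, hC0, hC⟩ := hV
  obtain ⟨D, hD0, hD⟩ := hU
  refine ⟨C * D, by positivity, fun f => ?_⟩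
  filter_upwards [hC (U f), ae_muI_of_forall fun x hx => hx] with s hs hs'
  rw [mul_assoc]
  exact hs.trans (mul_le_mul_of_nonneg_left (hD f s hs') hC0)

lemma IsVolt.mult_comp {V : Lp Z 2 muI →L[ℝ] Lp Y 2 muI} (hV : IsVolt V)
    {B : ℝ → Y →L[ℝ] X} (hB : IsMult B) : IsVolt (hB.op ∘L V) := by
  obtain ⟨C, hC0, hC⟩ := hV
  obtain ⟨D, hD⟩ := hB.2
  refine ⟨D ^ 2 * C, by positivity, fun f => ?_⟩
  filter_upwards [hC f, hD, hB.op_ae (V f)] with s hs hs' hs''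
  rw [ContinuousLinearMap.comp_apply, hs'', mul_assoc]
  refine (pow_le_pow_left₀ (norm_nonneg _) ((B s).le_of_opNorm_le hs' _) 2).trans ?_
  rw [mul_pow]
  exact mul_le_mul_of_nonneg_left hs (sq_nonneg _)

lemma IsVolt.add {V W : Lp Z 2 muI →L[ℝ] Lp Y 2 muI} (hV : IsVolt V) (hW : IsVolt W) :
    IsVolt (V + W) := by
  obtain ⟨C, hC0, hC⟩ := hV
  obtain ⟨D, hD0, hD⟩ := hW
  refine ⟨2 * C + 2 * D, by positivity, fun f => ?_⟩
  filter_upwards [hC f, hD f, Lp.coeFn_add (V f) (W f)] with s hs hs' h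
  rw [add_apply, h, Pi.add_apply]
  have h1 := norm_add_le (V f s) (W f s)
  have h2 := pow_le_pow_left₀ (norm_nonneg _) h1 2
  nlinarith [sq_nonneg (‖V f s‖ - ‖W f s‖)]

lemma IsVolt.neg {V : Lp Z 2 muI →L[ℝ] Lp Y 2 muI} (hV : IsVolt V) : IsVolt (-V) := by
  obtain ⟨C, hC0, hC⟩ := hV
  refine ⟨C, hC0, fun f => ?_⟩
  filter_upwards [hC f, Lp.coeFn_neg (V f)] with s hs h
  rwa [neg_apply, h, Pi.neg_apply, norm_neg]

lemma IsVolt.sub {V W : Lp Z 2 muI →L[ℝ] Lp Y 2 muI} (hV : IsVolt V) (hW : IsVolt W) :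
    IsVolt (V - W) := by
  rw [sub_eq_add_neg]; exact hV.add hW.neg

/-- An operator of Volterra type is quasinilpotent. -/
lemma IsVolt.isUnit_one_sub {V : Lp Z 2 muI →L[ℝ] Lp Z 2 muI} (hV : IsVolt V) :
    IsUnit (1 - V) := by
  obtain ⟨C, hC0, hC⟩ := hV
  -- Each application of `V` integrates once more in the upper limit, which produces the factor `xⁿ
  -- / n!`.
  have key : ∀ (n : ℕ) (f : Lp Z 2 muI), ∀ x ∈ Icc (0 : ℝ) 1,
      ∫ s in (0 : ℝ)..x, ‖(V ^ n) f s‖ ^ 2 ≤ C ^ n * (x ^ n / n.factorial) * ‖f‖ ^ 2 := by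
    intro n f
    induction n with
    | zero =>
      intro x hx
      simp only [pow_zero, one_apply_eq_self, Nat.factorial_zero, Nat.cast_one, div_one, one_mul]
      rw [norm_sq_eq_integral]
      exact integral_mono_right (integrable_norm_sq (Lp.memLp f)) (fun _ => sq_nonneg _)
        hx.1 hx.2 le_rfl
    | succ n ih =>
      intro x hx
      have hp : ∀ c : ℝ, Integrable (fun s : ℝ => c * s ^ n) muI := fun c =>
        (Continuous.integrableOn_Icc (by fun_prop))
      calc _ ≤ ∫ s in (0 : ℝ)..x, (C * C ^ n * ‖f‖ ^ 2 / n.factorial) * s ^ n := by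
            refine integral_mono_muI (integrable_norm_sq (Lp.memLp _)) (hp _) ?_ hx
            filter_upwards [hC ((V ^ n) f), ae_muI_of_forall fun x hx => hx] with s hs hs' _
            rw [pow_succ' V, mul_apply_eq_comp]
            refine hs.trans ((mul_le_mul_of_nonneg_left (ih s hs') hC0).trans_eq ?_)
            ring
        _ = _ := by
            rw [intervalIntegral.integral_const_mul, integral_pow, Nat.factorial_succ]
            push_cast
            field_simp
            ring
  obtain ⟨n, hn⟩ := ((FloorSemiring.tendsto_pow_div_factorial_atTop C).eventually
    (gt_mem_nhds (show (0 : ℝ) < 1 / 4 by norm_num))).exists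
  have hVn : ‖V ^ n‖ < 1 := by
    refine lt_of_le_of_lt (ContinuousLinearMap.opNorm_le_bound _ (by norm_num)
      fun f => ?_) (show (1 / 2 : ℝ) < 1 by norm_num)
    refine (sq_le_sq₀ (norm_nonneg _) (by positivity)).1 ?_
    have h1 := key n f 1 (right_mem_Icc.2 zero_le_one)
    rw [norm_sq_eq_integral]
    refine h1.trans ?_
    rw [one_pow, mul_one_div, mul_pow]
    exact mul_le_mul_of_nonneg_right (by norm_num at hn ⊢; exact hn.le) (sq_nonneg _)
  have h1 : IsUnit (1 - V ^ n) :=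
    isUnit_one_sub_of_norm_lt_one (R := Lp Z 2 muI →L[ℝ] Lp Z 2 muI) hVn
  -- `1 - V` is a factor of the invertible `1 - Vⁿ` and commutes with the cofactor `∑ Vⁱ`, so it is
  -- itself invertible.
  rw [← mul_neg_geom_sum V n] at h1
  refine ((Commute.isUnit_mul_iff ?_).1 h1).1
  exact (Commute.one_left _).sub_left (Commute.sum_right _ _ _ fun i _ => Commute.self_pow V i)

lemma IsVolt.isUnit_one_add {V : Lp Z 2 muI →L[ℝ] Lp Z 2 muI} (hV : IsVolt V) :
    IsUnit (1 + V) := by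
  have := hV.neg.isUnit_one_sub
  rwa [sub_neg_eq_add] at this

lemma integrable_mul_continuous {f : ℝ → ℝ} (hf : Integrable f muI) {g : ℝ → ℝ}
    (hg : Continuous g) : Integrable (fun x => g x * f x) muI := by
  have := integrable_muI.1 hf
  exact integrable_muI.2 (this.continuousOn_mul hg.continuousOn)

/-- Operators of Volterra type have small norm in exponentially weighted spaces. -/
lemma IsVolt.exists_weighted_le {V : Lp Z 2 muI →L[ℝ] Lp Y 2 muI} (hV : IsVolt V) :
    ∃ C, 0 ≤ C ∧ ∀ κ : ℝ, 0 < κ → ∀ f : Lp Z 2 muI,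
      ∫ x in (0 : ℝ)..1, Real.exp (-κ * x) * ‖V f x‖ ^ 2
        ≤ C / κ * ∫ x in (0 : ℝ)..1, Real.exp (-κ * x) * ‖f x‖ ^ 2 := by
  obtain ⟨C, hC0, hC⟩ := hV
  refine ⟨C, hC0, fun κ hκ f => ?_⟩
  have hf := integrable_norm_sq (Lp.memLp f)
  set F : ℝ → ℝ := fun x => ∫ s in (0 : ℝ)..x, ‖f s‖ ^ 2
  have hF : IsPrim F (fun s => ‖f s‖ ^ 2) := ⟨integrable_muI.1 hf, fun x _ => by simp [F]⟩
  have hE : IsPrim (fun x => Real.exp (-κ * x)) (fun x => -κ * Real.exp (-κ * x)) := by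
    refine isPrim_of_hasDerivAt (fun x => ?_) (by fun_prop)
    simpa [mul_comm] using ((hasDerivAt_id x).const_mul (-κ)).exp
  -- Integrating `(e^{-κx} F)'` with `F(x) = ∫₀ˣ ‖f‖²` gives `κ ∫ e^{-κx} F ≤ ∫ e^{-κx} ‖f‖²`,
  -- because the boundary term at `1` is nonnegative and `F(0) = 0`. This is the source of the gain
  -- `1/κ`.
  have hp := hE.bilin (ContinuousLinearMap.mul ℝ ℝ) hF
  have e := hp.2 1 (right_mem_Icc.2 zero_le_one)
  simp only [ContinuousLinearMap.mul_apply'] at e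
  have i1 : Integrable (fun x => Real.exp (-κ * x) * F x) muI := by
    refine IntegrableOn.continuousOn_mul (Continuous.continuousOn (by fun_prop)) ?_ isCompact_Icc
    exact hF.continuousOn.integrableOn_Icc
  have i2 : Integrable (fun x => Real.exp (-κ * x) * ‖f x‖ ^ 2) muI :=
    integrable_mul_continuous hf (by fun_prop)
  have e2 : ∫ x in (0 : ℝ)..1, (-κ * Real.exp (-κ * x) * F x + Real.exp (-κ * x) * ‖f x‖ ^ 2)
      = -κ * (∫ x in (0 : ℝ)..1, Real.exp (-κ * x) * F x)
        + ∫ x in (0 : ℝ)..1, Real.exp (-κ * x) * ‖f x‖ ^ 2 := by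
    simp_rw [mul_assoc]
    rw [intervalIntegral.integral_add ((integrable_muI.1 i1).const_mul _) (integrable_muI.1 i2),
      intervalIntegral.integral_const_mul]
  rw [e2] at e
  have hF1 : 0 ≤ Real.exp (-κ * 1) * F 1 :=
    mul_nonneg (Real.exp_pos _).le (integral_sq_nonneg _ zero_le_one)
  have hF0 : F 0 = 0 := by simp [F]
  rw [hF0, mul_zero, zero_add] at e
  have h3 : (∫ x in (0 : ℝ)..1, Real.exp (-κ * x) * F x)
      ≤ (∫ x in (0 : ℝ)..1, Real.exp (-κ * x) * ‖f x‖ ^ 2) / κ := by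
    rw [le_div_iff₀ hκ]; linarith
  calc _ ≤ ∫ x in (0 : ℝ)..1, C * (Real.exp (-κ * x) * F x) := by
        refine integral_mono_muI (integrable_mul_continuous (integrable_norm_sq (Lp.memLp _))
          (by fun_prop)) (i1.const_mul C) ?_ (right_mem_Icc.2 zero_le_one)
        filter_upwards [hC f] with x hx _
        rw [mul_left_comm]
        exact mul_le_mul_of_nonneg_left hx (Real.exp_pos _).le
    _ ≤ _ := by
        rw [intervalIntegral.integral_const_mul, div_mul_eq_mul_div, mul_div_assoc]
        exact mul_le_mul_of_nonneg_left h3 hC0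

/-- The energy identity with an exponential weight. -/
lemma IsPrim.energy {f f' : ℝ → X} (h : IsPrim f f') (θ : ℝ) :
    2 * ∫ x in (0 : ℝ)..1, Real.exp (θ * x) * inner ℝ (f' x) (f x)
      = Real.exp θ * ‖f 1‖ ^ 2 - ‖f 0‖ ^ 2
        - θ * ∫ x in (0 : ℝ)..1, Real.exp (θ * x) * ‖f x‖ ^ 2 := by
  have hE : IsPrim (fun x => Real.exp (θ * x)) (fun x => θ * Real.exp (θ * x)) := by
    refine isPrim_of_hasDerivAt (fun x => ?_) (by fun_prop)
    simpa [mul_comm] using ((hasDerivAt_id x).const_mul θ).exp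
  have hn : IsPrim (fun x => ‖f x‖ ^ 2) (fun x => inner ℝ (f' x) (f x) + inner ℝ (f x) (f' x)) := by
    simp_rw [← real_inner_self_eq_norm_sq]
    exact h.bilin (innerSL ℝ) h
  have hp := hE.bilin (ContinuousLinearMap.mul ℝ ℝ) hn
  have e := hp.2 1 (right_mem_Icc.2 zero_le_one)
  simp only [ContinuousLinearMap.mul_apply'] at e
  have i1 : Integrable (fun x => Real.exp (θ * x) * ‖f x‖ ^ 2) muI :=
    ContinuousOn.integrableOn_Icc ((Continuous.continuousOn (by fun_prop)).mul
      (h.continuousOn.norm.pow 2))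
  have i2 : Integrable (fun x => Real.exp (θ * x) * inner ℝ (f' x) (f x)) muI := by
    refine integrable_mul_continuous ?_ (by fun_prop)
    obtain ⟨K, hK⟩ := (isCompact_Icc.image_of_continuousOn h.continuousOn).isBounded.exists_norm_le
    exact integrable_bilin (innerSL ℝ) h.integrableOn
      (h.continuousOn.aestronglyMeasurable measurableSet_Icc)
      (ae_muI_of_forall fun s hs => hK _ ⟨s, hs, rfl⟩)
  have e2 : ∀ x, θ * Real.exp (θ * x) * ‖f x‖ ^ 2
      + Real.exp (θ * x) * (inner ℝ (f' x) (f x) + inner ℝ (f x) (f' x))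
      = θ * (Real.exp (θ * x) * ‖f x‖ ^ 2) + 2 * (Real.exp (θ * x) * inner ℝ (f' x) (f x)) := by
    intro x
    rw [real_inner_comm (f' x) (f x)]; ring
  simp_rw [e2] at e
  rw [intervalIntegral.integral_add ((integrable_muI.1 i1).const_mul _)
    ((integrable_muI.1 i2).const_mul _), intervalIntegral.integral_const_mul,
    intervalIntegral.integral_const_mul] at e
  simp only [mul_one, mul_zero, Real.exp_zero, one_mul] at e
  linarith

end LTwo

/-! ### From weak formulations to integrated equations. -/

section Weak

variable {X : Type*} [NormedAddCommGroup X] [InnerProductSpace ℝ X] [CompleteSpace X]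

/-- A weak solution of `a m' = r`, `m(0) = 0` with trace `m₁` at `1` is the primitive
of `a⁻¹ r`. -/
lemma eq_primitive_of_weak {a a' c : ℝ → X →L[ℝ] X} (ha : IsMult a) (ha' : IsMult a')
    (hc : IsPrim c fun x => -(c x ∘L a' x ∘L c x))
    (hca : ∀ x ∈ Icc (0 : ℝ) 1, ∀ v, c x (a x v) = v) {m r : ℝ → X} (hm : MemLp m 2 muI)
    (hr : MemLp r 2 muI) {m₁ : X}
    (hweak : ∀ χ χ' : ℝ → ℝ, (∀ x, HasDerivAt χ (χ' x) x) → Continuous χ' →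
      (∫ x in (0 : ℝ)..1, (χ' x • a x (m x) + χ x • a' x (m x))) + ∫ x in (0 : ℝ)..1, χ x • r x
        = χ 1 • a 1 m₁) :
    (∀ᵐ x ∂muI, m x = ∫ s in (0 : ℝ)..x, c s (r s)) ∧ m₁ = ∫ s in (0 : ℝ)..1, c s (r s) := by
  have h1mem : (1 : ℝ) ∈ Icc (0 : ℝ) 1 := right_mem_Icc.2 zero_le_one
  have iam := (ha.memLp hm).integrable one_le_two
  have iam' := (ha'.memLp hm).integrable one_le_two
  have ir := hr.integrable one_le_two
  set D : ℝ → X := fun x => ∫ s in (0 : ℝ)..x, (a' s (m s) + r s)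
  have hD0 : D 0 = 0 := by simp [D]
  have hD : IsPrim D fun s => a' s (m s) + r s :=
    ⟨integrable_muI.1 (iam'.add ir), fun x _ => by rw [hD0, zero_add]⟩
  have iD : Integrable D muI := hD.continuousOn.integrableOn_Icc
  have smul_int : ∀ {χ : ℝ → ℝ} {f : ℝ → X}, Continuous χ → Integrable f muI →
      IntervalIntegrable (fun x => χ x • f x) volume 0 1 := fun hχ hf =>
    (integrable_muI.1 hf).continuousOn_smul hχ.continuousOn
  -- The hypothesis is the weak form of `(a m)' = a' m + r`, and `D` is the primitive of that
  -- right-hand side. Subtracting the product rule for `χ D` leaves only `a m - D` and the trace at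
  -- `1`. The absence of a term at `0` encodes `m(0) = 0`.
  have key : ∀ χ χ' : ℝ → ℝ, (∀ x, HasDerivAt χ (χ' x) x) → Continuous χ' →
      ∫ x in (0 : ℝ)..1, χ' x • (a x (m x) - D x) = χ 1 • (a 1 m₁ - D 1) := by
    intro χ χ' hχ hχ'
    have hχc : Continuous χ := continuous_iff_continuousAt.2 fun x => (hχ x).continuousAt
    have h1 := hweak χ χ' hχ hχ'
    have h2 := ((isPrim_of_hasDerivAt hχ hχ').bilin (ContinuousLinearMap.lsmul ℝ ℝ) hD).2 1 h1mem
    simp only [ContinuousLinearMap.lsmul_apply, hD0, smul_zero, zero_add, smul_add] at h2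
    have i1 := smul_int hχ' iam
    have i2 := smul_int hχc iam'
    have i3 := smul_int hχc ir
    have i4 := smul_int hχ' iD
    simp_rw [smul_sub]
    rw [intervalIntegral.integral_sub i1 i4, h2, ← h1,
      intervalIntegral.integral_add i1 i2, intervalIntegral.integral_add i4 (i2.add i3),
      intervalIntegral.integral_add i2 i3]
    abel
  have hone : a 1 m₁ = D 1 := by
    have := key (fun _ => 1) (fun _ => 0) (fun x => hasDerivAt_const x 1) continuous_const
    simp only [zero_smul, intervalIntegral.integral_zero, one_smul] at this
    exact (sub_eq_zero.1 this.symm)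
  have hae : ∀ᵐ x ∂muI, a x (m x) - D x = 0 := by
    refine ae_eq_zero_of_integral_contDiff_smul_eq_zero (iam.sub iD).locallyIntegrable
      fun g hg _ => ?_
    rw [integral_muI]
    have := key (fun x => ∫ s in (0 : ℝ)..x, g s) g (fun x =>
      intervalIntegral.integral_hasDerivAt_right (hg.continuous.intervalIntegrable _ _)
        (hg.continuous.stronglyMeasurableAtFilter _ _) hg.continuous.continuousAt) hg.continuous
    rwa [hone, sub_self, smul_zero] at this
  have hcD : ∀ᵐ x ∂muI, c x (D x) = m x := by
    filter_upwards [hae, ae_muI_of_forall hca] with x hx hx'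
    rw [← sub_eq_zero.1 hx, hx']
  -- As `c` is a left inverse of `a`, one has `c D = m` almost everywhere, and `(c D)' = -c a' c D +
  -- c (a' m + r) = c r`.
  have hp := hc.bilin (ContinuousLinearMap.id ℝ (X →L[ℝ] X)) hD
  have hp' : ∀ x ∈ Icc (0 : ℝ) 1, c x (D x) = ∫ s in (0 : ℝ)..x, c s (r s) := by
    intro x hx
    have := hp.2 x hx
    simp only [ContinuousLinearMap.id_apply, hD0, map_zero, zero_add] at this
    rw [this]
    refine integral_congr_muI ?_ hx
    filter_upwards [hcD] with s hs
    simp [hs]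
  refine ⟨?_, ?_⟩
  · filter_upwards [hcD, ae_muI_of_forall hp'] with x hx hx'
    rw [← hx, hx']
  · rw [← hp' 1 h1mem, ← hone, hca 1 h1mem]

/-- A continuous linear map on `L²` is determined by its values on smooth functions. -/
lemma eq_of_eq_on_smooth {T T' : Lp ℝ 2 muI →L[ℝ] X}
    (h : ∀ f : Lp ℝ 2 muI, ∀ ψ : ℝ → ℝ, ContDiff ℝ 1 ψ → f =ᵐ[muI] ψ → T f = T' f) : T = T' := by
  have hK : (LinearMap.ker ((T - T' : Lp ℝ 2 muI →L[ℝ] X) : Lp ℝ 2 muI →ₗ[ℝ] X)) = ⊤ := by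
    set K := LinearMap.ker ((T - T' : Lp ℝ 2 muI →L[ℝ] X) : Lp ℝ 2 muI →ₗ[ℝ] X)
    have hcl : IsClosed (K : Set (Lp ℝ 2 muI)) := (T - T').isClosed_ker
    have : CompleteSpace K := hcl.completeSpace_coe
    rw [← Submodule.orthogonal_eq_bot_iff, Submodule.eq_bot_iff]
    -- The kernel of `T - T'` is closed and contains the smooth functions, so a vector orthogonal to
    -- it integrates to zero against every test function.
    intro ρ hρ
    rw [Submodule.mem_orthogonal] at hρ
    refine Lp.ext ?_
    have hz := Lp.coeFn_zero ℝ 2 muI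
    have : ∀ᵐ x ∂muI, ρ x = 0 := by
      refine ae_eq_zero_of_integral_contDiff_smul_eq_zero
        ((Lp.memLp ρ).integrable one_le_two).locallyIntegrable fun g hg _ => ?_
      have hmem : MemLp g 2 muI := by
        obtain ⟨C, hC⟩ :=
          (isCompact_Icc.image_of_continuousOn (hg.continuous.continuousOn (s := Icc 0 1))).isBounded.exists_norm_le
        exact MemLp.of_bound hg.continuous.aestronglyMeasurable C
          (ae_muI_of_forall fun x hx => hC _ ⟨x, hx, rfl⟩)
      have h1 := hρ hmem.toLp (by
        have := h hmem.toLp g (hg.of_le (by simp)) hmem.coeFn_toLp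
        simp [K, this])
      rw [L2.inner_def] at h1
      rw [← h1]
      refine integral_congr_ae ?_
      filter_upwards [hmem.coeFn_toLp] with x hx
      rw [hx]; simp [mul_comm]
    filter_upwards [this, hz] with x hx hx'
    rw [hx, hx']; rfl
  ext f
  have : f ∈ LinearMap.ker ((T - T' : Lp ℝ 2 muI →L[ℝ] X) : Lp ℝ 2 muI →ₗ[ℝ] X) := hK ▸ trivial
  exact sub_eq_zero.1 (by simpa using this)

end Weak

/-! ### Multiplication by functions continuous on the square, as operators on `L²` in `y`. -/

section MulH

/-- The unit interval as a type. -/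
abbrev UI : Type := Icc (0 : ℝ) 1

lemma isMult_ext (f : C(UI, ℝ)) :
    IsMult (fun y => ContinuousLinearMap.toSpanSingleton ℝ (IccExtend zero_le_one f y)) := by
  refine IsMult.of_continuousOn (Continuous.continuousOn ?_)
  exact (ContinuousLinearMap.toSpanSingletonLE ℝ ℝ ℝ).toLinearMap.continuous_of_finiteDimensional.comp
    f.continuous.Icc_extend'

lemma isMult_ext_op_ae (f : C(UI, ℝ)) (h : H) :
    (isMult_ext f).op h =ᵐ[muI] fun y => IccExtend zero_le_one f y * h y := by
  filter_upwards [(isMult_ext f).op_ae h] with y hy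
  rw [hy]; simp [mul_comm]

lemma norm_isMult_ext_op_le (f : C(UI, ℝ)) (h : H) : ‖(isMult_ext f).op h‖ ≤ ‖f‖ * ‖h‖ := by
  refine Lp.norm_le_mul_norm_of_ae_le_mul ?_
  filter_upwards [isMult_ext_op_ae f h] with y hy
  rw [hy, norm_mul]
  exact mul_le_mul_of_nonneg_right (f.norm_coe_le_norm _) (norm_nonneg _)

/-- Multiplication by continuous functions on `L²([0,1])`. -/
def mulH : C(UI, ℝ) →L[ℝ] H →L[ℝ] H :=
  LinearMap.mkContinuous
    { toFun := fun f => (isMult_ext f).op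
      map_add' := fun f g => by
        ext1 h
        refine Lp.ext ?_
        filter_upwards [isMult_ext_op_ae (f + g) h, isMult_ext_op_ae f h, isMult_ext_op_ae g h,
          Lp.coeFn_add ((isMult_ext f).op h) ((isMult_ext g).op h)] with y h1 h2 h3 h4
        rw [add_apply, h4, Pi.add_apply, h1, h2, h3]
        simp [IccExtend, add_mul]
      map_smul' := fun r f => by
        ext1 h
        refine Lp.ext ?_
        filter_upwards [isMult_ext_op_ae (r • f) h, isMult_ext_op_ae f h,
          Lp.coeFn_smul r ((isMult_ext f).op h)] with y h1 h2 h4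
        rw [RingHom.id_apply, smul_apply, h4, Pi.smul_apply, h1, h2]
        simp [IccExtend, mul_assoc] } 1
    fun f => by
      rw [one_mul]
      exact ContinuousLinearMap.opNorm_le_bound _ (norm_nonneg _) (norm_isMult_ext_op_le f)

lemma mulH_ae (f : C(UI, ℝ)) (h : H) :
    ∀ᵐ y ∂muI, mulH f h y = IccExtend zero_le_one f y * h y := isMult_ext_op_ae f h

lemma mulH_mul (f g : C(UI, ℝ)) (h : H) : mulH (f * g) h = mulH f (mulH g h) := by
  refine Lp.ext ?_
  filter_upwards [mulH_ae (f * g) h, mulH_ae f (mulH g h), mulH_ae g h] with y h1 h2 h3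
  rw [h1, h2, h3]; simp [IccExtend, mul_assoc]

lemma mulH_one (h : H) : mulH 1 h = h := by
  refine Lp.ext ?_
  filter_upwards [mulH_ae 1 h] with y h1
  rw [h1]; simp [IccExtend]

lemma inner_H (f g : H) : inner ℝ f g = ∫ y, f y * g y ∂muI := by
  rw [L2.inner_def]; simp [mul_comm]

lemma inner_mulH (f : C(UI, ℝ)) (h g : H) : inner ℝ (mulH f h) g = inner ℝ h (mulH f g) := by
  rw [inner_H, inner_H]
  refine integral_congr_ae ?_
  filter_upwards [mulH_ae f h, mulH_ae f g] with y h1 h2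
  rw [h1, h2]; ring

/-- The slice `y ↦ F(x,y)` of a function continuous on the unit square. -/
def slice {F : ℝ → ℝ → ℝ} (hF : ContinuousOn (fun q : ℝ × ℝ => F q.1 q.2) (Icc 0 1 ×ˢ Icc 0 1))
    (x : ℝ) : C(UI, ℝ) where
  toFun y := F (projIcc 0 1 zero_le_one x) y
  continuous_toFun := by
    have : Continuous fun y : UI => ((projIcc 0 1 zero_le_one x : ℝ), (y : ℝ)) := by fun_prop
    exact hF.comp_continuous this fun y => ⟨(projIcc 0 1 zero_le_one x).2, y.2⟩

lemma slice_apply {F : ℝ → ℝ → ℝ}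
    (hF : ContinuousOn (fun q : ℝ × ℝ => F q.1 q.2) (Icc 0 1 ×ˢ Icc 0 1)) {x y : ℝ}
    (hx : x ∈ Icc (0 : ℝ) 1) (hy : y ∈ Icc (0 : ℝ) 1) :
    IccExtend zero_le_one (slice hF x) y = F x y := by
  rw [IccExtend_of_mem _ _ hy]
  simp [slice, projIcc_of_mem zero_le_one hx]

lemma continuous_slice {F : ℝ → ℝ → ℝ}
    (hF : ContinuousOn (fun q : ℝ × ℝ => F q.1 q.2) (Icc 0 1 ×ˢ Icc 0 1)) :
    Continuous (slice hF) := by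
  have : Continuous fun q : ℝ × UI => F (projIcc 0 1 zero_le_one q.1) q.2 := by
    refine hF.comp_continuous (f := fun q : ℝ × UI => ((projIcc 0 1 zero_le_one q.1 : ℝ), (q.2 : ℝ)))
      ?_ fun q => ⟨(projIcc 0 1 zero_le_one q.1).2, q.2.2⟩
    exact ((continuous_subtype_val.comp (continuous_projIcc.comp continuous_fst))).prodMk
      (continuous_subtype_val.comp continuous_snd)
  exact (ContinuousMap.curry ⟨_, this⟩).continuous

/-- A function on the square that is continuously differentiable in `x` has absolutely continuous
slices. -/
lemma isPrim_slice {F F' : ℝ → ℝ → ℝ}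
    (hF : ContinuousOn (fun q : ℝ × ℝ => F q.1 q.2) (Icc 0 1 ×ˢ Icc 0 1))
    (hF' : ContinuousOn (fun q : ℝ × ℝ => F' q.1 q.2) (Icc 0 1 ×ˢ Icc 0 1))
    (hd : ∀ x ∈ Icc (0 : ℝ) 1, ∀ y ∈ Icc (0 : ℝ) 1,
      HasDerivWithinAt (fun s => F s y) (F' x y) (Icc 0 1) x) :
    IsPrim (slice hF) (slice hF') := by
  have hi : IntervalIntegrable (slice hF') volume 0 1 :=
    (continuous_slice hF').intervalIntegrable _ _
  refine ⟨hi, fun x hx => ?_⟩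
  ext y
  have hsub : Icc (0 : ℝ) x ⊆ Icc 0 1 := Icc_subset_Icc_right hx.2
  let ev : C(UI, ℝ) →L[ℝ] ℝ := ContinuousMap.evalCLM ℝ y
  have e1 : (∫ s in (0 : ℝ)..x, slice hF' s) y = ∫ s in (0 : ℝ)..x, slice hF' s y :=
    (ev.intervalIntegral_comp_comm ((continuous_slice hF').intervalIntegrable _ _)).symm
  have e2 : ∫ s in (0 : ℝ)..x, slice hF' s y = ∫ s in (0 : ℝ)..x, F' s y := by
    refine intervalIntegral.integral_congr fun s hs => ?_
    rw [uIcc_of_le hx.1] at hs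
    simp [slice, projIcc_of_mem zero_le_one (hsub hs)]
  have e3 : ∫ s in (0 : ℝ)..x, F' s y = F x y - F 0 y := by
    refine intervalIntegral.integral_eq_sub_of_hasDeriv_right_of_le (f := fun s => F s y)
      (f' := fun s => F' s y) hx.1 ?_ ?_ ?_
    · exact fun s hs => ((hd s (hsub hs) y y.2).continuousWithinAt).mono hsub
    · intro s hs
      have h1 := hd s (hsub (Ioo_subset_Icc_self hs)) y y.2
      refine (h1.hasDerivAt (Icc_mem_nhds hs.1 (hs.2.trans_le hx.2))).hasDerivWithinAt
    · refine ContinuousOn.intervalIntegrable ?_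
      rw [uIcc_of_le hx.1]
      exact hF'.comp (f := fun s : ℝ => (s, (y : ℝ))) (by fun_prop) fun s hs => ⟨hsub hs, y.2⟩
  rw [ContinuousMap.add_apply, e1, e2, e3]
  simp [slice, projIcc_of_mem zero_le_one hx]

end MulH

/-! ### Hilbert–Schmidt integral operators in `y`. -/

section HilbertSchmidt

lemma abs_integral_mul_sq_le {f g : ℝ → ℝ} (hf : MemLp f 2 muI) (hg : MemLp g 2 muI) :
    (∫ y, f y * g y ∂muI) ^ 2 ≤ (∫ y, f y ^ 2 ∂muI) * ∫ y, g y ^ 2 ∂muI := by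
  have h := real_inner_mul_inner_self_le hf.toLp hg.toLp
  have e : ∀ {a b : ℝ → ℝ} (ha : MemLp a 2 muI) (hb : MemLp b 2 muI),
      inner ℝ ha.toLp hb.toLp = ∫ y, a y * b y ∂muI := by
    intro a b ha hb
    rw [inner_H]
    refine integral_congr_ae ?_
    filter_upwards [ha.coeFn_toLp, hb.coeFn_toLp] with y h1 h2
    rw [h1, h2]
  rw [e, e, e] at h
  simpa [sq] using h

lemma integrable_mul_muI {f g : ℝ → ℝ} (hf : MemLp f 2 muI) (hg : MemLp g 2 muI) :
    Integrable (fun x => f x * g x) muI := hf.integrable_mul hg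

lemma integrable_sq_prod (s : Lp ℝ 2 (muI.prod muI)) :
    Integrable (fun q : ℝ × ℝ => s q ^ 2) (muI.prod muI) := (Lp.memLp s).integrable_sq

lemma ae_memLp_slice (s : Lp ℝ 2 (muI.prod muI)) :
    ∀ᵐ y ∂muI, MemLp (fun η => s (y, η)) 2 muI := by
  filter_upwards [(integrable_sq_prod s).prod_right_ae,
    (Lp.stronglyMeasurable s).aestronglyMeasurable.prodMk_left (μ := muI) (ν := muI)] with y h1 h2
  exact (memLp_two_iff_integrable_sq h2).2 h1

lemma norm_sq_H (h : H) : ‖h‖ ^ 2 = ∫ y, h y ^ 2 ∂muI := by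
  rw [← real_inner_self_eq_norm_sq, inner_H]; simp [sq]

/-- Cauchy–Schwarz in `η` for almost every `y`, then Fubini. The bound by `‖s‖` makes `hsOp`
continuous in the kernel, so continuity of `σ` in `x` passes to the operators. -/
lemma memLp_hs (s : Lp ℝ 2 (muI.prod muI)) (h : H) :
    MemLp (fun y => ∫ η, s (y, η) * h η ∂muI) 2 muI ∧
      ∫ y, (∫ η, s (y, η) * h η ∂muI) ^ 2 ∂muI ≤ ‖s‖ ^ 2 * ‖h‖ ^ 2 := by
  have hmeas : AEStronglyMeasurable (fun y => ∫ η, s (y, η) * h η ∂muI) muI := by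
    have : AEStronglyMeasurable (fun q : ℝ × ℝ => s q * h q.2) (muI.prod muI) :=
      (Lp.stronglyMeasurable s).aestronglyMeasurable.mul
        (Lp.stronglyMeasurable h).aestronglyMeasurable.comp_snd
    exact this.integral_prod_right'
  have hbd : ∀ᵐ y ∂muI, (∫ η, s (y, η) * h η ∂muI) ^ 2 ≤ (∫ η, s (y, η) ^ 2 ∂muI) * ‖h‖ ^ 2 := by
    filter_upwards [ae_memLp_slice s] with y hy
    rw [norm_sq_H]
    exact abs_integral_mul_sq_le hy (Lp.memLp h)
  have hi : Integrable (fun y => (∫ η, s (y, η) ^ 2 ∂muI) * ‖h‖ ^ 2) muI :=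
    (integrable_sq_prod s).integral_prod_left.mul_const _
  have hi2 : Integrable (fun y => (∫ η, s (y, η) * h η ∂muI) ^ 2) muI := by
    refine hi.mono' (hmeas.pow 2) ?_
    filter_upwards [hbd] with y hy
    rwa [Real.norm_of_nonneg (sq_nonneg _)]
  refine ⟨(memLp_two_iff_integrable_sq hmeas).2 hi2, (integral_mono_ae hi2 hi hbd).trans_eq ?_⟩
  rw [integral_mul_const, ← integral_prod _ (integrable_sq_prod s),
    ← real_inner_self_eq_norm_sq s, L2.inner_def]
  simp [sq]

lemma exists_hs (s : Lp ℝ 2 (muI.prod muI)) : ∃ T : H →L[ℝ] H,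
    ∀ h, T h =ᵐ[muI] fun y => ∫ η, s (y, η) * h η ∂muI := by
  refine exists_clm (fun h y => ∫ η, s (y, η) * h η ∂muI) ‖s‖ (fun h => (memLp_hs s h).1) ?_ ?_ ?_
  · intro f g
    filter_upwards [ae_memLp_slice s] with y hy
    rw [Pi.add_apply, ← integral_add (integrable_mul_muI hy (Lp.memLp f))
      (integrable_mul_muI hy (Lp.memLp g))]
    refine integral_congr_ae ?_
    filter_upwards [Lp.coeFn_add f g] with η h
    rw [h]; simp [mul_add]
  · intro c f
    refine ae_of_all _ fun y => ?_
    rw [Pi.smul_apply, smul_eq_mul, ← integral_const_mul]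
    refine integral_congr_ae ?_
    filter_upwards [Lp.coeFn_smul c f] with η h
    rw [h]; simp [mul_left_comm]
  · intro h
    refine (sq_le_sq₀ (norm_nonneg _) (by positivity)).1 ?_
    rw [mul_pow, norm_sq_H]
    refine (le_of_eq ?_).trans (memLp_hs s h).2
    refine integral_congr_ae ?_
    filter_upwards [(memLp_hs s h).1.coeFn_toLp] with y hy
    rw [hy]

/-- The Hilbert–Schmidt operator with kernel in `L²`. -/
def hsOp : Lp ℝ 2 (muI.prod muI) →L[ℝ] H →L[ℝ] H :=
  LinearMap.mkContinuous
    { toFun := fun s => (exists_hs s).choose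
      map_add' := fun s t => by
        ext1 h
        refine Lp.ext ?_
        have h0 := Measure.ae_ae_of_ae_prod (Lp.coeFn_add s t)
        filter_upwards [(exists_hs (s + t)).choose_spec h, (exists_hs s).choose_spec h,
          (exists_hs t).choose_spec h, ae_memLp_slice s, ae_memLp_slice t, h0,
          Lp.coeFn_add ((exists_hs s).choose h) ((exists_hs t).choose h)] with y h1 h2 h3 h4 h5 h6 h7
        rw [add_apply, h7, Pi.add_apply, h1, h2, h3, ← integral_add
          (integrable_mul_muI h4 (Lp.memLp h)) (integrable_mul_muI h5 (Lp.memLp h))]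
        refine integral_congr_ae ?_
        filter_upwards [h6] with η h8
        rw [h8]; simp [add_mul]
      map_smul' := fun r s => by
        ext1 h
        refine Lp.ext ?_
        have h0 := Measure.ae_ae_of_ae_prod (Lp.coeFn_smul r s)
        filter_upwards [(exists_hs (r • s)).choose_spec h, (exists_hs s).choose_spec h, h0,
          Lp.coeFn_smul r ((exists_hs s).choose h)] with y h1 h2 h6 h7
        rw [RingHom.id_apply, smul_apply, h7, Pi.smul_apply, h1, h2, smul_eq_mul,
          ← integral_const_mul]
        refine integral_congr_ae ?_
        filter_upwards [h6] with η h8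
        rw [h8]; simp [mul_assoc] } 1
    fun s => by
      rw [one_mul]
      refine ContinuousLinearMap.opNorm_le_bound _ (norm_nonneg _) fun h => ?_
      refine (sq_le_sq₀ (norm_nonneg _) (by positivity)).1 ?_
      rw [mul_pow, norm_sq_H]
      refine (le_of_eq ?_).trans (memLp_hs s h).2
      refine integral_congr_ae ?_
      filter_upwards [(exists_hs s).choose_spec h] with y hy
      simp only [LinearMap.coe_mk, AddHom.coe_mk]
      rw [hy]

lemma hsOp_ae (s : Lp ℝ 2 (muI.prod muI)) (h : H) :
    ∀ᵐ y ∂muI, hsOp s h y = ∫ η, s (y, η) * h η ∂muI := (exists_hs s).choose_spec h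

end HilbertSchmidt

/-! ### Regularity of `λ`, `μ_j` and their reciprocals. -/

section Coefficients

variable {m : ℕ} {p : Params m}

/-- `∂ₓλ(x,y)` on the unit square. -/
def Params.lamX (p : Params m) (x y : ℝ) : ℝ := derivWithin (fun s => p.lam s y) (Icc 0 1) x

/-- `μ_j'(x)` on the unit interval. -/
def Params.muX (p : Params m) (j : Fin m) (x : ℝ) : ℝ := derivWithin (p.mu j) (Icc 0 1) x

lemma Params.Standing.lam_cont (hp : p.Standing) :
    ContinuousOn (fun q : ℝ × ℝ => p.lam q.1 q.2) (Icc 0 1 ×ˢ Icc 0 1) := hp.lam_C1.continuousOn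

lemma Params.Standing.hasDerivWithinAt_lam (hp : p.Standing) {x y : ℝ} (hx : x ∈ Icc (0 : ℝ) 1)
    (hy : y ∈ Icc (0 : ℝ) 1) :
    HasDerivWithinAt (fun s => p.lam s y) (p.lamX x y) (Icc 0 1) x := by
  refine DifferentiableWithinAt.hasDerivWithinAt ?_
  have h1 := (hp.lam_C1.differentiableOn one_ne_zero) (x, y) ⟨hx, hy⟩
  exact h1.comp (f := fun s : ℝ => (s, y)) x (by fun_prop) fun s hs => ⟨hs, hy⟩

lemma Params.Standing.lamX_cont (hp : p.Standing) :
    ContinuousOn (fun q : ℝ × ℝ => p.lamX q.1 q.2) (Icc 0 1 ×ˢ Icc 0 1) := by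
  have hu : UniqueDiffOn ℝ (Icc (0 : ℝ) 1 ×ˢ Icc (0 : ℝ) 1) :=
    (uniqueDiffOn_Icc zero_lt_one).prod (uniqueDiffOn_Icc zero_lt_one)
  have h1 := (hp.lam_C1.continuousOn_fderivWithin hu le_rfl).clm_apply
    (continuousOn_const (c := ((1 : ℝ), (0 : ℝ))))
  refine h1.congr fun q hq => ?_
  have h2 := ((hp.lam_C1.differentiableOn one_ne_zero) q hq).hasFDerivWithinAt
  have h3 : HasDerivWithinAt (fun s : ℝ => (s, q.2)) ((1 : ℝ), (0 : ℝ)) (Icc 0 1) q.1 :=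
    (hasDerivWithinAt_id _ _).prodMk (hasDerivWithinAt_const _ _ _)
  have h4 := HasFDerivWithinAt.comp_hasDerivWithinAt (f := fun s : ℝ => (s, q.2)) q.1 h2 h3
    fun s hs => ⟨hs, hq.2⟩
  exact h4.derivWithin (uniqueDiffOn_Icc zero_lt_one _ hq.1)

/-- `1/λ(x,y)`. -/
def Params.lamInv (p : Params m) (x y : ℝ) : ℝ := (p.lam x y)⁻¹

/-- `∂ₓ(1/λ(x,y))`. -/
def Params.lamInvX (p : Params m) (x y : ℝ) : ℝ := -(p.lamInv x y * p.lamX x y * p.lamInv x y)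

lemma Params.Standing.lamInv_cont (hp : p.Standing) :
    ContinuousOn (fun q : ℝ × ℝ => p.lamInv q.1 q.2) (Icc 0 1 ×ˢ Icc 0 1) :=
  hp.lam_cont.inv₀ fun _ hq => (hp.lam_pos _ hq.1 _ hq.2).ne'

lemma Params.Standing.lamInvX_cont (hp : p.Standing) :
    ContinuousOn (fun q : ℝ × ℝ => p.lamInvX q.1 q.2) (Icc 0 1 ×ˢ Icc 0 1) :=
  ((hp.lamInv_cont.mul hp.lamX_cont).mul hp.lamInv_cont).neg

lemma Params.Standing.hasDerivWithinAt_lamInv (hp : p.Standing) {x y : ℝ} (hx : x ∈ Icc (0 : ℝ) 1)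
    (hy : y ∈ Icc (0 : ℝ) 1) :
    HasDerivWithinAt (fun s => p.lamInv s y) (p.lamInvX x y) (Icc 0 1) x := by
  have hne := (hp.lam_pos x hx y hy).ne'
  refine ((hp.hasDerivWithinAt_lam hx hy).inv hne).congr_deriv ?_
  rw [Params.lamInvX, Params.lamInv]; field_simp

lemma Params.Standing.mu_cont (hp : p.Standing) (j : Fin m) : ContinuousOn (p.mu j) (Icc 0 1) :=
  (hp.mu_C1 j).continuousOn

lemma Params.Standing.hasDerivWithinAt_mu (hp : p.Standing) (j : Fin m) {x : ℝ} (hx : x ∈ Icc (0 : ℝ) 1) :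
    HasDerivWithinAt (p.mu j) (p.muX j x) (Icc 0 1) x :=
  (((hp.mu_C1 j).differentiableOn one_ne_zero) x hx).hasDerivWithinAt

lemma Params.Standing.muX_cont (hp : p.Standing) (j : Fin m) : ContinuousOn (p.muX j) (Icc 0 1) :=
  (hp.mu_C1 j).continuousOn_derivWithin (uniqueDiffOn_Icc zero_lt_one) le_rfl

end Coefficients

/-! ### The kernel equations integrated against a function of `ξ`. -/

section Columns

variable {m : ℕ} {p : Params m} {n : Fin m → Fin m → ℝ → ℝ} {M : Fin m → ℝ → ℝ → H}
  {N : ℝ → ℝ → Matrix (Fin m) (Fin m) ℝ}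

lemma isKer_smulRight {Y : Type*} [NormedAddCommGroup Y] [InnerProductSpace ℝ Y] {k : ℝ → ℝ → Y}
    (hk : StronglyMeasurable fun q : ℝ × ℝ => k q.1 q.2) {C : ℝ}
    (hC : ∀ x ∈ Icc (0 : ℝ) 1, ∀ ξ ∈ Icc 0 x, ‖k x ξ‖ ≤ C) :
    IsKer fun x ξ => ContinuousLinearMap.toSpanSingleton ℝ (k x ξ) := by
  refine ⟨?_, max C 0, le_max_right _ _, fun x hx ξ hξ => ?_⟩
  · exact (ContinuousLinearMap.toSpanSingletonCLE (𝕜 := ℝ) (E := Y)).continuous.comp_stronglyMeasurable hk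
  · rw [ContinuousLinearMap.norm_toSpanSingleton]; exact (hC x hx ξ hξ).trans (le_max_left _ _)

lemma memLp_of_continuousOn {Y : Type*} [NormedAddCommGroup Y] {f : ℝ → Y}
    (hf : ContinuousOn f (Icc 0 1)) : MemLp f 2 muI := by
  obtain ⟨C, hC⟩ := (isCompact_Icc.image_of_continuousOn hf).isBounded.exists_norm_le
  exact MemLp.of_bound (hf.aestronglyMeasurable measurableSet_Icc) C
    (ae_muI_of_forall fun x hx => hC _ ⟨x, hx, rfl⟩)

lemma eq_zero_of_inner_smooth {V : H}
    (h : ∀ (g : ℝ → ℝ) (hg : ContDiff ℝ 1 g),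
      inner ℝ (memLp_of_continuousOn (f := g) hg.continuous.continuousOn).toLp V = (0 : ℝ)) :
    V = 0 := by
  have : ∀ᵐ x ∂muI, V x = 0 := by
    refine ae_eq_zero_of_integral_contDiff_smul_eq_zero
      ((Lp.memLp V).integrable one_le_two).locallyIntegrable fun g hg _ => ?_
    have hg' : ContDiff ℝ 1 g := hg.of_le (by simp)
    rw [← h g hg', inner_H]
    refine integral_congr_ae ?_
    filter_upwards [(memLp_of_continuousOn (f := g) hg'.continuous.continuousOn).coeFn_toLp] with x hx
    rw [hx]; rfl
  refine Lp.ext ?_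
  filter_upwards [this, Lp.coeFn_zero ℝ 2 muI] with x h1 h2
  rw [h1, h2]; rfl

lemma IsObserverKernel.isKer_M (hMN : IsObserverKernel p n M N) (j : Fin m) :
    IsKer fun x ξ => ContinuousLinearMap.toSpanSingleton ℝ (M j x ξ) := by
  obtain ⟨C, hC⟩ := hMN.bounded
  exact isKer_smulRight (hMN.M_meas j) fun x hx ξ hξ => (hC x hx ξ hξ).1 j

lemma IsObserverKernel.isKer_N (hMN : IsObserverKernel p n M N) (i j : Fin m) :
    IsKer fun x ξ => ContinuousLinearMap.toSpanSingleton ℝ (N x ξ i j) := by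
  obtain ⟨C, hC⟩ := hMN.bounded
  exact isKer_smulRight (hMN.N_meas i j).stronglyMeasurable fun x hx ξ hξ => (hC x hx ξ hξ).2 i j

/-- Pairing in `L²` with a continuous function. -/
def pairing {g : ℝ → ℝ} (hg : Continuous g) : H →L[ℝ] ℝ :=
  innerSL ℝ (memLp_of_continuousOn (f := g) hg.continuousOn).toLp

lemma pairing_eq {g : ℝ → ℝ} (hg : Continuous g) (V : H) :
    pairing hg V = ∫ y, V y * g y ∂muI := by
  rw [pairing, innerSL_apply_apply, inner_H]
  refine integral_congr_ae ?_
  filter_upwards [(memLp_of_continuousOn (f := g) hg.continuousOn).coeFn_toLp] with x hx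
  rw [hx, mul_comm]

lemma integrable_mul_cont {g : ℝ → ℝ} (hg : Continuous g) (V : H) :
    Integrable (fun y => V y * g y) muI :=
  integrable_mul_muI (Lp.memLp V) (memLp_of_continuousOn hg.continuousOn)

lemma pairing_mulH {g : ℝ → ℝ} (hg : Continuous g) (f : C(UI, ℝ)) (V : H) :
    pairing hg (mulH f V) = ∫ y, IccExtend zero_le_one f y * V y * g y ∂muI := by
  rw [pairing_eq]
  refine integral_congr_ae ?_
  filter_upwards [mulH_ae f V] with y hy
  rw [hy]

lemma integrable_mulH {g : ℝ → ℝ} (hg : Continuous g) (f : C(UI, ℝ)) (V : H) :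
    Integrable (fun y => IccExtend zero_le_one f y * V y * g y) muI := by
  refine (integrable_mul_cont hg (mulH f V)).congr ?_
  filter_upwards [mulH_ae f V] with y hy
  rw [hy]

lemma _root_.ContinuousLinearMap.intervalIntegrable_comp {Y Z : Type*} [NormedAddCommGroup Y]
    [NormedSpace ℝ Y] [NormedAddCommGroup Z] [NormedSpace ℝ Z] (L : Y →L[ℝ] Z) {f : ℝ → Y} {a b : ℝ}
    (hf : IntervalIntegrable f volume a b) : IntervalIntegrable (fun x => L (f x)) volume a b :=
  ⟨L.integrable_comp hf.1, L.integrable_comp hf.2⟩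

lemma isMult_mulH_slice {F : ℝ → ℝ → ℝ}
    (hF : ContinuousOn (fun q : ℝ × ℝ => F q.1 q.2) (Icc 0 1 ×ˢ Icc 0 1)) :
    IsMult fun x => mulH (slice hF x) :=
  IsMult.of_continuousOn (mulH.continuous.comp (continuous_slice hF)).continuousOn

lemma Params.Standing.isMult_hsOp (hp : p.Standing) : IsMult fun x => hsOp (p.sigma x) :=
  IsMult.of_continuousOn (hsOp.continuous.comp_continuousOn hp.sigma_cont)

lemma Params.Standing.isMult_W (hp : p.Standing) (l : Fin m) :
    IsMult fun x => ContinuousLinearMap.toSpanSingleton ℝ (p.W l x) :=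
  IsMult.of_continuousOn ((ContinuousLinearMap.toSpanSingletonCLE (𝕜 := ℝ)
    (E := H)).continuous.comp_continuousOn (hp.W_cont l))

/-- `∫₀ˣ M_j(x,ξ) b(ξ) dξ`. -/
def colM (M : Fin m → ℝ → ℝ → H) (j : Fin m) (b : ℝ → ℝ) (x : ℝ) : H :=
  ∫ ξ in (0 : ℝ)..x, b ξ • M j x ξ

/-- `∫₀ˣ N_{i,j}(x,ξ) b(ξ) dξ`. -/
def colN (N : ℝ → ℝ → Matrix (Fin m) (Fin m) ℝ) (i j : Fin m) (b : ℝ → ℝ) (x : ℝ) : ℝ :=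
  ∫ ξ in (0 : ℝ)..x, b ξ * N x ξ i j

lemma IsObserverKernel.memLp_colM (hMN : IsObserverKernel p n M N) (j : Fin m) {b : ℝ → ℝ}
    (hb : MemLp b 2 muI) : MemLp (colM M j b) 2 muI := (hMN.isKer_M j).memLp hb

lemma IsObserverKernel.memLp_colN (hMN : IsObserverKernel p n M N) (i j : Fin m) {b : ℝ → ℝ}
    (hb : MemLp b 2 muI) : MemLp (colN N i j b) 2 muI := (hMN.isKer_N i j).memLp hb

lemma IsObserverKernel.intM (hMN : IsObserverKernel p n M N) (j : Fin m) {b : ℝ → ℝ}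
    (hb : MemLp b 2 muI) {x : ℝ} (hx : x ∈ Icc (0 : ℝ) 1) :
    IntervalIntegrable (fun ξ => b ξ • M j x ξ) volume 0 x := (hMN.isKer_M j).integrable hb hx

lemma IsObserverKernel.intN (hMN : IsObserverKernel p n M N) (i j : Fin m) {b : ℝ → ℝ}
    (hb : MemLp b 2 muI) {x : ℝ} (hx : x ∈ Icc (0 : ℝ) 1) :
    IntervalIntegrable (fun ξ => b ξ * N x ξ i j) volume 0 x := (hMN.isKer_N i j).integrable hb hx

lemma IsObserverKernel.memLp_M_zero (hMN : IsObserverKernel p n M N) (j : Fin m) :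
    MemLp (fun x => M j x 0) 2 muI := by
  obtain ⟨C, hC⟩ := hMN.bounded
  exact MemLp.of_bound ((hMN.M_meas j).comp_measurable
    (measurable_id.prodMk measurable_const)).aestronglyMeasurable C
    (ae_muI_of_forall fun x hx => (hC x hx 0 ⟨le_rfl, hx.1⟩).1 j)

lemma IsObserverKernel.memLp_N_zero (hMN : IsObserverKernel p n M N) (i j : Fin m) :
    MemLp (fun x => N x 0 i j) 2 muI := by
  obtain ⟨C, hC⟩ := hMN.bounded
  exact MemLp.of_bound ((hMN.N_meas i j).comp
    (measurable_id.prodMk measurable_const)).aestronglyMeasurable C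
    (ae_muI_of_forall fun x hx => (hC x hx 0 ⟨le_rfl, hx.1⟩).2 i j)

/-- The first component of the right-hand side in the equation of the column `j`. -/
def rhsM (p : Params m) (M : Fin m → ℝ → ℝ → H) (N : ℝ → ℝ → Matrix (Fin m) (Fin m) ℝ)
    (j : Fin m) (b b' : ℝ → ℝ) (x : ℝ) : H :=
  b x • p.W j x - (p.mu j 0 * b 0) • M j x 0 - colM M j (fun ξ => p.mu j ξ * b' ξ) x
    + (hsOp (p.sigma x) (colM M j b x) + ∑ l, colN N l j b x • p.W l x)

lemma memLp_mu_mul (hp : p.Standing) (j : Fin m) {b : ℝ → ℝ} (hb : MemLp b 2 muI) :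
    MemLp (fun ξ => p.mu j ξ * b ξ) 2 muI := by
  have : IsMult fun x => ContinuousLinearMap.toSpanSingleton ℝ (p.mu j x) :=
    IsMult.of_continuousOn ((ContinuousLinearMap.toSpanSingletonCLE (𝕜 := ℝ)
      (E := ℝ)).continuous.comp_continuousOn (hp.mu_cont j))
  refine (this.memLp hb).congr_norm ?_ ?_
  · exact ((hp.mu_cont j).aestronglyMeasurable measurableSet_Icc).mul hb.1
  · exact ae_of_all _ fun x => by simp [mul_comm]

/-- Testing with a product `χ(x) b(ξ) g(y)` separates the variables: the `ξ` integrals build `colM`,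
the arbitrary `g` recovers an identity in `H`, and `χ` remains as the test function of an ODE in
`x`. The edge `ξ = x` becomes `b W_j` by the diagonal condition, the edge `ξ = 0` becomes the
injection term, and the edge `x = 1` is the trace on the right. -/
lemma IsObserverKernel.weak_M (hp : p.Standing) (hMN : IsObserverKernel p n M N) (j : Fin m)
    {b b' χ χ' : ℝ → ℝ} (hb : ∀ x, HasDerivAt b (b' x) x) (hb' : Continuous b')
    (hχ : ∀ x, HasDerivAt χ (χ' x) x) (hχ' : Continuous χ') :
    (∫ x in (0 : ℝ)..1, (χ' x • mulH (slice hp.lam_cont x) (colM M j b x)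
        + χ x • mulH (slice hp.lamX_cont x) (colM M j b x)))
      + ∫ x in (0 : ℝ)..1, χ x • rhsM p M N j b b' x
      = χ 1 • mulH (slice hp.lam_cont 1) (colM M j b 1) := by
  have h1mem : (1 : ℝ) ∈ Icc (0 : ℝ) 1 := right_mem_Icc.2 zero_le_one
  have hbc : Continuous b := continuous_iff_continuousAt.2 fun x => (hb x).continuousAt
  have hχc : Continuous χ := continuous_iff_continuousAt.2 fun x => (hχ x).continuousAt
  have mb : MemLp b 2 muI := memLp_of_continuousOn hbc.continuousOn
  have mb' : MemLp b' 2 muI := memLp_of_continuousOn hb'.continuousOn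
  have mmb' := memLp_mu_mul hp j mb'
  have smul_int : ∀ {χ : ℝ → ℝ} {f : ℝ → H}, Continuous χ → MemLp f 2 muI →
      IntervalIntegrable (fun x => χ x • f x) volume 0 1 := fun hχ hf =>
    (integrable_muI.1 (hf.integrable one_le_two)).continuousOn_smul hχ.continuousOn
  have mM := hMN.memLp_colM j mb
  have i1 := smul_int hχ' ((isMult_mulH_slice hp.lam_cont).memLp mM)
  have i2 := smul_int hχc ((isMult_mulH_slice hp.lamX_cont).memLp mM)
  have mW : MemLp (fun x => b x • p.W j x) 2 muI :=
    memLp_of_continuousOn (hbc.continuousOn.smul (hp.W_cont j))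
  have m0 : MemLp (fun x => (p.mu j 0 * b 0) • M j x 0) 2 muI :=
    (hMN.memLp_M_zero j).const_smul (p.mu j 0 * b 0)
  have mK := hMN.memLp_colM j mmb'
  have mS : MemLp (fun x => hsOp (p.sigma x) (colM M j b x) + ∑ l, colN N l j b x • p.W l x)
      2 muI := (hp.isMult_hsOp.memLp mM).add
        (memLp_finsetSum _ fun l _ => (hp.isMult_W l).memLp (hMN.memLp_colN l j mb))
  have i3 := smul_int hχc mW
  have i4 := smul_int hχc m0
  have i5 := smul_int hχc mK
  have i6 := smul_int hχc mS
  rw [← sub_eq_zero]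
  refine eq_zero_of_inner_smooth fun g hg => ?_
  change pairing hg.continuous _ = 0
  set L := pairing hg.continuous with hL
  have hweak := hMN.eq_M j (fun x ξ y => χ x * b ξ * g y) (by
    have hb1 : ContDiff ℝ 1 b := contDiff_one_iff_deriv.2
      ⟨fun x => (hb x).differentiableAt, by rwa [funext fun x => (hb x).deriv]⟩
    have hχ1 : ContDiff ℝ 1 χ := contDiff_one_iff_deriv.2
      ⟨fun x => (hχ x).differentiableAt, by rwa [funext fun x => (hχ x).deriv]⟩
    exact ((hχ1.comp contDiff_fst).mul (hb1.comp (contDiff_fst.comp contDiff_snd))).mul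
      (hg.comp (contDiff_snd.comp contDiff_snd)))
  have T1 : ∀ x ∈ uIcc (0 : ℝ) 1, (∫ ξ in (0 : ℝ)..x, ∫ y, M j x ξ y *
        (-derivWithin (fun s => p.lam s y * (χ s * b ξ * g y)) (Icc 0 1) x
          + p.mu j ξ * deriv (fun s => χ x * b s * g y) ξ) ∂muI)
      = L (χ x • colM M j (fun ξ => p.mu j ξ * b' ξ) x)
        - L (χ' x • mulH (slice hp.lam_cont x) (colM M j b x)
          + χ x • mulH (slice hp.lamX_cont x) (colM M j b x)) := by
    intro x hx
    rw [uIcc_of_le zero_le_one] at hx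
    set A : H →L[ℝ] ℝ := L ∘L (χ' x • mulH (slice hp.lam_cont x)
      + χ x • mulH (slice hp.lamX_cont x)) with hA
    have e : ∀ ξ, (∫ y, M j x ξ y *
        (-derivWithin (fun s => p.lam s y * (χ s * b ξ * g y)) (Icc 0 1) x
          + p.mu j ξ * deriv (fun s => χ x * b s * g y) ξ) ∂muI)
        = (χ x • L) ((p.mu j ξ * b' ξ) • M j x ξ) - A (b ξ • M j x ξ) := by
      intro ξ
      have e1 : ∀ᵐ y ∂muI, M j x ξ y *
        (-derivWithin (fun s => p.lam s y * (χ s * b ξ * g y)) (Icc 0 1) x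
          + p.mu j ξ * deriv (fun s => χ x * b s * g y) ξ)
          = (χ x * (p.mu j ξ * b' ξ)) * (M j x ξ y * g y)
            - ((b ξ * χ' x) * (IccExtend zero_le_one (slice hp.lam_cont x) y * M j x ξ y * g y)
              + (b ξ * χ x)
                * (IccExtend zero_le_one (slice hp.lamX_cont x) y * M j x ξ y * g y)) := by
        refine ae_muI_of_forall fun y hy => ?_
        have d1 : HasDerivWithinAt (fun s => p.lam s y * (χ s * b ξ * g y))
            (p.lamX x y * (χ x * b ξ * g y) + p.lam x y * (χ' x * b ξ * g y)) (Icc 0 1) x :=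
          (hp.hasDerivWithinAt_lam hx hy).mul
            (((hχ x).hasDerivWithinAt.mul_const _).mul_const _)
        rw [d1.derivWithin (uniqueDiffOn_Icc zero_lt_one x hx),
          (((hb ξ).const_mul (χ x)).mul_const (g y)).deriv, slice_apply hp.lam_cont hx hy,
          slice_apply hp.lamX_cont hx hy]
        ring
      rw [integral_congr_ae e1, integral_sub, integral_add, integral_const_mul, integral_const_mul,
        integral_const_mul, ← pairing_mulH hg.continuous, ← pairing_mulH hg.continuous,
        ← pairing_eq hg.continuous, ← hL]
      · simp only [hA, map_smul, ContinuousLinearMap.comp_apply, add_apply, smul_apply, map_add,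
          smul_eq_mul]
        ring
      · exact (integrable_mulH hg.continuous _ _).const_mul _
      · exact (integrable_mulH hg.continuous _ _).const_mul _
      · exact (integrable_mul_cont hg.continuous _).const_mul _
      · exact ((integrable_mulH hg.continuous _ _).const_mul _).add
          ((integrable_mulH hg.continuous _ _).const_mul _)
    simp_rw [e]
    have j1 := hMN.intM j mmb' hx
    have j2 := hMN.intM j mb hx
    rw [intervalIntegral.integral_sub ((χ x • L).intervalIntegrable_comp j1)
      (A.intervalIntegrable_comp j2), (χ x • L).intervalIntegral_comp_comm j1,
      A.intervalIntegral_comp_comm j2]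
    simp [hA, colM]
  have T2 : (∫ ξ in (0 : ℝ)..1, ∫ y, p.lam 1 y * M j 1 ξ y * (χ 1 * b ξ * g y) ∂muI)
      = L (χ 1 • mulH (slice hp.lam_cont 1) (colM M j b 1)) := by
    set A : H →L[ℝ] ℝ := L ∘L (χ 1 • mulH (slice hp.lam_cont 1)) with hA
    have e : ∀ ξ, (∫ y, p.lam 1 y * M j 1 ξ y * (χ 1 * b ξ * g y) ∂muI)
        = A (b ξ • M j 1 ξ) := by
      intro ξ
      have e1 : ∀ᵐ y ∂muI, p.lam 1 y * M j 1 ξ y * (χ 1 * b ξ * g y) = (χ 1 * b ξ) *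
          (IccExtend zero_le_one (slice hp.lam_cont 1) y * M j 1 ξ y * g y) := by
        refine ae_muI_of_forall fun y hy => ?_
        rw [slice_apply hp.lam_cont h1mem hy]; ring
      rw [integral_congr_ae e1, integral_const_mul, ← pairing_mulH hg.continuous, ← hL]
      simp only [hA, map_smul, ContinuousLinearMap.comp_apply, smul_apply, smul_eq_mul]
      ring
    simp_rw [e]
    rw [A.intervalIntegral_comp_comm (hMN.intM j mb h1mem)]
    simp [hA, colM]
  -- The only use of the diagonal condition on `M`: it replaces the trace on `ξ = x` by the
  -- coefficient `W_j`.
  have T3 : (∫ x in (0 : ℝ)..1, ∫ y, (p.lam x y + p.mu j x) * M j x x y * (χ x * b x * g y) ∂muI)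
      = ∫ x in (0 : ℝ)..1, L (χ x • b x • p.W j x) := by
    refine integral_congr_muI ?_ h1mem
    filter_upwards [hMN.diag_M j] with x hx
    have e1 : ∀ᵐ y ∂muI, (p.lam x y + p.mu j x) * M j x x y * (χ x * b x * g y)
        = (χ x * b x) * (p.W j x y * g y) := by
      filter_upwards [hx] with y hy
      rw [hy]; ring
    rw [integral_congr_ae e1, integral_const_mul, ← pairing_eq hg.continuous, ← hL]
    simp only [map_smul, smul_eq_mul]; ring
  have T4 : (∫ x in (0 : ℝ)..1, ∫ y, p.mu j 0 * M j x 0 y * (χ x * b 0 * g y) ∂muI)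
      = ∫ x in (0 : ℝ)..1, L (χ x • (p.mu j 0 * b 0) • M j x 0) := by
    refine intervalIntegral.integral_congr fun x _ => ?_
    have e1 : ∀ y, p.mu j 0 * M j x 0 y * (χ x * b 0 * g y)
        = (χ x * (p.mu j 0 * b 0)) * (M j x 0 y * g y) := fun y => by ring
    simp_rw [e1]
    rw [integral_const_mul, ← pairing_eq hg.continuous, ← hL]
    simp only [map_smul, smul_eq_mul]; ring
  have T5 : ∀ x ∈ uIcc (0 : ℝ) 1, (∫ ξ in (0 : ℝ)..x, ∫ y,
        ((∫ η, p.sigma x (y, η) * M j x ξ η ∂muI) + ∑ l, p.W l x y * N x ξ l j)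
          * (χ x * b ξ * g y) ∂muI)
      = L (χ x • (hsOp (p.sigma x) (colM M j b x) + ∑ l, colN N l j b x • p.W l x)) := by
    intro x hx
    rw [uIcc_of_le zero_le_one] at hx
    have e : ∀ ξ, (∫ y, ((∫ η, p.sigma x (y, η) * M j x ξ η ∂muI) + ∑ l, p.W l x y * N x ξ l j)
          * (χ x * b ξ * g y) ∂muI)
        = (χ x • L ∘L hsOp (p.sigma x)) (b ξ • M j x ξ)
          + ∑ l, (χ x * L (p.W l x)) * (b ξ * N x ξ l j) := by
      intro ξ
      have e1 : ∀ᵐ y ∂muI, ((∫ η, p.sigma x (y, η) * M j x ξ η ∂muI)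
          + ∑ l, p.W l x y * N x ξ l j) * (χ x * b ξ * g y)
          = (χ x * b ξ) * (hsOp (p.sigma x) (M j x ξ) y * g y)
            + ∑ l, (χ x * b ξ * N x ξ l j) * (p.W l x y * g y) := by
        filter_upwards [hsOp_ae (p.sigma x) (M j x ξ)] with y hy
        rw [hy, add_mul, Finset.sum_mul]
        congr 1
        · ring
        · exact Finset.sum_congr rfl fun l _ => by ring
      rw [integral_congr_ae e1, integral_add, integral_const_mul, integral_finsetSum,
        ← pairing_eq hg.continuous, ← hL]
      · simp_rw [integral_const_mul, ← pairing_eq hg.continuous, ← hL]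
        simp only [smul_apply, ContinuousLinearMap.comp_apply, map_smul, smul_eq_mul]
        congr 1
        · ring
        · exact Finset.sum_congr rfl fun l _ => by ring
      · exact fun l _ => (integrable_mul_cont hg.continuous _).const_mul _
      · exact (integrable_mul_cont hg.continuous _).const_mul _
      · exact integrable_finsetSum _ fun l _ => (integrable_mul_cont hg.continuous _).const_mul _
    simp_rw [e]
    have j2 := hMN.intM j mb hx
    have j3 : ∀ l, IntervalIntegrable (fun ξ => (χ x * L (p.W l x)) * (b ξ * N x ξ l j))
        volume 0 x := fun l => (hMN.intN l j mb hx).const_mul _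
    have j4 : IntervalIntegrable (fun ξ => ∑ l, (χ x * L (p.W l x)) * (b ξ * N x ξ l j))
        volume 0 x := by
      have := IntervalIntegrable.sum Finset.univ fun l _ => j3 l
      rwa [Finset.sum_fn] at this
    rw [intervalIntegral.integral_add
      ((χ x • L ∘L hsOp (p.sigma x)).intervalIntegrable_comp j2) j4,
      (χ x • L ∘L hsOp (p.sigma x)).intervalIntegral_comp_comm j2,
      intervalIntegral.integral_finsetSum fun l _ => j3 l]
    simp_rw [intervalIntegral.integral_const_mul]
    simp only [map_smul, map_add, map_sum, smul_apply, ContinuousLinearMap.comp_apply, smul_eq_mul,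
      mul_add, Finset.mul_sum, colM, colN]
    congr 1
    exact Finset.sum_congr rfl fun l _ => by ring
  beta_reduce at hweak
  rw [intervalIntegral.integral_congr T1, T2, T3, T4, intervalIntegral.integral_congr T5,
    intervalIntegral.integral_sub (L.intervalIntegrable_comp i5)
      (L.intervalIntegrable_comp (i1.add i2)), L.intervalIntegral_comp_comm i5,
    L.intervalIntegral_comp_comm (i1.add i2), L.intervalIntegral_comp_comm i3,
    L.intervalIntegral_comp_comm i4, L.intervalIntegral_comp_comm i6] at hweak
  have er : ∀ x, χ x • rhsM p M N j b b' x = χ x • b x • p.W j x - χ x • (p.mu j 0 * b 0) • M j x 0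
      - χ x • colM M j (fun ξ => p.mu j ξ * b' ξ) x
      + χ x • (hsOp (p.sigma x) (colM M j b x) + ∑ l, colN N l j b x • p.W l x) := by
    intro x
    rw [rhsM, smul_add, smul_sub, smul_sub]
  simp_rw [er]
  rw [intervalIntegral.integral_add ((i3.sub i4).sub i5) i6,
    intervalIntegral.integral_sub (i3.sub i4) i5, intervalIntegral.integral_sub i3 i4]
  rw [map_sub, map_add, map_add, map_sub, map_sub]
  linarith

/-- The second component of the right-hand side in the equation of the column `j`. -/
def rhsN (p : Params m) (M : Fin m → ℝ → ℝ → H) (N : ℝ → ℝ → Matrix (Fin m) (Fin m) ℝ)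
    (i j : Fin m) (b b' : ℝ → ℝ) (x : ℝ) : ℝ :=
  b x * p.Psi x i j - (p.mu j 0 * b 0) * N x 0 i j - colN N i j (fun ξ => p.mu j ξ * b' ξ) x
    + (inner ℝ (p.Theta i x) (colM M j b x) + ∑ l, p.Psi x i l * colN N l j b x)

lemma memLp_cont_mul {a f : ℝ → ℝ} (ha : ContinuousOn a (Icc 0 1)) (hf : MemLp f 2 muI) :
    MemLp (fun x => a x * f x) 2 muI := by
  have : IsMult fun x => ContinuousLinearMap.toSpanSingleton ℝ (a x) :=
    IsMult.of_continuousOn ((ContinuousLinearMap.toSpanSingletonCLE (𝕜 := ℝ)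
      (E := ℝ)).continuous.comp_continuousOn ha)
  refine (this.memLp hf).congr_norm ?_ ?_
  · exact (ha.aestronglyMeasurable measurableSet_Icc).mul hf.1
  · exact ae_of_all _ fun x => by simp [mul_comm]

lemma Params.Standing.isMult_Theta (hp : p.Standing) (i : Fin m) :
    IsMult fun x => (innerSL ℝ (p.Theta i x) : H →L[ℝ] ℝ) :=
  IsMult.of_continuousOn ((innerSL ℝ (E := H)).continuous.comp_continuousOn (hp.Theta_cont i))

lemma Params.Standing.Psi_entry_cont (hp : p.Standing) (i j : Fin m) :
    ContinuousOn (fun x => p.Psi x i j) (Icc 0 1) :=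
  (continuous_apply_apply i j).comp_continuousOn hp.Psi_cont

/-- Same separation of variables as for `M`. The equation is multiplied by `-1`, so that its
transport speed `-μ_i` matches the second block of `aOp` and its source matches that of `bOp`. -/
lemma IsObserverKernel.weak_N (hp : p.Standing) (hMN : IsObserverKernel p n M N) (i j : Fin m)
    {b b' χ χ' : ℝ → ℝ} (hb : ∀ x, HasDerivAt b (b' x) x) (hb' : Continuous b')
    (hχ : ∀ x, HasDerivAt χ (χ' x) x) (hχ' : Continuous χ') :
    (∫ x in (0 : ℝ)..1, (χ' x * (-p.mu i x * colN N i j b x)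
        + χ x * (-p.muX i x * colN N i j b x)))
      + ∫ x in (0 : ℝ)..1, χ x * rhsN p M N i j b b' x
      = χ 1 * (-p.mu i 1 * colN N i j b 1) := by
  have h1mem : (1 : ℝ) ∈ Icc (0 : ℝ) 1 := right_mem_Icc.2 zero_le_one
  have hbc : Continuous b := continuous_iff_continuousAt.2 fun x => (hb x).continuousAt
  have hχc : Continuous χ := continuous_iff_continuousAt.2 fun x => (hχ x).continuousAt
  have mb : MemLp b 2 muI := memLp_of_continuousOn hbc.continuousOn
  have mb' : MemLp b' 2 muI := memLp_of_continuousOn hb'.continuousOn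
  have mmb' := memLp_mu_mul hp j mb'
  have smul_int : ∀ {χ : ℝ → ℝ} {f : ℝ → ℝ}, Continuous χ → MemLp f 2 muI →
      IntervalIntegrable (fun x => χ x * f x) volume 0 1 := fun hχ hf =>
    (integrable_muI.1 (hf.integrable one_le_two)).continuousOn_mul hχ.continuousOn
  have mN := hMN.memLp_colN i j mb
  have i1 : IntervalIntegrable (fun x => χ' x * (-p.mu i x * colN N i j b x)) volume 0 1 :=
    smul_int hχ' (memLp_cont_mul (hp.mu_cont i).neg mN)
  have i2 : IntervalIntegrable (fun x => χ x * (-p.muX i x * colN N i j b x)) volume 0 1 :=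
    smul_int hχc (memLp_cont_mul (hp.muX_cont i).neg mN)
  have mP : MemLp (fun x => b x * p.Psi x i j) 2 muI :=
    memLp_of_continuousOn (hbc.continuousOn.mul (hp.Psi_entry_cont i j))
  have m0 : MemLp (fun x => (p.mu j 0 * b 0) * N x 0 i j) 2 muI :=
    (hMN.memLp_N_zero i j).const_mul (p.mu j 0 * b 0)
  have mK := hMN.memLp_colN i j mmb'
  have mS : MemLp (fun x => inner ℝ (p.Theta i x) (colM M j b x)
      + ∑ l, p.Psi x i l * colN N l j b x) 2 muI :=
    ((hp.isMult_Theta i).memLp (hMN.memLp_colM j mb)).add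
      (memLp_finsetSum _ fun l _ => memLp_cont_mul (hp.Psi_entry_cont i l) (hMN.memLp_colN l j mb))
  have i3 := smul_int hχc mP
  have i4 := smul_int hχc m0
  have i5 := smul_int hχc mK
  have i6 := smul_int hχc mS
  have hweak := hMN.eq_N i j (fun x ξ => χ x * b ξ) (by
    have hb1 : ContDiff ℝ 1 b := contDiff_one_iff_deriv.2
      ⟨fun x => (hb x).differentiableAt, by rwa [funext fun x => (hb x).deriv]⟩
    have hχ1 : ContDiff ℝ 1 χ := contDiff_one_iff_deriv.2
      ⟨fun x => (hχ x).differentiableAt, by rwa [funext fun x => (hχ x).deriv]⟩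
    exact (hχ1.comp contDiff_fst).mul (hb1.comp contDiff_snd))
  have T1 : ∀ x ∈ uIcc (0 : ℝ) 1, (∫ ξ in (0 : ℝ)..x, N x ξ i j *
        (-derivWithin (fun s => p.mu i s * (χ s * b ξ)) (Icc 0 1) x
          - p.mu j ξ * deriv (fun s => χ x * b s) ξ))
      = (χ' x * (-p.mu i x * colN N i j b x) + χ x * (-p.muX i x * colN N i j b x))
        - χ x * colN N i j (fun ξ => p.mu j ξ * b' ξ) x := by
    intro x hx
    rw [uIcc_of_le zero_le_one] at hx
    have e : ∀ ξ, N x ξ i j * (-derivWithin (fun s => p.mu i s * (χ s * b ξ)) (Icc 0 1) x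
          - p.mu j ξ * deriv (fun s => χ x * b s) ξ)
        = (χ' x * (-p.mu i x) + χ x * (-p.muX i x)) * (b ξ * N x ξ i j)
          - χ x * (p.mu j ξ * b' ξ * N x ξ i j) := by
      intro ξ
      have d1 : HasDerivWithinAt (fun s => p.mu i s * (χ s * b ξ))
          (p.muX i x * (χ x * b ξ) + p.mu i x * (χ' x * b ξ)) (Icc 0 1) x :=
        (hp.hasDerivWithinAt_mu i hx).mul ((hχ x).hasDerivWithinAt.mul_const _)
      rw [d1.derivWithin (uniqueDiffOn_Icc zero_lt_one x hx), ((hb ξ).const_mul (χ x)).deriv]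
      ring
    simp_rw [e]
    rw [intervalIntegral.integral_sub ((hMN.intN i j mb hx).const_mul _)
      ((hMN.intN i j mmb' hx).const_mul _), intervalIntegral.integral_const_mul,
      intervalIntegral.integral_const_mul, colN, colN]
    ring
  have T2 : (∫ ξ in (0 : ℝ)..1, p.mu i 1 * N 1 ξ i j * (χ 1 * b ξ))
      = - (χ 1 * (-p.mu i 1 * colN N i j b 1)) := by
    have e : ∀ ξ, p.mu i 1 * N 1 ξ i j * (χ 1 * b ξ) = (p.mu i 1 * χ 1) * (b ξ * N 1 ξ i j) :=
      fun ξ => by ring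
    simp_rw [e]
    rw [intervalIntegral.integral_const_mul, colN]; ring
  have T3 : (∫ x in (0 : ℝ)..1, (p.mu i x - p.mu j x) * N x x i j * (χ x * b x))
      = - ∫ x in (0 : ℝ)..1, χ x * (b x * p.Psi x i j) := by
    rw [← intervalIntegral.integral_neg]
    refine integral_congr_muI ?_ h1mem
    filter_upwards [hMN.diag_N i j] with x hx
    rw [hx]; ring
  have T4 : (∫ x in (0 : ℝ)..1, p.mu j 0 * N x 0 i j * (χ x * b 0))
      = ∫ x in (0 : ℝ)..1, χ x * ((p.mu j 0 * b 0) * N x 0 i j) :=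
    intervalIntegral.integral_congr fun x _ => by ring
  have T5 : ∀ x ∈ uIcc (0 : ℝ) 1, (∫ ξ in (0 : ℝ)..x,
        (-(∫ y, p.Theta i x y * M j x ξ y ∂muI) - ∑ l, p.Psi x i l * N x ξ l j) * (χ x * b ξ))
      = - (χ x * (inner ℝ (p.Theta i x) (colM M j b x) + ∑ l, p.Psi x i l * colN N l j b x)) := by
    intro x hx
    rw [uIcc_of_le zero_le_one] at hx
    have e : ∀ ξ, (-(∫ y, p.Theta i x y * M j x ξ y ∂muI) - ∑ l, p.Psi x i l * N x ξ l j)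
          * (χ x * b ξ)
        = (-χ x • (innerSL ℝ (p.Theta i x) : H →L[ℝ] ℝ)) (b ξ • M j x ξ)
          + ∑ l, (-χ x * p.Psi x i l) * (b ξ * N x ξ l j) := by
      intro ξ
      rw [← inner_H, sub_mul, Finset.sum_mul, sub_eq_add_neg, ← Finset.sum_neg_distrib]
      simp only [smul_apply, innerSL_apply_apply, inner_smul_right, smul_eq_mul]
      congr 1
      · ring
      · exact Finset.sum_congr rfl fun l _ => by ring
    simp_rw [e]
    have j2 := hMN.intM j mb hx
    have j3 : ∀ l, IntervalIntegrable (fun ξ => (-χ x * p.Psi x i l) * (b ξ * N x ξ l j))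
        volume 0 x := fun l => (hMN.intN l j mb hx).const_mul _
    have j4 : IntervalIntegrable (fun ξ => ∑ l, (-χ x * p.Psi x i l) * (b ξ * N x ξ l j))
        volume 0 x := by
      have := IntervalIntegrable.sum Finset.univ fun l _ => j3 l
      rwa [Finset.sum_fn] at this
    rw [intervalIntegral.integral_add (ContinuousLinearMap.intervalIntegrable_comp _ j2) j4,
      ContinuousLinearMap.intervalIntegral_comp_comm _ j2,
      intervalIntegral.integral_finsetSum fun l _ => j3 l]
    simp_rw [intervalIntegral.integral_const_mul]
    simp only [smul_apply, innerSL_apply_apply, smul_eq_mul, mul_add, Finset.mul_sum, neg_add,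
      ← Finset.sum_neg_distrib, colM, colN]
    congr 1
    · ring
    · exact Finset.sum_congr rfl fun l _ => by ring
  beta_reduce at hweak
  rw [intervalIntegral.integral_congr T1, T2, T3, T4, intervalIntegral.integral_congr T5,
    intervalIntegral.integral_sub (i1.add i2) i5, intervalIntegral.integral_neg] at hweak
  have er : ∀ x, χ x * rhsN p M N i j b b' x = χ x * (b x * p.Psi x i j)
      - χ x * ((p.mu j 0 * b 0) * N x 0 i j) - χ x * colN N i j (fun ξ => p.mu j ξ * b' ξ) x
      + χ x * (inner ℝ (p.Theta i x) (colM M j b x) + ∑ l, p.Psi x i l * colN N l j b x) := by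
    intro x
    rw [rhsN]; ring
  simp_rw [er]
  rw [intervalIntegral.integral_add ((i3.sub i4).sub i5) i6,
    intervalIntegral.integral_sub (i3.sub i4) i5, intervalIntegral.integral_sub i3 i4]
  linarith

end Columns

/-! ### The fibre `H × ℝᵐ` and its block operators. -/

section Blocks

variable {m : ℕ}

/-- The space of the `m` left-going components. -/
abbrev Eu (m : ℕ) : Type := EuclideanSpace ℝ (Fin m)

/-- The values of the state at a point `x`. -/
abbrev Xs (m : ℕ) : Type := WithLp 2 (H × Eu m)

/-- First component of a value. -/
def pr1 : Xs m →L[ℝ] H := WithLp.fstL 2 ℝ H (Eu m)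

/-- Second component of a value. -/
def pr2 : Xs m →L[ℝ] Eu m := WithLp.sndL 2 ℝ H (Eu m)

/-- Embedding of the first component. -/
def in1 : H →L[ℝ] Xs m :=
  ((WithLp.prodContinuousLinearEquiv 2 ℝ H (Eu m)).symm : H × Eu m →L[ℝ] Xs m) ∘L
    ContinuousLinearMap.inl ℝ H (Eu m)

/-- Embedding of the second component. -/
def in2 : Eu m →L[ℝ] Xs m :=
  ((WithLp.prodContinuousLinearEquiv 2 ℝ H (Eu m)).symm : H × Eu m →L[ℝ] Xs m) ∘L
    ContinuousLinearMap.inr ℝ H (Eu m)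

@[simp] lemma pr1_in1 (h : H) : pr1 (in1 h : Xs m) = h := rfl
@[simp] lemma pr2_in1 (h : H) : pr2 (in1 h : Xs m) = 0 := rfl
@[simp] lemma pr1_in2 (v : Eu m) : pr1 (in2 v) = 0 := rfl
@[simp] lemma pr2_in2 (v : Eu m) : pr2 (in2 v) = v := rfl

lemma Xs_ext {a b : Xs m} (h1 : pr1 a = pr1 b) (h2 : pr2 a = pr2 b) : a = b :=
  WithLp.ofLp_injective 2 (Prod.ext h1 h2)

lemma in1_pr1_add (a : Xs m) : in1 (pr1 a) + in2 (pr2 a) = a :=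
  Xs_ext (by simp) (by simp)

lemma norm_sq_Xs (a : Xs m) : ‖a‖ ^ 2 = ‖pr1 a‖ ^ 2 + ‖pr2 a‖ ^ 2 :=
  WithLp.prod_norm_sq_eq_of_L2 a

lemma inner_Xs (a b : Xs m) : inner ℝ a b = inner ℝ (pr1 a) (pr1 b) + inner ℝ (pr2 a) (pr2 b) :=
  WithLp.prod_inner_apply a b

/-- The `i`-th coordinate. -/
def coordE (i : Fin m) : Eu m →L[ℝ] ℝ := EuclideanSpace.proj i

@[simp] lemma coordE_apply (i : Fin m) (v : Eu m) : coordE i v = v i := rfl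

/-- The `i`-th unit vector. -/
def unitE (i : Fin m) : Eu m := EuclideanSpace.single i 1

@[simp] lemma unitE_apply (i j : Fin m) : unitE i j = if j = i then (1 : ℝ) else 0 := by
  simp [unitE]

lemma sum_smul_unitE_apply (f : Fin m → ℝ) (i : Fin m) : (∑ j, f j • unitE j : Eu m) i = f i := by
  simp

/-- Diagonal operators. -/
def diagE (d : Fin m → ℝ) : Eu m →L[ℝ] Eu m :=
  ∑ i, d i • ContinuousLinearMap.toSpanSingleton ℝ (unitE i) ∘L coordE i

@[simp] lemma diagE_apply (d : Fin m → ℝ) (v : Eu m) (i : Fin m) : diagE d v i = d i * v i := by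
  have : diagE d v = ∑ i, (d i * v i) • unitE i := by
    simp [diagE, smul_smul]
  rw [this, sum_smul_unitE_apply]

lemma continuousOn_diagE {f : Fin m → ℝ → ℝ} {s : Set ℝ} (hf : ∀ i, ContinuousOn (f i) s) :
    ContinuousOn (fun x => diagE fun i => f i x) s :=
  continuousOn_finsetSum _ fun i _ => (hf i).smul continuousOn_const

end Blocks

/-! ### Coupling, transport matrix and kernel columns as operators on the fibre. -/

section Operators

variable {m : ℕ} {p : Params m} {n : Fin m → Fin m → ℝ → ℝ} {M : Fin m → ℝ → ℝ → H}
  {N : ℝ → ℝ → Matrix (Fin m) (Fin m) ℝ}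

/-- `v ↦ W(x) v`. -/
def wOp (p : Params m) (x : ℝ) : Eu m →L[ℝ] H :=
  ∑ j, ContinuousLinearMap.toSpanSingleton ℝ (p.W j x) ∘L coordE j

lemma wOp_apply (x : ℝ) (v : Eu m) : wOp p x v = ∑ j, v j • p.W j x := by
  simp [wOp]

/-- `u ↦ ∫ Θ(x,y) u(y) dy`. -/
def thetaOp (p : Params m) (x : ℝ) : H →L[ℝ] Eu m :=
  ∑ i, ContinuousLinearMap.toSpanSingleton ℝ (unitE i) ∘L innerSL ℝ (p.Theta i x)

@[simp] lemma thetaOp_apply (x : ℝ) (h : H) (i : Fin m) :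
    thetaOp p x h i = inner ℝ (p.Theta i x) h := by
  have : thetaOp p x h = ∑ i, (inner ℝ (p.Theta i x) h : ℝ) • unitE i := by
    simp [thetaOp]
  rw [this, sum_smul_unitE_apply]

/-- `v ↦ Ψ(x) v`. -/
def psiOp (p : Params m) (x : ℝ) : Eu m →L[ℝ] Eu m :=
  ∑ i, ∑ l, p.Psi x i l • ContinuousLinearMap.toSpanSingleton ℝ (unitE i) ∘L coordE l

@[simp] lemma psiOp_apply (x : ℝ) (v : Eu m) (i : Fin m) :
    psiOp p x v i = ∑ l, p.Psi x i l * v l := by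
  have : psiOp p x v = ∑ i, (∑ l, p.Psi x i l * v l) • unitE i := by
    simp [psiOp, smul_smul, Finset.sum_smul]
  rw [this, sum_smul_unitE_apply]

/-- The zeroth order coupling operators `[[σ, W], [Θ, Ψ]]`. -/
def bOp (p : Params m) (x : ℝ) : Xs m →L[ℝ] Xs m :=
  in1 ∘L (hsOp (p.sigma x) ∘L pr1 + wOp p x ∘L pr2) + in2 ∘L (thetaOp p x ∘L pr1 + psiOp p x ∘L pr2)

lemma pr1_bOp (x : ℝ) (a : Xs m) : pr1 (bOp p x a) = hsOp (p.sigma x) (pr1 a) + wOp p x (pr2 a) := by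
  simp [bOp]

lemma pr2_bOp (x : ℝ) (a : Xs m) : pr2 (bOp p x a) = thetaOp p x (pr1 a) + psiOp p x (pr2 a) := by
  simp [bOp]

lemma Params.Standing.isMult_bOp (hp : p.Standing) : IsMult (bOp p) := by
  have h1 : ContinuousOn (wOp p) (Icc 0 1) := continuousOn_finsetSum _ fun j _ =>
    ((ContinuousLinearMap.toSpanSingletonCLE (𝕜 := ℝ) (E := H)).continuous.comp_continuousOn
      (hp.W_cont j)).clm_comp continuousOn_const
  have h2 : ContinuousOn (thetaOp p) (Icc 0 1) := continuousOn_finsetSum _ fun j _ =>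
    continuousOn_const.clm_comp ((innerSL ℝ (E := H)).continuous.comp_continuousOn (hp.Theta_cont j))
  have h3 : ContinuousOn (psiOp p) (Icc 0 1) := continuousOn_finsetSum _ fun i _ =>
    continuousOn_finsetSum _ fun l _ => (hp.Psi_entry_cont i l).smul continuousOn_const
  have h4 := hsOp.continuous.comp_continuousOn hp.sigma_cont
  exact IsMult.of_continuousOn ((continuousOn_const.clm_comp
    ((h4.clm_comp continuousOn_const).add (h1.clm_comp continuousOn_const))).add
    (continuousOn_const.clm_comp
      ((h2.clm_comp continuousOn_const).add (h3.clm_comp continuousOn_const))))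

/-- The matrix of transport speeds `diag(λ, -μ)`. -/
def aOp (hp : p.Standing) (x : ℝ) : Xs m →L[ℝ] Xs m :=
  in1 ∘L mulH (slice hp.lam_cont x) ∘L pr1 - in2 ∘L diagE (fun i => p.mu i x) ∘L pr2

/-- The inverse of the matrix of transport speeds. -/
def aInv (hp : p.Standing) (x : ℝ) : Xs m →L[ℝ] Xs m :=
  in1 ∘L mulH (slice hp.lamInv_cont x) ∘L pr1 - in2 ∘L diagE (fun i => (p.mu i x)⁻¹) ∘L pr2

lemma pr1_aOp (hp : p.Standing) (x : ℝ) (a : Xs m) :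
    pr1 (aOp hp x a) = mulH (slice hp.lam_cont x) (pr1 a) := by simp [aOp]

lemma pr2_aOp (hp : p.Standing) (x : ℝ) (a : Xs m) :
    pr2 (aOp hp x a) = -diagE (fun i => p.mu i x) (pr2 a) := by simp [aOp]

lemma pr1_aInv (hp : p.Standing) (x : ℝ) (a : Xs m) :
    pr1 (aInv hp x a) = mulH (slice hp.lamInv_cont x) (pr1 a) := by simp [aInv]

lemma pr2_aInv (hp : p.Standing) (x : ℝ) (a : Xs m) :
    pr2 (aInv hp x a) = -diagE (fun i => (p.mu i x)⁻¹) (pr2 a) := by simp [aInv]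

lemma mulH_lamInv_lam (hp : p.Standing) (x : ℝ) (h : H) :
    mulH (slice hp.lamInv_cont x) (mulH (slice hp.lam_cont x) h) = h := by
  have h1 : slice hp.lamInv_cont x * slice hp.lam_cont x = 1 := by
    ext y
    exact inv_mul_cancel₀ (hp.lam_pos _ (projIcc 0 1 zero_le_one x).2 _ y.2).ne'
  rw [← mulH_mul, h1, mulH_one]

lemma mulH_lam_lamInv (hp : p.Standing) (x : ℝ) (h : H) :
    mulH (slice hp.lam_cont x) (mulH (slice hp.lamInv_cont x) h) = h := by
  rw [← mulH_mul, mul_comm, mulH_mul, mulH_lamInv_lam hp]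

lemma aOp_aInv (hp : p.Standing) {x : ℝ} (hx : x ∈ Icc (0 : ℝ) 1) (a : Xs m) :
    aOp hp x (aInv hp x a) = a := by
  refine Xs_ext ?_ ?_
  · rw [pr1_aOp, pr1_aInv, mulH_lam_lamInv hp]
  · rw [pr2_aOp, pr2_aInv]
    ext i
    have := (hp.mu_pos i x hx).ne'
    simp [this]

lemma isMult_aOp (hp : p.Standing) : IsMult (aOp hp) :=
  IsMult.of_continuousOn ((continuousOn_const.clm_comp
    ((mulH.continuous.comp (continuous_slice hp.lam_cont)).continuousOn.clm_comp
      continuousOn_const)).sub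
    (continuousOn_const.clm_comp ((continuousOn_diagE hp.mu_cont).clm_comp continuousOn_const)))

lemma isMult_aInv (hp : p.Standing) : IsMult (aInv hp) :=
  IsMult.of_continuousOn ((continuousOn_const.clm_comp
    ((mulH.continuous.comp (continuous_slice hp.lamInv_cont)).continuousOn.clm_comp
      continuousOn_const)).sub
    (continuousOn_const.clm_comp ((continuousOn_diagE fun i => (hp.mu_cont i).inv₀
      fun x hx => (hp.mu_pos i x hx).ne').clm_comp continuousOn_const)))

/-- The `j`-th column of the kernel. -/
def kcol (M : Fin m → ℝ → ℝ → H) (N : ℝ → ℝ → Matrix (Fin m) (Fin m) ℝ) (j : Fin m) (x ξ : ℝ) :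
    Xs m := in1 (M j x ξ) + in2 (∑ i, N x ξ i j • unitE i)

@[simp] lemma pr1_kcol (j : Fin m) (x ξ : ℝ) : pr1 (kcol M N j x ξ) = M j x ξ := by simp [kcol]

@[simp] lemma pr2_kcol (i j : Fin m) (x ξ : ℝ) : pr2 (kcol M N j x ξ) i = N x ξ i j := by
  simp [kcol]

lemma IsObserverKernel.kcol_meas (hMN : IsObserverKernel p n M N) (j : Fin m) :
    StronglyMeasurable fun q : ℝ × ℝ => kcol M N j q.1 q.2 :=
  (in1.continuous.comp_stronglyMeasurable (hMN.M_meas j)).add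
    (in2.continuous.comp_stronglyMeasurable (Finset.stronglyMeasurable_fun_sum _ fun i _ =>
      (hMN.N_meas i j).stronglyMeasurable.smul_const _))

lemma IsObserverKernel.kcol_bound (hMN : IsObserverKernel p n M N) :
    ∃ C, 0 ≤ C ∧ ∀ j, ∀ x ∈ Icc (0 : ℝ) 1, ∀ ξ ∈ Icc 0 x, ‖kcol M N j x ξ‖ ≤ C := by
  obtain ⟨C, hC⟩ := hMN.bounded
  refine ⟨‖(in1 : H →L[ℝ] Xs m)‖ * max C 0 + ‖(in2 : Eu m →L[ℝ] Xs m)‖ *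
    ∑ i : Fin m, max C 0 * ‖(unitE i : Eu m)‖, by positivity, fun j x hx ξ hξ => ?_⟩
  refine (norm_add_le _ _).trans (add_le_add ((in1.le_opNorm _).trans ?_)
    ((in2.le_opNorm _).trans ?_))
  · exact mul_le_mul_of_nonneg_left (((hC x hx ξ hξ).1 j).trans (le_max_left _ _)) (norm_nonneg _)
  · refine mul_le_mul_of_nonneg_left (norm_sum_le_of_le _ fun i _ => ?_) (norm_nonneg _)
    rw [norm_smul]
    exact mul_le_mul_of_nonneg_right (((hC x hx ξ hξ).2 i j).trans (le_max_left _ _)) (norm_nonneg _)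

lemma IsObserverKernel.isKer_col (hMN : IsObserverKernel p n M N) (j : Fin m) :
    IsKer fun x ξ => ContinuousLinearMap.toSpanSingleton ℝ (kcol M N j x ξ) := by
  obtain ⟨C, -, hC⟩ := hMN.kcol_bound
  exact isKer_smulRight (hMN.kcol_meas j) (hC j)

lemma IsObserverKernel.intCol (hMN : IsObserverKernel p n M N) (j : Fin m) {b : ℝ → ℝ}
    (hb : MemLp b 2 muI) {x : ℝ} (hx : x ∈ Icc (0 : ℝ) 1) :
    IntervalIntegrable (fun ξ => b ξ • kcol M N j x ξ) volume 0 x :=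
  (hMN.isKer_col j).integrable hb hx

/-- `∫₀ˣ k_j(x,ξ) b(ξ) dξ`. -/
def colX (M : Fin m → ℝ → ℝ → H) (N : ℝ → ℝ → Matrix (Fin m) (Fin m) ℝ) (j : Fin m) (b : ℝ → ℝ)
    (x : ℝ) : Xs m := ∫ ξ in (0 : ℝ)..x, b ξ • kcol M N j x ξ

lemma IsObserverKernel.pr1_colX (hMN : IsObserverKernel p n M N) (j : Fin m) {b : ℝ → ℝ}
    (hb : MemLp b 2 muI) {x : ℝ} (hx : x ∈ Icc (0 : ℝ) 1) :
    pr1 (colX M N j b x) = colM M j b x := by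
  rw [colX, ← pr1.intervalIntegral_comp_comm (hMN.intCol j hb hx)]
  simp [colM]

lemma IsObserverKernel.pr2_colX (hMN : IsObserverKernel p n M N) (i j : Fin m) {b : ℝ → ℝ}
    (hb : MemLp b 2 muI) {x : ℝ} (hx : x ∈ Icc (0 : ℝ) 1) :
    pr2 (colX M N j b x) i = colN N i j b x := by
  rw [colX, ← coordE_apply, ← ContinuousLinearMap.comp_apply,
    ← (coordE i ∘L pr2).intervalIntegral_comp_comm (hMN.intCol j hb hx)]
  simp [colN]

/-- The right-hand side in the equation of the column `j`. -/
def rhsX (p : Params m) (M : Fin m → ℝ → ℝ → H) (N : ℝ → ℝ → Matrix (Fin m) (Fin m) ℝ)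
    (j : Fin m) (b b' : ℝ → ℝ) (x : ℝ) : Xs m :=
  b x • bOp p x (in2 (unitE j)) - (p.mu j 0 * b 0) • kcol M N j x 0
    - colX M N j (fun ξ => p.mu j ξ * b' ξ) x + bOp p x (colX M N j b x)

lemma pr1_rhsX (hp : p.Standing) (hMN : IsObserverKernel p n M N) (j : Fin m) {b b' : ℝ → ℝ}
    (hb : MemLp b 2 muI) (hb' : MemLp b' 2 muI) {x : ℝ} (hx : x ∈ Icc (0 : ℝ) 1) :
    pr1 (rhsX p M N j b b' x) = rhsM p M N j b b' x := by
  simp only [rhsX, rhsM, map_add, map_sub, map_smul, pr1_kcol, pr1_bOp,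
    hMN.pr1_colX j hb hx, hMN.pr1_colX j (memLp_mu_mul hp j hb') hx, pr1_in2, pr2_in2, wOp_apply,
    hMN.pr2_colX _ j hb hx]
  simp

lemma pr2_rhsX (hp : p.Standing) (hMN : IsObserverKernel p n M N) (i j : Fin m) {b b' : ℝ → ℝ}
    (hb : MemLp b 2 muI) (hb' : MemLp b' 2 muI) {x : ℝ} (hx : x ∈ Icc (0 : ℝ) 1) :
    pr2 (rhsX p M N j b b' x) i = rhsN p M N i j b b' x := by
  simp only [rhsX, rhsN, map_add, map_sub, map_smul, PiLp.add_apply, PiLp.sub_apply,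
    PiLp.smul_apply, pr2_kcol, pr2_bOp, hMN.pr1_colX j hb hx,
    hMN.pr2_colX _ j (memLp_mu_mul hp j hb') hx, pr1_in2, pr2_in2, hMN.pr2_colX _ j hb hx,
    thetaOp_apply, psiOp_apply, smul_eq_mul]
  simp

end Operators

/-! ### Generalities on primitives and integration operators. -/

section General

variable {X Y Z : Type*} [NormedAddCommGroup X] [InnerProductSpace ℝ X] [CompleteSpace X]
  [NormedAddCommGroup Y] [InnerProductSpace ℝ Y] [CompleteSpace Y]
  [NormedAddCommGroup Z] [InnerProductSpace ℝ Z] [CompleteSpace Z]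

lemma IsPrim.clm {Y Z : Type*} [NormedAddCommGroup Y] [NormedSpace ℝ Y] [CompleteSpace Y]
    [NormedAddCommGroup Z] [NormedSpace ℝ Z] [CompleteSpace Z] (L : Y →L[ℝ] Z) {f f' : ℝ → Y}
    (h : IsPrim f f') : IsPrim (fun x => L (f x)) (fun x => L (f' x)) := by
  refine ⟨L.intervalIntegrable_comp h.1, fun x hx => ?_⟩
  rw [L.intervalIntegral_comp_comm (h.intervalIntegrable hx), ← map_add, ← h.2 x hx]

lemma isPrim_of_hasDerivWithinAt {f f' : ℝ → X}
    (h : ∀ x ∈ Icc (0 : ℝ) 1, HasDerivWithinAt f (f' x) (Icc 0 1) x)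
    (hf' : ContinuousOn f' (Icc 0 1)) : IsPrim f f' := by
  have hi : IntervalIntegrable f' volume 0 1 := by
    refine ContinuousOn.intervalIntegrable ?_
    rwa [uIcc_of_le zero_le_one]
  refine ⟨hi, fun x hx => ?_⟩
  have hsub : Icc (0 : ℝ) x ⊆ Icc 0 1 := Icc_subset_Icc_right hx.2
  rw [intervalIntegral.integral_eq_sub_of_hasDeriv_right_of_le (f := f) hx.1
    (fun s hs => ((h s (hsub hs)).continuousWithinAt).mono hsub)
    (fun s hs => ((h s (hsub (Ioo_subset_Icc_self hs))).hasDerivAt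
      (Icc_mem_nhds hs.1 (hs.2.trans_le hx.2))).hasDerivWithinAt)
    (hi.mono_set (by rw [uIcc_of_le hx.1, uIcc_of_le zero_le_one]; exact hsub))]
  abel

lemma IsMult.op_ae_of {B : ℝ → Z →L[ℝ] Y} (h : IsMult B) {f : Lp Z 2 muI} {g : ℝ → Z}
    (hg : f =ᵐ[muI] g) : h.op f =ᵐ[muI] fun x => B x (g x) := by
  filter_upwards [h.op_ae f, hg] with x h1 h2
  rw [h1, h2]

lemma IsKer.op_ae_of {k : ℝ → ℝ → Z →L[ℝ] Y} (h : IsKer k) {f : Lp Z 2 muI} {g : ℝ → Z}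
    (hg : f =ᵐ[muI] g) : h.op f =ᵐ[muI] fun x => ∫ ξ in (0 : ℝ)..x, k x ξ (g ξ) := by
  filter_upwards [h.op_ae f, ae_muI_of_forall fun x hx => hx] with x h1 hx
  rw [h1]
  refine integral_congr_muI ?_ hx
  filter_upwards [hg] with ξ h2
  rw [h2]

/-- The kernel of the primitive. -/
lemma isKer_id : IsKer fun _ _ : ℝ => ContinuousLinearMap.id ℝ X :=
  ⟨stronglyMeasurable_const, 1, zero_le_one, fun _ _ _ _ => ContinuousLinearMap.norm_id_le⟩

/-- The primitive that vanishes at `0`. -/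
def primOp : Lp X 2 muI →L[ℝ] Lp X 2 muI := (isKer_id (X := X)).op

lemma primOp_ae (f : Lp X 2 muI) : primOp f =ᵐ[muI] fun x => ∫ ξ in (0 : ℝ)..x, f ξ :=
  isKer_id.op_ae f

lemma primOp_ae_of {f : Lp X 2 muI} {g : ℝ → X} (hg : f =ᵐ[muI] g) :
    primOp f =ᵐ[muI] fun x => ∫ ξ in (0 : ℝ)..x, g ξ := isKer_id.op_ae_of hg

lemma isVolt_primOp : IsVolt (primOp (X := X)) := isKer_id.isVolt

lemma exists_intOp : ∃ T : Lp X 2 muI →L[ℝ] X, ∀ f, T f = ∫ x in (0 : ℝ)..1, f x := by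
  have h1 : (1 : ℝ) ∈ Icc (0 : ℝ) 1 := right_mem_Icc.2 zero_le_one
  have hi : ∀ f : Lp X 2 muI, IntervalIntegrable f volume 0 1 := fun f =>
    integrable_muI.1 ((Lp.memLp f).integrable one_le_two)
  let T : Lp X 2 muI →ₗ[ℝ] X :=
    { toFun := fun f => ∫ x in (0 : ℝ)..1, f x
      map_add' := fun f g => by
        rw [← intervalIntegral.integral_add (hi f) (hi g)]
        exact integral_congr_muI (Lp.coeFn_add f g) h1
      map_smul' := fun c f => by
        rw [RingHom.id_apply, ← intervalIntegral.integral_smul]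
        exact integral_congr_muI (Lp.coeFn_smul c f) h1 }
  refine ⟨T.mkContinuous 1 fun f => ?_, fun f => rfl⟩
  rw [one_mul]
  refine (intervalIntegral.norm_integral_le_integral_norm zero_le_one).trans ?_
  refine abs_le_of_sq_le_sq' ?_ (norm_nonneg _) |>.2
  rw [norm_sq_eq_integral]
  exact sq_integral_norm_le (Lp.memLp f) h1

/-- The integral over `[0,1]`. -/
def intOp : Lp X 2 muI →L[ℝ] X := exists_intOp.choose

lemma intOp_eq (f : Lp X 2 muI) : intOp f = ∫ x in (0 : ℝ)..1, f x := exists_intOp.choose_spec f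

lemma intOp_eq_of {f : Lp X 2 muI} {g : ℝ → X} (hg : f =ᵐ[muI] g) :
    intOp f = ∫ x in (0 : ℝ)..1, g x := by
  rw [intOp_eq]; exact integral_congr_muI hg (right_mem_Icc.2 zero_le_one)

lemma isH1_primitive {f' : ℝ → X} (hf' : MemLp f' 2 muI) (c : X) :
    IsH1 (fun x => c + ∫ s in (0 : ℝ)..x, f' s) f' :=
  ⟨hf', fun x _ => by simp⟩

end General

/-! ### The integrated kernel equation for one column, first for smooth and then for `H¹` functions.
-/

section ColumnEquation

variable {m : ℕ} {p : Params m} {n : Fin m → Fin m → ℝ → ℝ} {M : Fin m → ℝ → ℝ → H}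
  {N : ℝ → ℝ → Matrix (Fin m) (Fin m) ℝ}

lemma isMult_scalar {a : ℝ → ℝ} (ha : ContinuousOn a (Icc 0 1)) :
    IsMult fun x => ContinuousLinearMap.toSpanSingleton ℝ (a x) :=
  IsMult.of_continuousOn ((ContinuousLinearMap.toSpanSingletonCLE (𝕜 := ℝ)
    (E := ℝ)).continuous.comp_continuousOn ha)

lemma IsObserverKernel.memLp_kcol_zero (hMN : IsObserverKernel p n M N) (j : Fin m) :
    MemLp (fun x => kcol M N j x 0) 2 muI := by
  obtain ⟨C, -, hC⟩ := hMN.kcol_bound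
  exact MemLp.of_bound ((hMN.kcol_meas j).comp_measurable
    (measurable_id.prodMk measurable_const)).aestronglyMeasurable C
    (ae_muI_of_forall fun x hx => hC j x hx 0 ⟨le_rfl, hx.1⟩)

lemma IsObserverKernel.memLp_colX (hMN : IsObserverKernel p n M N) (j : Fin m) {b : ℝ → ℝ}
    (hb : MemLp b 2 muI) : MemLp (colX M N j b) 2 muI := (hMN.isKer_col j).memLp hb

lemma memLp_rhsX (hp : p.Standing) (hMN : IsObserverKernel p n M N) (j : Fin m) {b b' : ℝ → ℝ}
    (hb : MemLp b 2 muI) (hb' : MemLp b' 2 muI) : MemLp (rhsX p M N j b b') 2 muI := by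
  refine MemLp.add (MemLp.sub (MemLp.sub ?_ ((hMN.memLp_kcol_zero j).const_smul (p.mu j 0 * b 0)))
    (hMN.memLp_colX j (memLp_mu_mul hp j hb'))) (hp.isMult_bOp.memLp (hMN.memLp_colX j hb))
  have : MemLp (fun x => bOp p x (b x • in2 (unitE j))) 2 muI :=
    hp.isMult_bOp.memLp ((ContinuousLinearMap.toSpanSingleton ℝ (in2 (unitE j))).comp_memLp' hb)
  simpa only [map_smul] using this

/-- The derivative of the inverse is written as `-(c a' c)` because `eq_primitive_of_weak` requires
this form. Absolute continuity holds in operator norm, since slices of a function that is `C¹` in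
`x` form a primitive in the sup norm. -/
lemma isPrim_mulH_lamInv (hp : p.Standing) : IsPrim (fun x => mulH (slice hp.lamInv_cont x))
    fun x => -(mulH (slice hp.lamInv_cont x) ∘L mulH (slice hp.lamX_cont x)
      ∘L mulH (slice hp.lamInv_cont x)) := by
  have h := (isPrim_slice hp.lamInv_cont hp.lamInvX_cont
    fun x hx y hy => hp.hasDerivWithinAt_lamInv hx hy).clm mulH
  convert h using 2 with x
  have : slice hp.lamInvX_cont x
      = -(slice hp.lamInv_cont x * (slice hp.lamX_cont x * slice hp.lamInv_cont x)) := by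
    ext y
    simp [slice, Params.lamInvX, mul_assoc]
  rw [this, map_neg]
  ext1 h
  simp only [neg_apply, ContinuousLinearMap.comp_apply, mulH_mul]

lemma isPrim_muInv (hp : p.Standing) (i : Fin m) :
    IsPrim (fun x => ContinuousLinearMap.toSpanSingleton ℝ (-(p.mu i x)⁻¹))
      fun x => -(ContinuousLinearMap.toSpanSingleton ℝ (-(p.mu i x)⁻¹)
        ∘L ContinuousLinearMap.toSpanSingleton ℝ (-p.muX i x)
        ∘L ContinuousLinearMap.toSpanSingleton ℝ (-(p.mu i x)⁻¹)) := by
  have hne : ∀ x ∈ Icc (0 : ℝ) 1, p.mu i x ≠ 0 := fun x hx => (hp.mu_pos i x hx).ne'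
  have h : IsPrim (fun x => -(p.mu i x)⁻¹) (fun x => -(-p.muX i x / p.mu i x ^ 2)) :=
    isPrim_of_hasDerivWithinAt (fun x hx => ((hp.hasDerivWithinAt_mu i hx).inv (hne x hx)).neg)
      (((hp.muX_cont i).neg.div ((hp.mu_cont i).pow 2) fun x hx => pow_ne_zero 2 (hne x hx)).neg)
  convert h.clm (ContinuousLinearMap.toSpanSingletonCLE (𝕜 := ℝ) (E := ℝ)).toContinuousLinearMap
    using 2 with x x
  · rfl
  refine ContinuousLinearMap.ext fun v => ?_
  change _ = ContinuousLinearMap.toSpanSingleton ℝ (-(-p.muX i x / p.mu i x ^ 2)) v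
  simp
  ring

/-- The weak identities for `M` and for each `N_{i,j}` are ODEs with speeds `λ` and `-μ_i`. They are
solved block by block and reassembled with `aInv`. The value at `x = 1` needs its own statement,
since the first identity holds only for almost every `x` and the boundary condition uses the trace.
-/
lemma colX_eq_of_continuous (hp : p.Standing) (hMN : IsObserverKernel p n M N) (j : Fin m)
    {b b' : ℝ → ℝ} (hb : ∀ x, HasDerivAt b (b' x) x) (hb' : Continuous b') :
    (∀ᵐ x ∂muI, colX M N j b x = ∫ s in (0 : ℝ)..x, aInv hp s (rhsX p M N j b b' s)) ∧
      colX M N j b 1 = ∫ s in (0 : ℝ)..1, aInv hp s (rhsX p M N j b b' s) := by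
  have h1mem : (1 : ℝ) ∈ Icc (0 : ℝ) 1 := right_mem_Icc.2 zero_le_one
  have hbc : Continuous b := continuous_iff_continuousAt.2 fun x => (hb x).continuousAt
  have mb : MemLp b 2 muI := memLp_of_continuousOn hbc.continuousOn
  have mb' : MemLp b' 2 muI := memLp_of_continuousOn hb'.continuousOn
  have mr := memLp_rhsX hp hMN j mb mb'
  have hI : ∀ {x}, x ∈ Icc (0 : ℝ) 1 →
      IntervalIntegrable (fun s => aInv hp s (rhsX p M N j b b' s)) volume 0 x := fun hx =>
    intervalIntegrable_of_muI (((isMult_aInv hp).memLp mr).integrable one_le_two) hx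
  have mM : MemLp (rhsM p M N j b b') 2 muI :=
    (memLp_congr_ae (ae_muI_of_forall fun x hx => pr1_rhsX hp hMN j mb mb' hx)).1
      (pr1.comp_memLp' mr)
  have mN : ∀ i, MemLp (rhsN p M N i j b b') 2 muI := fun i =>
    (memLp_congr_ae (ae_muI_of_forall fun x hx => pr2_rhsX hp hMN i j mb mb' hx)).1
      ((coordE i ∘L pr2).comp_memLp' mr)
  have eM := eq_primitive_of_weak (isMult_mulH_slice hp.lam_cont) (isMult_mulH_slice hp.lamX_cont)
    (isPrim_mulH_lamInv hp) (fun x _ v => mulH_lamInv_lam hp x v) (hMN.memLp_colM j mb) mM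
    (fun χ χ' hχ hχ' => hMN.weak_M hp j hb hb' hχ hχ')
  have eN := fun i => eq_primitive_of_weak (isMult_scalar (hp.mu_cont i).neg)
    (isMult_scalar (hp.muX_cont i).neg) (isPrim_muInv hp i)
    (fun x hx v => by
      have := (hp.mu_pos i x hx).ne'
      simp; field_simp)
    (hMN.memLp_colN i j mb) (mN i) (m₁ := colN N i j b 1)
    (fun χ χ' hχ hχ' => by
      have := hMN.weak_N hp i j hb hb' hχ hχ'
      simpa [mul_comm, mul_left_comm] using this)
  have key : ∀ {x}, x ∈ Icc (0 : ℝ) 1 →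
      colM M j b x = ∫ s in (0 : ℝ)..x, mulH (slice hp.lamInv_cont s) (rhsM p M N j b b' s) →
      (∀ i, colN N i j b x = ∫ s in (0 : ℝ)..x,
        ContinuousLinearMap.toSpanSingleton ℝ (-(p.mu i s)⁻¹) (rhsN p M N i j b b' s)) →
      colX M N j b x = ∫ s in (0 : ℝ)..x, aInv hp s (rhsX p M N j b b' s) := by
    intro x hx h1 h2
    refine Xs_ext ?_ ?_
    · rw [hMN.pr1_colX j mb hx, h1, ← pr1.intervalIntegral_comp_comm (hI hx)]
      refine integral_congr_muI (ae_muI_of_forall fun s hs => ?_) hx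
      rw [pr1_aInv, pr1_rhsX hp hMN j mb mb' hs]
    · ext i
      rw [hMN.pr2_colX i j mb hx, h2, ← coordE_apply, ← ContinuousLinearMap.comp_apply,
        ← (coordE i ∘L pr2).intervalIntegral_comp_comm (hI hx)]
      refine integral_congr_muI (ae_muI_of_forall fun s hs => ?_) hx
      rw [ContinuousLinearMap.comp_apply, pr2_aInv, coordE_apply, PiLp.neg_apply, diagE_apply,
        pr2_rhsX hp hMN i j mb mb' hs]
      simp [mul_comm]
  refine ⟨?_, key h1mem eM.2 fun i => (eN i).2⟩
  filter_upwards [eM.1, ae_all_iff.2 fun i => (eN i).1, ae_muI_of_forall fun x hx => hx]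
    with x h1 h2 hx
  exact key hx h1 h2

lemma rhsX_add (hp : p.Standing) (hMN : IsObserverKernel p n M N) (j : Fin m)
    {b b' c c' : ℝ → ℝ} (hb : MemLp b 2 muI) (hb' : MemLp b' 2 muI) (hc : MemLp c 2 muI)
    (hc' : MemLp c' 2 muI) {x : ℝ} (hx : x ∈ Icc (0 : ℝ) 1) :
    rhsX p M N j (fun x => b x + c x) (fun x => b' x + c' x) x
      = rhsX p M N j b b' x + rhsX p M N j c c' x := by
  have e1 : colX M N j (fun x => b x + c x) x = colX M N j b x + colX M N j c x := by
    simp only [colX, add_smul]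
    exact intervalIntegral.integral_add (hMN.intCol j hb hx) (hMN.intCol j hc hx)
  have e2 : colX M N j (fun x => p.mu j x * (b' x + c' x)) x
      = colX M N j (fun x => p.mu j x * b' x) x + colX M N j (fun x => p.mu j x * c' x) x := by
    simp only [colX, mul_add, add_smul]
    exact intervalIntegral.integral_add (hMN.intCol j (memLp_mu_mul hp j hb') hx)
      (hMN.intCol j (memLp_mu_mul hp j hc') hx)
  rw [rhsX, e1, e2, rhsX, rhsX]
  simp only [map_add, add_smul, mul_add]
  abel

/-- When `b(0) = 0`, `b` is the primitive of `b'` and the injection term disappears. Both sides are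
then bounded operators applied to `b' ∈ L²`, and they agree on smooth `b'` by
`colX_eq_of_continuous`, hence everywhere. -/
lemma colX_eq_of_zero (hp : p.Standing) (hMN : IsObserverKernel p n M N) (j : Fin m)
    {b b' : ℝ → ℝ} (hb : IsH1 b b') (h0 : b 0 = 0) :
    (∀ᵐ x ∂muI, colX M N j b x = ∫ s in (0 : ℝ)..x, aInv hp s (rhsX p M N j b b' s)) ∧
      colX M N j b 1 = ∫ s in (0 : ℝ)..1, aInv hp s (rhsX p M N j b b' s) := by
  have h1mem : (1 : ℝ) ∈ Icc (0 : ℝ) 1 := right_mem_Icc.2 zero_le_one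
  set K := (hMN.isKer_col j).op
  have hmu := isMult_scalar (hp.mu_cont j)
  -- The trace of the kernel on `x = 1` as a multiplication operator: followed by `intOp` it gives
  -- the column integral at `x = 1`, which evaluation of an `L²` class could not.
  have hK1 : IsMult fun ξ => ContinuousLinearMap.toSpanSingleton ℝ (kcol M N j 1 ξ) := by
    obtain ⟨C, -, hC⟩ := hMN.kcol_bound
    refine ⟨((ContinuousLinearMap.toSpanSingletonCLE (𝕜 := ℝ)
      (E := Xs m)).continuous.comp_stronglyMeasurable ((hMN.kcol_meas j).comp_measurable
        (measurable_const.prodMk measurable_id))).aestronglyMeasurable, C,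
      ae_muI_of_forall fun ξ hξ => ?_⟩
    rw [ContinuousLinearMap.norm_toSpanSingleton]
    exact hC j 1 h1mem ξ hξ
  have hE : IsMult fun _ : ℝ => ContinuousLinearMap.toSpanSingleton ℝ (in2 (unitE j) : Xs m) :=
    IsMult.of_continuousOn continuousOn_const
  set R : Lp ℝ 2 muI →L[ℝ] Lp (Xs m) 2 muI := hp.isMult_bOp.op ∘L hE.op ∘L primOp - K ∘L hmu.op
    + hp.isMult_bOp.op ∘L K ∘L primOp with hR
  have R_ae : ∀ (f : Lp ℝ 2 muI) (b b' : ℝ → ℝ), IsH1 b b' → b 0 = 0 → f =ᵐ[muI] b' →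
      R f =ᵐ[muI] rhsX p M N j b b' ∧ primOp f =ᵐ[muI] b := by
    intro f b b' hb h0 hf
    have h1 : primOp f =ᵐ[muI] b := by
      filter_upwards [primOp_ae_of hf, ae_muI_of_forall hb.2] with x h1 h2
      rw [h1, h2, h0, zero_add]
    refine ⟨?_, h1⟩
    have h2 := hp.isMult_bOp.op_ae_of (hE.op_ae_of h1)
    have h3 : K (hmu.op f) =ᵐ[muI] _ := (hMN.isKer_col j).op_ae_of (hmu.op_ae_of hf)
    have h4 := hp.isMult_bOp.op_ae_of ((hMN.isKer_col j).op_ae_of h1)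
    filter_upwards [h2, h3, h4, Lp.coeFn_add (hp.isMult_bOp.op (hE.op (primOp f)) - K (hmu.op f))
      (hp.isMult_bOp.op (K (primOp f))), Lp.coeFn_sub (hp.isMult_bOp.op (hE.op (primOp f)))
      (K (hmu.op f))] with x h2 h3 h4 h5 h6
    change (hp.isMult_bOp.op (hE.op (primOp f)) - K (hmu.op f)
      + hp.isMult_bOp.op (K (primOp f)) : Lp (Xs m) 2 muI) x = _
    rw [h5, Pi.add_apply, h6, Pi.sub_apply, h2, h3, h4]
    simp [rhsX, h0, colX, mul_comm]
  have smooth : ∀ ψ : ℝ → ℝ, Continuous ψ → ∀ x, HasDerivAt (fun x => ∫ s in (0 : ℝ)..x, ψ s) (ψ x) x :=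
    fun ψ hψ x => intervalIntegral.integral_hasDerivAt_right (hψ.intervalIntegrable _ _)
      (hψ.stronglyMeasurableAtFilter _ _) hψ.continuousAt
  have H1 : ∀ ψ : ℝ → ℝ, Continuous ψ → IsH1 (fun x => ∫ s in (0 : ℝ)..x, ψ s) ψ := fun ψ hψ =>
    ⟨memLp_of_continuousOn hψ.continuousOn, fun x _ => by simp⟩
  have id1 : K ∘L primOp = primOp ∘L (isMult_aInv hp).op ∘L R := by
    refine eq_of_eq_on_smooth fun f ψ hψ hf => ?_
    obtain ⟨r1, r2⟩ := R_ae f _ ψ (H1 ψ hψ.continuous) (by simp) hf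
    refine Lp.ext ?_
    filter_upwards [(hMN.isKer_col j).op_ae_of r2, primOp_ae_of ((isMult_aInv hp).op_ae_of r1),
      (colX_eq_of_continuous hp hMN j (smooth ψ hψ.continuous) hψ.continuous).1] with x h1 h2 h3
    exact (h1.trans h3).trans h2.symm
  have id2 : intOp ∘L hK1.op ∘L primOp = intOp ∘L (isMult_aInv hp).op ∘L R := by
    refine eq_of_eq_on_smooth fun f ψ hψ hf => ?_
    obtain ⟨r1, r2⟩ := R_ae f _ ψ (H1 ψ hψ.continuous) (by simp) hf
    have h1 := intOp_eq_of (hK1.op_ae_of r2)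
    have h2 := intOp_eq_of ((isMult_aInv hp).op_ae_of r1)
    exact (h1.trans (colX_eq_of_continuous hp hMN j (smooth ψ hψ.continuous) hψ.continuous).2).trans
      h2.symm
  obtain ⟨r1, r2⟩ := R_ae hb.1.toLp b b' hb h0 hb.1.coeFn_toLp
  constructor
  · have h := congrArg (fun T => T hb.1.toLp) id1
    have e : K (primOp hb.1.toLp) = primOp ((isMult_aInv hp).op (R hb.1.toLp)) := h
    filter_upwards [(hMN.isKer_col j).op_ae_of r2, primOp_ae_of ((isMult_aInv hp).op_ae_of r1)]
      with x h1 h2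
    refine Eq.trans h1.symm (Eq.trans ?_ h2)
    exact congrArg (fun g : Lp (Xs m) 2 muI => g x) e
  · have h : intOp (hK1.op (primOp hb.1.toLp)) = intOp ((isMult_aInv hp).op (R hb.1.toLp)) :=
      congrArg (fun T => T hb.1.toLp) id2
    rw [intOp_eq_of (hK1.op_ae_of r2), intOp_eq_of ((isMult_aInv hp).op_ae_of r1)] at h
    exact h

/-- The kernel equations applied to an `H¹` function. -/
lemma colX_eq (hp : p.Standing) (hMN : IsObserverKernel p n M N) (j : Fin m)
    {b b' : ℝ → ℝ} (hb : IsH1 b b') :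
    (∀ᵐ x ∂muI, colX M N j b x = ∫ s in (0 : ℝ)..x, aInv hp s (rhsX p M N j b b' s)) ∧
      colX M N j b 1 = ∫ s in (0 : ℝ)..1, aInv hp s (rhsX p M N j b b' s) := by
  have h1mem : (1 : ℝ) ∈ Icc (0 : ℝ) 1 := right_mem_Icc.2 zero_le_one
  -- Split `b` into `b - b(0)`, covered by the density argument, and the constant `b(0)`, covered by
  -- the smooth case.
  have hb1 : IsH1 (fun x => b x - b 0) b' := ⟨hb.1, fun x hx => by simp [hb.2 x hx]⟩
  have z1 := colX_eq_of_zero hp hMN j hb1 (sub_self _)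
  have z2 := colX_eq_of_continuous hp hMN j (b := fun _ => b 0) (b' := fun _ => 0)
    (fun x => hasDerivAt_const _ _) continuous_const
  have m1 : MemLp (fun x => b x - b 0) 2 muI :=
    memLp_of_continuousOn (hb1.isPrim.continuousOn)
  have m2 : MemLp (fun _ : ℝ => b 0) 2 muI := memLp_const _
  have m0 : MemLp (fun _ : ℝ => (0 : ℝ)) 2 muI := memLp_const _
  have key : ∀ {x}, x ∈ Icc (0 : ℝ) 1 →
      colX M N j (fun x => b x - b 0) x
        = ∫ s in (0 : ℝ)..x, aInv hp s (rhsX p M N j (fun x => b x - b 0) b' s) →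
      colX M N j (fun _ => b 0) x
        = ∫ s in (0 : ℝ)..x, aInv hp s (rhsX p M N j (fun _ => b 0) (fun _ => 0) s) →
      colX M N j b x = ∫ s in (0 : ℝ)..x, aInv hp s (rhsX p M N j b b' s) := by
    intro x hx h1 h2
    have e1 : colX M N j b x = colX M N j (fun x => b x - b 0) x + colX M N j (fun _ => b 0) x := by
      rw [colX, colX, colX, ← intervalIntegral.integral_add (hMN.intCol j m1 hx)
        (hMN.intCol j m2 hx)]
      refine intervalIntegral.integral_congr fun s _ => ?_
      simp only [← add_smul, sub_add_cancel]
    rw [e1, h1, h2, ← intervalIntegral.integral_add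
      (intervalIntegrable_of_muI (((isMult_aInv hp).memLp
        (memLp_rhsX hp hMN j m1 hb.1)).integrable one_le_two) hx)
      (intervalIntegrable_of_muI (((isMult_aInv hp).memLp
        (memLp_rhsX hp hMN j m2 m0)).integrable one_le_two) hx)]
    refine integral_congr_muI (ae_muI_of_forall fun s hs => ?_) hx
    rw [← map_add, ← rhsX_add hp hMN j m1 hb.1 m2 m0 hs]
    simp
  refine ⟨?_, key h1mem z1.2 z2.2⟩
  filter_upwards [z1.1, z2.1, ae_muI_of_forall fun x hx => hx] with x h1 h2 hx
  exact key hx h1 h2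

end ColumnEquation

/-! ### The backstepping transformation and its action on `H¹`. -/

section Transformation

variable {m : ℕ} {p : Params m} {n : Fin m → Fin m → ℝ → ℝ} {M : Fin m → ℝ → ℝ → H}
  {N : ℝ → ℝ → Matrix (Fin m) (Fin m) ℝ}

lemma isMult_const {X Y : Type*} [NormedAddCommGroup X] [InnerProductSpace ℝ X]
    [CompleteSpace X] [NormedAddCommGroup Y] [InnerProductSpace ℝ Y] [CompleteSpace Y]
    (A : X →L[ℝ] Y) : IsMult fun _ : ℝ => A :=
  IsMult.of_continuousOn continuousOn_const

/-- The matrix kernel. -/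
def kop (M : Fin m → ℝ → ℝ → H) (N : ℝ → ℝ → Matrix (Fin m) (Fin m) ℝ) (x ξ : ℝ) : Eu m →L[ℝ] Xs m :=
  ∑ j, ContinuousLinearMap.toSpanSingleton ℝ (kcol M N j x ξ) ∘L coordE j

lemma kop_apply (x ξ : ℝ) (v : Eu m) : kop M N x ξ v = ∑ j, v j • kcol M N j x ξ := by
  simp [kop]

lemma IsObserverKernel.isKer_kop (hMN : IsObserverKernel p n M N) : IsKer (kop M N) := by
  obtain ⟨C, hC0, hC⟩ := hMN.kcol_bound
  have e : Function.uncurry (kop M N) = fun q : ℝ × ℝ => ∑ j,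
      ContinuousLinearMap.toSpanSingleton ℝ (kcol M N j q.1 q.2) ∘L coordE j := rfl
  refine ⟨e ▸ Finset.stronglyMeasurable_fun_sum _ fun j _ => ?_, ∑ j : Fin m, C * ‖(coordE j : Eu m →L[ℝ] ℝ)‖,
    by positivity, fun x hx ξ hξ => norm_sum_le_of_le _ fun j _ => ?_⟩
  · exact (((ContinuousLinearMap.compL ℝ (Eu m) ℝ (Xs m)).flip (coordE j)).continuous.comp
      (ContinuousLinearMap.toSpanSingletonCLE (𝕜 := ℝ)
        (E := Xs m)).continuous).comp_stronglyMeasurable (hMN.kcol_meas j)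
  · refine (ContinuousLinearMap.opNorm_comp_le _ _).trans ?_
    rw [ContinuousLinearMap.norm_toSpanSingleton]
    exact mul_le_mul_of_nonneg_right (hC j x hx ξ hξ) (norm_nonneg _)

/-- The output injection gain as an operator. -/
def pOp (p : Params m) (M : Fin m → ℝ → ℝ → H) (N : ℝ → ℝ → Matrix (Fin m) (Fin m) ℝ) (x : ℝ) :
    Eu m →L[ℝ] Xs m :=
  ∑ j, p.mu j 0 • ContinuousLinearMap.toSpanSingleton ℝ (kcol M N j x 0) ∘L coordE j

lemma pOp_apply (x : ℝ) (v : Eu m) :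
    pOp p M N x v = ∑ j, (p.mu j 0 * v j) • kcol M N j x 0 := by
  simp [pOp, smul_smul]

lemma IsObserverKernel.memLp_pOp (hMN : IsObserverKernel p n M N) (v : Eu m) :
    MemLp (fun x => pOp p M N x v) 2 muI := by
  simp only [pOp_apply]
  exact memLp_finsetSum _ fun j _ => (hMN.memLp_kcol_zero j).const_smul (p.mu j 0 * v j)

/-- The Volterra integral `∫₀ˣ k(x,ξ) β(ξ) dξ`. -/
def kint (M : Fin m → ℝ → ℝ → H) (N : ℝ → ℝ → Matrix (Fin m) (Fin m) ℝ) (β : ℝ → Eu m) (x : ℝ) :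
    Xs m := ∫ ξ in (0 : ℝ)..x, kop M N x ξ (β ξ)

lemma memLp_coord {β : ℝ → Eu m} (hβ : MemLp β 2 muI) (j : Fin m) : MemLp (fun x => β x j) 2 muI :=
  (coordE j).comp_memLp' hβ

lemma IsObserverKernel.kint_eq_sum (hMN : IsObserverKernel p n M N) {β : ℝ → Eu m}
    (hβ : MemLp β 2 muI) {x : ℝ} (hx : x ∈ Icc (0 : ℝ) 1) :
    kint M N β x = ∑ j, colX M N j (fun ξ => β ξ j) x := by
  simp only [kint, kop_apply, colX]
  exact intervalIntegral.integral_finsetSum fun j _ => hMN.intCol j (memLp_coord hβ j) hx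

lemma IsObserverKernel.kint_add (hMN : IsObserverKernel p n M N) {β γ : ℝ → Eu m}
    (hβ : MemLp β 2 muI) (hγ : MemLp γ 2 muI) {x : ℝ} (hx : x ∈ Icc (0 : ℝ) 1) :
    kint M N (fun x => β x + γ x) x = kint M N β x + kint M N γ x := by
  simp only [kint, map_add]
  exact intervalIntegral.integral_add (hMN.isKer_kop.integrable hβ hx) (hMN.isKer_kop.integrable hγ hx)

/-- `v ↦ Λ₋(x) v`. -/
def muE (p : Params m) (x : ℝ) : Eu m →L[ℝ] Eu m := diagE fun i => p.mu i x

lemma isMult_muE (hp : p.Standing) : IsMult (muE p) :=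
  IsMult.of_continuousOn (continuousOn_diagE hp.mu_cont)

/-- The right-hand side of the kernel equations applied to `β`. -/
def rhsK (p : Params m) (M : Fin m → ℝ → ℝ → H) (N : ℝ → ℝ → Matrix (Fin m) (Fin m) ℝ)
    (β β' : ℝ → Eu m) (x : ℝ) : Xs m :=
  bOp p x (in2 (β x)) - pOp p M N x (β 0) - kint M N (fun ξ => muE p ξ (β' ξ)) x
    + bOp p x (kint M N β x)

lemma memLp_rhsK (hp : p.Standing) (hMN : IsObserverKernel p n M N) {β β' : ℝ → Eu m}
    (hβ : MemLp β 2 muI) (hβ' : MemLp β' 2 muI) : MemLp (rhsK p M N β β') 2 muI :=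
  (((hp.isMult_bOp.memLp (in2.comp_memLp' hβ)).sub (hMN.memLp_pOp _)).sub
    (hMN.isKer_kop.memLp ((isMult_muE hp).memLp hβ'))).add
    (hp.isMult_bOp.memLp (hMN.isKer_kop.memLp hβ))

lemma eq_sum_unitE (v : Eu m) : v = ∑ j, v j • unitE j := by
  ext i; rw [sum_smul_unitE_apply]

lemma rhsK_eq_sum (hp : p.Standing) (hMN : IsObserverKernel p n M N) {β β' : ℝ → Eu m}
    (hβ : MemLp β 2 muI) (hβ' : MemLp β' 2 muI) {x : ℝ} (hx : x ∈ Icc (0 : ℝ) 1) :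
    rhsK p M N β β' x = ∑ j, rhsX p M N j (fun ξ => β ξ j) (fun ξ => β' ξ j) x := by
  have e1 : bOp p x (in2 (β x)) = ∑ j, β x j • bOp p x (in2 (unitE j)) := by
    conv_lhs => rw [eq_sum_unitE (β x)]
    simp only [map_sum, map_smul]
  rw [rhsK, e1, pOp_apply, hMN.kint_eq_sum ((isMult_muE hp).memLp hβ') hx, hMN.kint_eq_sum hβ hx,
    map_sum, ← Finset.sum_sub_distrib, ← Finset.sum_sub_distrib, ← Finset.sum_add_distrib]
  simp only [rhsX, muE, diagE_apply]

lemma IsH1.clm {X Y : Type*} [NormedAddCommGroup X] [NormedSpace ℝ X] [CompleteSpace X]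
    [NormedAddCommGroup Y] [NormedSpace ℝ Y] [CompleteSpace Y] (A : X →L[ℝ] Y) {f f' : ℝ → X}
    (h : IsH1 f f') : IsH1 (fun x => A (f x)) (fun x => A (f' x)) :=
  ⟨A.comp_memLp' h.1, (h.isPrim.clm A).2⟩

lemma IsH1.memLp {X : Type*} [NormedAddCommGroup X] [NormedSpace ℝ X] [CompleteSpace X]
    {f f' : ℝ → X} (h : IsH1 f f') : MemLp f 2 muI := memLp_of_continuousOn h.isPrim.continuousOn

lemma kint_eq (hp : p.Standing) (hMN : IsObserverKernel p n M N) {β β' : ℝ → Eu m}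
    (hβ : IsH1 β β') :
    (∀ᵐ x ∂muI, kint M N β x = ∫ s in (0 : ℝ)..x, aInv hp s (rhsK p M N β β' s)) ∧
      kint M N β 1 = ∫ s in (0 : ℝ)..1, aInv hp s (rhsK p M N β β' s) := by
  have h1mem : (1 : ℝ) ∈ Icc (0 : ℝ) 1 := right_mem_Icc.2 zero_le_one
  have hj : ∀ j, IsH1 (fun ξ => β ξ j) (fun ξ => β' ξ j) := fun j => hβ.clm (coordE j)
  have key : ∀ {x}, x ∈ Icc (0 : ℝ) 1 → (∀ j, colX M N j (fun ξ => β ξ j) x = ∫ s in (0 : ℝ)..x,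
      aInv hp s (rhsX p M N j (fun ξ => β ξ j) (fun ξ => β' ξ j) s)) →
      kint M N β x = ∫ s in (0 : ℝ)..x, aInv hp s (rhsK p M N β β' s) := by
    intro x hx h
    rw [hMN.kint_eq_sum hβ.memLp hx, Finset.sum_congr rfl fun j _ => h j,
      ← intervalIntegral.integral_finsetSum fun j _ => intervalIntegrable_of_muI
        (((isMult_aInv hp).memLp (memLp_rhsX hp hMN j (hj j).memLp (hj j).1)).integrable
          one_le_two) hx]
    refine integral_congr_muI (ae_muI_of_forall fun s hs => ?_) hx
    rw [rhsK_eq_sum hp hMN hβ.memLp hβ.1 hs, map_sum]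
  refine ⟨?_, key h1mem fun j => (colX_eq hp hMN j (hj j)).2⟩
  filter_upwards [ae_all_iff.2 fun j => (colX_eq hp hMN j (hj j)).1,
    ae_muI_of_forall fun x hx => hx] with x h hx
  exact key hx h

/-- The Volterra part of the backstepping transformation. -/
def volterraOp (hMN : IsObserverKernel p n M N) : Lp (Xs m) 2 muI →L[ℝ] Lp (Xs m) 2 muI :=
  hMN.isKer_kop.op ∘L (isMult_const pr2).op

lemma isVolt_volterraOp (hMN : IsObserverKernel p n M N) : IsVolt (volterraOp hMN) :=
  hMN.isKer_kop.isVolt.comp_causal (isMult_const pr2).isCausal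

lemma volterraOp_ae_of (hMN : IsObserverKernel p n M N) {Z : Lp (Xs m) 2 muI} {z : ℝ → Xs m}
    (hz : Z =ᵐ[muI] z) : volterraOp hMN Z =ᵐ[muI] kint M N fun x => pr2 (z x) :=
  hMN.isKer_kop.op_ae_of ((isMult_const pr2).op_ae_of hz)

/-- The backstepping transformation. -/
def backstepping (hMN : IsObserverKernel p n M N) : Lp (Xs m) 2 muI ≃L[ℝ] Lp (Xs m) 2 muI :=
  ContinuousLinearEquiv.unitsEquiv ℝ _ (isVolt_volterraOp hMN).isUnit_one_add.unit

lemma backstepping_apply (hMN : IsObserverKernel p n M N) (Z : Lp (Xs m) 2 muI) :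
    backstepping hMN Z = Z + volterraOp hMN Z := rfl

lemma backstepping_ae_of (hMN : IsObserverKernel p n M N) {Z : Lp (Xs m) 2 muI} {z : ℝ → Xs m}
    (hz : Z =ᵐ[muI] z) :
    backstepping hMN Z =ᵐ[muI] fun x => z x + kint M N (fun x => pr2 (z x)) x := by
  rw [backstepping_apply]
  filter_upwards [hz, volterraOp_ae_of hMN hz, Lp.coeFn_add Z (volterraOp hMN Z)] with x h1 h2 h3
  rw [h3, Pi.add_apply, h1, h2]

/-- The inverse backstepping transformation preserves `H¹`. -/
lemma exists_isH1_preimage (hp : p.Standing) (hMN : IsObserverKernel p n M N) {y y' : ℝ → Xs m}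
    (hy : IsH1 y y') : ∃ z z' : ℝ → Xs m, IsH1 z z' ∧ z 0 = y 0 ∧
      (∀ᵐ x ∂muI, y x = z x + kint M N (fun x => pr2 (z x)) x) ∧
      y 1 = z 1 + kint M N (fun x => pr2 (z x)) 1 ∧
      ∀ᵐ x ∂muI, aOp hp x (y' x)
        = aOp hp x (z' x) + rhsK p M N (fun x => pr2 (z x)) (fun x => pr2 (z' x)) x := by
  have h1mem : (1 : ℝ) ∈ Icc (0 : ℝ) 1 := right_mem_Icc.2 zero_le_one
  set c : Eu m := pr2 (y 0) with hc
  have mc : MemLp (fun _ : ℝ => c) 2 muI := memLp_const _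
  have hmuPr : IsMult fun x => muE p x ∘L pr2 := IsMult.of_continuousOn
    ((continuousOn_diagE hp.mu_cont).clm_comp continuousOn_const)
  set K := hMN.isKer_kop.op
  set B := hp.isMult_bOp.op
  -- The unknown is the derivative `γ = z'`. With `z = y(0) + ∫₀ˣ γ`, the differentiated relation
  -- `y' = γ + a⁻¹ rhsK` becomes `(1 + V) γ = r`, where `V` collects the terms in `γ` and `r` those
  -- involving only `y'` and the constant `pr2 (y 0)`. Every part of `V` is of Volterra type, so the
  -- equation is solvable.
  set V : Lp (Xs m) 2 muI →L[ℝ] Lp (Xs m) 2 muI := (isMult_aInv hp).op ∘L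
    (B ∘L ((isMult_const (in2 ∘L pr2 : Xs m →L[ℝ] Xs m)).op ∘L primOp) - K ∘L hmuPr.op
      + B ∘L (volterraOp hMN ∘L primOp)) with hV
  have vV : IsVolt V := (((((isVolt_primOp.mult_comp (isMult_const _)).mult_comp hp.isMult_bOp).sub
    (hMN.isKer_kop.isVolt.comp_causal hmuPr.isCausal)).add
    (((isVolt_volterraOp hMN).comp_causal isVolt_primOp.isCausal).mult_comp hp.isMult_bOp))).mult_comp
    (isMult_aInv hp)
  set r : ℝ → Xs m := fun x => y' x - aInv hp x (bOp p x (in2 c) - pOp p M N x c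
    + bOp p x (kint M N (fun _ => c) x)) with hr
  have mr : MemLp r 2 muI := hy.1.sub ((isMult_aInv hp).memLp
    (((hp.isMult_bOp.memLp (in2.comp_memLp' mc)).sub (hMN.memLp_pOp c)).add
      (hp.isMult_bOp.memLp (hMN.isKer_kop.memLp mc))))
  obtain ⟨γ, hγ⟩ : ∃ γ, (1 + V) γ = mr.toLp := by
    obtain ⟨u, hu⟩ := vV.isUnit_one_add
    refine ⟨(↑u⁻¹ : Lp (Xs m) 2 muI →L[ℝ] Lp (Xs m) 2 muI) mr.toLp, ?_⟩
    rw [← hu]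
    exact DFunLike.congr_fun (Units.mul_inv u) mr.toLp
  set z : ℝ → Xs m := fun x => y 0 + ∫ s in (0 : ℝ)..x, γ s with hz
  have hH1 : IsH1 z γ := isH1_primitive (Lp.memLp γ) _
  have hz0 : z 0 = y 0 := by simp [hz]
  have mJ : MemLp (fun x => pr2 (∫ s in (0 : ℝ)..x, γ s) : ℝ → Eu m) 2 muI :=
    pr2.comp_memLp' ((memLp_congr_ae (primOp_ae γ)).1 (Lp.memLp _))
  have mβ : MemLp (fun x => pr2 (z x)) 2 muI := pr2.comp_memLp' hH1.memLp
  have mβ' : MemLp (fun x => pr2 (γ x)) 2 muI := pr2.comp_memLp' (Lp.memLp γ)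
  have key : ∀ᵐ x ∂muI, y' x = γ x
      + aInv hp x (rhsK p M N (fun x => pr2 (z x)) (fun x => pr2 (γ x)) x) := by
    have hJ := primOp_ae γ
    have a1 := hp.isMult_bOp.op_ae_of ((isMult_const (in2 ∘L pr2 : Xs m →L[ℝ] Xs m)).op_ae_of hJ)
    have a2 := hMN.isKer_kop.op_ae_of (hmuPr.op_ae γ)
    have a3 := hp.isMult_bOp.op_ae_of (volterraOp_ae_of hMN hJ)
    set A1 := B ((isMult_const (in2 ∘L pr2 : Xs m →L[ℝ] Xs m)).op (primOp γ))
    set A2 := K (hmuPr.op γ)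
    set A3 := B (volterraOp hMN (primOp γ))
    have a4 := (isMult_aInv hp).op_ae (A1 - A2 + A3)
    have a5 : γ + (isMult_aInv hp).op (A1 - A2 + A3) = mr.toLp := hγ
    filter_upwards [a1, a2, a3, a4, mr.coeFn_toLp, Lp.coeFn_add (A1 - A2) A3, Lp.coeFn_sub A1 A2,
      Lp.coeFn_add γ ((isMult_aInv hp).op (A1 - A2 + A3)), ae_muI_of_forall fun x hx => hx]
      with x a1 a2 a3 a4 a6 a7 a8 a9 hx
    rw [a5, a6, Pi.add_apply, a4, a7, Pi.add_apply, a8, Pi.sub_apply, a1, a2, a3] at a9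
    have e1 : kint M N (fun x => pr2 (z x)) x
        = kint M N (fun _ => c) x + kint M N (fun x => pr2 (∫ s in (0 : ℝ)..x, γ s)) x := by
      rw [← hMN.kint_add mc mJ hx]
      simp only [hz, map_add, hc]
    have e2 : y' x = r x + aInv hp x (bOp p x (in2 c) - pOp p M N x c
        + bOp p x (kint M N (fun _ => c) x)) := by
      rw [hr, sub_add_cancel]
    rw [e2, a9, add_assoc, ← map_add, rhsK, e1, hz0, ← hc]
    congr 2
    simp only [hz, map_add, ContinuousLinearMap.comp_apply, ← hc]
    simp only [kint]
    abel
  -- Integrating the derivative relation and using the integrated kernel equation returns `y = z +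
  -- kint`.
  have hint : ∀ {x}, x ∈ Icc (0 : ℝ) 1 → kint M N (fun x => pr2 (z x)) x = (∫ s in (0 : ℝ)..x,
      aInv hp s (rhsK p M N (fun x => pr2 (z x)) (fun x => pr2 (γ x)) s)) →
      y x = z x + kint M N (fun x => pr2 (z x)) x := by
    intro x hx h
    rw [hy.2 x hx, h, hz, add_assoc, ← intervalIntegral.integral_add
      (intervalIntegrable_of_muI ((Lp.memLp γ).integrable one_le_two) hx)
      (intervalIntegrable_of_muI (((isMult_aInv hp).memLp
        (memLp_rhsK hp hMN mβ mβ')).integrable one_le_two) hx)]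
    congr 1
    exact integral_congr_muI key hx
  have hk := kint_eq hp hMN (hH1.clm pr2)
  refine ⟨z, γ, hH1, hz0, ?_, hint h1mem hk.2, ?_⟩
  · filter_upwards [hk.1, ae_muI_of_forall fun x hx => hx] with x h hx
    exact hint hx h
  · filter_upwards [key, ae_muI_of_forall fun x hx => hx] with x h hx
    rw [h, map_add, aOp_aInv hp hx]

end Transformation

/-! ### Generator, boundary mismatch and target system. -/

section Generator

variable {m : ℕ} {p : Params m} {n : Fin m → Fin m → ℝ → ℝ} {M : Fin m → ℝ → ℝ → H}
  {N : ℝ → ℝ → Matrix (Fin m) (Fin m) ℝ}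

/-- `u ↦ ∫ R(y) u(y) dy`. -/
def rOp (p : Params m) : H →L[ℝ] Eu m :=
  ∑ i, ContinuousLinearMap.toSpanSingleton ℝ (unitE i) ∘L innerSL ℝ (p.R i)

@[simp] lemma rOp_apply (h : H) (i : Fin m) : rOp p h i = inner ℝ (p.R i) h := by
  have : rOp p h = ∑ i, (inner ℝ (p.R i) h : ℝ) • unitE i := by simp [rOp]
  rw [this, sum_smul_unitE_apply]

/-- The graph of the operator of the estimation error dynamics on `L²([0,1]; H × ℝᵐ)`. -/
def IsGen (hp : p.Standing) (M : Fin m → ℝ → ℝ → H) (N : ℝ → ℝ → Matrix (Fin m) (Fin m) ℝ)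
    (Y F : Lp (Xs m) 2 muI) : Prop :=
  ∃ y y' : ℝ → Xs m, IsH1 y y' ∧ Y =ᵐ[muI] y ∧ pr1 (y 0) = 0 ∧ pr2 (y 1) = rOp p (pr1 (y 1)) ∧
    ∀ᵐ x ∂muI, F x = -aOp hp x (y' x) + bOp p x (y x) - pOp p M N x (pr2 (y 0))

/-- The mismatch of the boundary values of the kernels. -/
def mismatch (p : Params m) (M : Fin m → ℝ → ℝ → H) (N : ℝ → ℝ → Matrix (Fin m) (Fin m) ℝ)
    (i j : Fin m) (ξ : ℝ) : ℝ := N 1 ξ i j - inner ℝ (p.R i) (M j 1 ξ)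

/-- Strict upper triangularity of the mismatch. This is what keeps the boundary feedback in the
target system a cascade. -/
lemma IsObserverKernel.mismatch_zero (hMN : IsObserverKernel p n M N) {i j : Fin m} (hij : j ≤ i) :
    ∀ᵐ ξ ∂muI, mismatch p M N i j ξ = 0 := by
  filter_upwards [hMN.right_N i j hij] with ξ hξ
  rw [mismatch, hξ, inner_H, sub_self]

lemma IsObserverKernel.mismatch_bound (hMN : IsObserverKernel p n M N) :
    ∃ C, 0 ≤ C ∧ ∀ i j, ∀ ξ ∈ Icc (0 : ℝ) 1, |mismatch p M N i j ξ| ≤ C := by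
  obtain ⟨C, hC⟩ := hMN.bounded
  refine ⟨max C 0 + ∑ i, ‖p.R i‖ * max C 0, by positivity, fun i j ξ hξ => ?_⟩
  have h := hC 1 (right_mem_Icc.2 zero_le_one) ξ hξ
  refine (abs_sub _ _).trans (add_le_add ((h.2 i j).trans (le_max_left _ _)) ?_)
  refine (abs_real_inner_le_norm _ _).trans ?_
  refine le_trans (mul_le_mul_of_nonneg_left ((h.1 j).trans (le_max_left C 0)) (norm_nonneg _)) ?_
  exact Finset.single_le_sum (f := fun i => ‖p.R i‖ * max C 0) (fun i _ => by positivity)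
    (Finset.mem_univ i)

lemma IsObserverKernel.trace_kint (hMN : IsObserverKernel p n M N) {β : ℝ → Eu m}
    (hβ : MemLp β 2 muI) (i : Fin m) :
    pr2 (kint M N β 1) i - inner ℝ (p.R i) (pr1 (kint M N β 1))
      = ∑ j, ∫ ξ in (0 : ℝ)..1, β ξ j * mismatch p M N i j ξ := by
  have h1mem : (1 : ℝ) ∈ Icc (0 : ℝ) 1 := right_mem_Icc.2 zero_le_one
  rw [hMN.kint_eq_sum hβ h1mem, map_sum, map_sum, inner_sum, WithLp.ofLp_sum, Finset.sum_apply,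
    ← Finset.sum_sub_distrib]
  refine Finset.sum_congr rfl fun j _ => ?_
  have hb := memLp_coord hβ j
  rw [hMN.pr2_colX i j hb h1mem, hMN.pr1_colX j hb h1mem, colM, colN, ← innerSL_apply_apply ℝ,
    ← (innerSL ℝ (p.R i) : H →L[ℝ] ℝ).intervalIntegral_comp_comm (hMN.intM j hb h1mem),
    ← intervalIntegral.integral_sub (hMN.intN i j hb h1mem)
      ((innerSL ℝ (p.R i) : H →L[ℝ] ℝ).intervalIntegrable_comp (hMN.intM j hb h1mem))]
  refine intervalIntegral.integral_congr fun ξ _ => ?_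
  simp only [map_smul, innerSL_apply_apply, smul_eq_mul, mismatch]
  ring

/-- The target system of the backstepping transformation. -/
lemma IsGen.exists_target (hp : p.Standing) (hMN : IsObserverKernel p n M N)
    {Y F : Lp (Xs m) 2 muI} (hYF : IsGen hp M N Y F) :
    ∃ (z z' : ℝ → Xs m) (h : Lp (Xs m) 2 muI), IsH1 z z' ∧ (backstepping hMN).symm Y =ᵐ[muI] z ∧
      (∀ᵐ x ∂muI, (backstepping hMN).symm F x = -aOp hp x (z' x) + h x) ∧
      (∀ᵐ x ∂muI, h x + volterraOp hMN h x = bOp p x (in1 (pr1 (z x)))) ∧ pr1 (z 0) = 0 ∧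
      ∀ i, pr2 (z 1) i = inner ℝ (p.R i) (pr1 (z 1))
        - ∑ j, ∫ ξ in (0 : ℝ)..1, pr2 (z ξ) j * mismatch p M N i j ξ := by
  obtain ⟨y, y', hy, hYy, h0, h1, hF⟩ := hYF
  obtain ⟨z, z', hz, hz0, e1, e2, e3⟩ := exists_isH1_preimage hp hMN hy
  have mz := hz.memLp
  have ma : MemLp (fun x => -aOp hp x (z' x)) 2 muI := ((isMult_aOp hp).memLp hz.1).neg
  have mG : MemLp (fun x => bOp p x (in1 (pr1 (z x)))) 2 muI :=
    hp.isMult_bOp.memLp ((in1 ∘L pr1).comp_memLp' mz)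
  -- What survives of the coupling after the cancellation is `b (α, 0)`; its inverse transform is
  -- the source `h` of the target system.
  set h := (backstepping hMN).symm mG.toLp with hh
  have hhe : h + volterraOp hMN h = mG.toLp := by
    rw [← backstepping_apply, hh, ContinuousLinearEquiv.apply_symm_apply]
  have hha : ∀ᵐ x ∂muI, h x + volterraOp hMN h x = bOp p x (in1 (pr1 (z x))) := by
    filter_upwards [Lp.coeFn_add h (volterraOp hMN h), mG.coeFn_toLp] with x a1 a2
    rw [← a2, ← hhe, a1, Pi.add_apply]
  have eY : (backstepping hMN).symm Y = mz.toLp := by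
    rw [ContinuousLinearEquiv.symm_apply_eq]
    refine Lp.ext ?_
    filter_upwards [hYy, backstepping_ae_of hMN mz.coeFn_toLp, e1] with x a1 a2 a3
    rw [a1, a2, a3]
  -- In `F = -a y' + b y - P pr2 (y 0)`, insert `a y' = a z' + rhsK` and `y = z + kint`. The terms
  -- `P β(0)` and `b kint` cancel since `z(0) = y(0)`, and `b z - b (0, β)` leaves `b (α, 0)`. The
  -- remaining `∫₀ˣ k Λ₋ β'` is exactly the Volterra part of the transform of `-a z'`, whose second
  -- component is `Λ₋ β'`.
  have eF : (backstepping hMN).symm F = ma.toLp + h := by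
    rw [ContinuousLinearEquiv.symm_apply_eq, map_add, hh, ContinuousLinearEquiv.apply_symm_apply]
    refine Lp.ext ?_
    filter_upwards [hF, backstepping_ae_of hMN ma.coeFn_toLp, e1, e3, mG.coeFn_toLp,
      Lp.coeFn_add (backstepping hMN ma.toLp) mG.toLp] with x a1 a2 a3 a4 a5 a6
    rw [a6, Pi.add_apply, a5, a2, a1, a4, a3, rhsK, hz0]
    have e5 : kint M N (fun x => pr2 (-aOp hp x (z' x))) x
        = kint M N (fun ξ => muE p ξ (pr2 (z' ξ))) x := by
      simp only [map_neg, pr2_aOp, neg_neg, muE]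
    have e6 : bOp p x (in1 (pr1 (z x))) = bOp p x (z x) - bOp p x (in2 (pr2 (z x))) := by
      rw [← map_sub]; congr 1; rw [eq_sub_iff_add_eq, in1_pr1_add]
    rw [e5, e6, map_add]
    abel
  refine ⟨z, z', h, hz, eY ▸ mz.coeFn_toLp, ?_, hha, by rw [hz0, h0], fun i => ?_⟩
  · rw [eF]
    filter_upwards [Lp.coeFn_add ma.toLp h, ma.coeFn_toLp] with x a1 a2
    rw [a1, Pi.add_apply, a2]
  · rw [e2, map_add, map_add, map_add] at h1
    have h2 := congrArg (fun v : Eu m => v i) h1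
    simp only [PiLp.add_apply, rOp_apply] at h2
    have h3 := hMN.trace_kint (β := fun x => pr2 (z x)) (pr2.comp_memLp' mz) i
    linarith

end Generator

/-! ### Choice of the constants in the Lyapunov functional. -/

section Weights

/-- Geometric weights absorb a strictly upper triangular coupling of any size: `b_j` enters only the
rows `i < j`, whose weights satisfy `Kⁱ ≤ Kʲ / K`. -/
lemma sum_mul_sum_gt_le {m : ℕ} {K G : ℝ} (hG : 0 ≤ G) (hK1 : 1 ≤ K) (hK : 4 * (G * m) ≤ K)
    {b : Fin m → ℝ} (hb : ∀ j, 0 ≤ b j) :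
    ∑ i : Fin m, K ^ (i : ℕ) * (G * ∑ j with i < j, b j) ≤ 1 / 4 * ∑ j : Fin m, K ^ (j : ℕ) * b j := by
  have hK0 : 0 < K := by linarith
  have e : ∑ i : Fin m, K ^ (i : ℕ) * (G * ∑ j with i < j, b j)
      = ∑ j : Fin m, (G * ∑ i with i < j, K ^ (i : ℕ)) * b j := by
    simp only [Finset.mul_sum, Finset.sum_filter, Finset.sum_mul]
    rw [Finset.sum_comm]
    refine Finset.sum_congr rfl fun j _ => Finset.sum_congr rfl fun i _ => ?_
    split_ifs
    · ring
    · ring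
  rw [e, Finset.mul_sum]
  refine Finset.sum_le_sum fun j _ => ?_
  rw [← mul_assoc]
  refine mul_le_mul_of_nonneg_right ?_ (hb j)
  have h1 : (∑ i with i < j, K ^ (i : ℕ)) * K ≤ m * K ^ (j : ℕ) := by
    rw [Finset.sum_mul]
    calc ∑ i with i < j, K ^ (i : ℕ) * K ≤ ∑ i : Fin m with i < j, K ^ (j : ℕ) := by
          refine Finset.sum_le_sum fun i hi => ?_
          rw [← pow_succ]
          exact pow_le_pow_right₀ hK1 (Nat.succ_le_of_lt (Finset.mem_filter.1 hi).2)
      _ ≤ m * K ^ (j : ℕ) := by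
          rw [Finset.sum_const, nsmul_eq_mul]
          refine mul_le_mul_of_nonneg_right ?_ (by positivity)
          exact_mod_cast (Finset.card_filter_le _ _).trans (by simp)
  have h2 : 0 ≤ K ^ (j : ℕ) := by positivity
  have h3 : (G * ∑ i with i < j, K ^ (i : ℕ)) * K ≤ (1 / 4 * K ^ (j : ℕ)) * K := by
    nlinarith [mul_le_mul_of_nonneg_left h1 hG, mul_le_mul_of_nonneg_right hK h2]
  exact le_of_mul_le_mul_right h3 hK0

/-- The choice of the weights in the Lyapunov functional. -/
lemma exists_weights (m : ℕ) {r g l C κ₀ : ℝ} (hr : 0 ≤ r) (hg : 0 ≤ g) (hl : 0 ≤ l) (hC : 0 ≤ C) :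
    ∃ κ A : ℝ, ∃ B : Fin m → ℝ, κ₀ ≤ κ ∧ 0 < κ ∧ 0 < A ∧ (∀ j, 0 < B j) ∧
      ∀ (s a q : ℝ) (b u : Fin m → ℝ), 0 ≤ s → 0 ≤ a → (∀ j, 0 ≤ b j) → q ≤ C * a →
        (∀ i, u i ≤ r * s + g * ∑ j with i < j, b j) →
        A * (-Real.exp (-κ) * s - κ * a) + (∑ j, B j * (Real.exp 1 * u j - b j)) + A * l * (q + a)
          + (∑ j, B j * (1 / 2 * b j + 2 * l ^ 2 * Real.exp (1 + κ) * q))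
          ≤ -(1 / 4) * (A * a + ∑ j, B j * b j) := by
  set e := Real.exp 1
  have he : 0 < e := Real.exp_pos 1
  -- The constants are chosen in the order `K`, `κ`, `A`, each after the quantities it must
  -- dominate. Here `K` beats the mismatch `g`.
  set K := 4 * (e * g * m) + 1 with hK
  have hK0 : 0 < K := by positivity
  set S : ℝ := ∑ j : Fin m, K ^ (j : ℕ) with hS
  have hS0 : 0 ≤ S := by positivity
  -- The part `l (C + 1)` absorbs the source in the `α` equation, since `q ≤ C a`. Of the spare `2 A
  -- a`, one half pays for the source in the `β` equations and the other stays as dissipation. The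
  -- bound `C` must be independent of `κ`.
  set κ := max κ₀ 1 + l * (C + 1) + 2 with hκ
  have hκ0 : κ₀ ≤ κ := by
    have := le_max_left κ₀ 1
    have : 0 ≤ l * (C + 1) := by positivity
    linarith
  have hκ2 : l * (C + 1) + 2 ≤ κ := by
    have := le_max_right κ₀ 1
    linarith
  set E := 2 * l ^ 2 * Real.exp (1 + κ) with hE
  have hE0 : 0 ≤ E := by positivity
  -- The first term lets the outflow `A e^{-κ} s` dominate the boundary input `r s` of the `β`
  -- equations; the second lets `A a` dominate `S E q`. Both depend on `κ`, which is already fixed.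
  set A := Real.exp κ * (S * (e * r)) + S * E * C + 1 with hA
  have hA0 : 0 < A := by positivity
  have hlC : 0 ≤ l * (C + 1) := by positivity
  refine ⟨κ, A, fun j => K ^ (j : ℕ), hκ0, by linarith, hA0, fun j => by positivity,
    fun s a q b u hs ha hb hq hu => ?_⟩
  have h1 : ∑ j : Fin m, K ^ (j : ℕ) * (e * u j - b j)
      ≤ S * (e * r) * s + 1 / 4 * (∑ j : Fin m, K ^ (j : ℕ) * b j)
        - ∑ j : Fin m, K ^ (j : ℕ) * b j := by
    have h2 := sum_mul_sum_gt_le (K := K) (G := e * g) (by positivity)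
      (by rw [hK]; have : 0 ≤ e * g * m := by positivity
          linarith) (by rw [hK]; linarith) hb
    have h3 : ∑ j : Fin m, K ^ (j : ℕ) * (e * u j)
        ≤ S * (e * r) * s + ∑ i : Fin m, K ^ (i : ℕ) * (e * g * ∑ j with i < j, b j) := by
      rw [hS, Finset.sum_mul, Finset.sum_mul, ← Finset.sum_add_distrib]
      refine Finset.sum_le_sum fun i _ => ?_
      have := mul_le_mul_of_nonneg_left (mul_le_mul_of_nonneg_left (hu i) he.le)
        (show 0 ≤ K ^ (i : ℕ) by positivity)
      linarith
    simp only [mul_sub, Finset.sum_sub_distrib]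
    linarith
  have h4 : ∑ j : Fin m, K ^ (j : ℕ) * (1 / 2 * b j + E * q)
      = 1 / 2 * (∑ j : Fin m, K ^ (j : ℕ) * b j) + S * E * q := by
    simp only [mul_add, Finset.sum_add_distrib, hS, Finset.mul_sum, Finset.sum_mul]
    congr 1
    · exact Finset.sum_congr rfl fun j _ => by ring
    · exact Finset.sum_congr rfl fun j _ => by ring
  set X := ∑ j : Fin m, K ^ (j : ℕ) * b j
  have hX : 0 ≤ X := Finset.sum_nonneg fun j _ => mul_nonneg (by positivity) (hb j)
  have h5 : S * (e * r) * s ≤ A * (Real.exp (-κ) * s) := by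
    have : Real.exp κ * (S * (e * r)) ≤ A := by
      have : 0 ≤ S * E * C := by positivity
      linarith
    have h6 := mul_le_mul_of_nonneg_right this (show 0 ≤ Real.exp (-κ) * s by positivity)
    have h7 : Real.exp κ * Real.exp (-κ) = 1 := by rw [← Real.exp_add]; simp
    calc S * (e * r) * s = (Real.exp κ * Real.exp (-κ)) * (S * (e * r) * s) := by rw [h7, one_mul]
      _ = Real.exp κ * (S * (e * r)) * (Real.exp (-κ) * s) := by ring
      _ ≤ _ := h6
  have h6 : A * l * (q + a) ≤ A * (l * (C + 1)) * a := by
    have := mul_le_mul_of_nonneg_left hq (show 0 ≤ A * l by positivity)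
    linarith
  have h7 : S * E * q ≤ A * a := by
    have h8 := mul_le_mul_of_nonneg_left hq (show 0 ≤ S * E by positivity)
    have h9 : S * E * C ≤ A := by
      have : 0 ≤ Real.exp κ * (S * (e * r)) := by positivity
      linarith
    have h10 := mul_le_mul_of_nonneg_right h9 ha
    linarith
  have h8 : A * (l * (C + 1)) * a + 2 * (A * a) ≤ A * κ * a := by
    have := mul_le_mul_of_nonneg_left hκ2 (show 0 ≤ A * a by positivity)
    linarith
  have hAa : 0 ≤ A * a := by positivity
  rw [h4]
  linarith

end Weights

/-! ### Strict dissipativity of the target system in the weighted inner product. -/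

section Lyapunov

variable {m : ℕ} {p : Params m} {n : Fin m → Fin m → ℝ → ℝ} {M : Fin m → ℝ → ℝ → H}
  {N : ℝ → ℝ → Matrix (Fin m) (Fin m) ℝ}

lemma integrable_inner_of_memLp {X : Type*} [NormedAddCommGroup X] [InnerProductSpace ℝ X]
    {f g : ℝ → X} (hf : MemLp f 2 muI) (hg : MemLp g 2 muI) :
    Integrable (fun x => (inner ℝ (f x) (g x) : ℝ)) muI := by
  refine (L2.integrable_inner (𝕜 := ℝ) hf.toLp hg.toLp).congr ?_
  filter_upwards [hf.coeFn_toLp, hg.coeFn_toLp] with x h1 h2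
  rw [h1, h2]

lemma norm_in1 (h : H) : ‖(in1 h : Xs m)‖ = ‖h‖ := by
  have := norm_sq_Xs (in1 h : Xs m)
  rw [pr1_in1, pr2_in1] at this
  exact (sq_eq_sq₀ (norm_nonneg _) (norm_nonneg _)).1 (by simpa using this)

lemma norm_pr1_le (a : Xs m) : ‖pr1 a‖ ≤ ‖a‖ := by
  have := norm_sq_Xs a
  exact (sq_le_sq₀ (norm_nonneg _) (norm_nonneg _)).1 (by nlinarith [sq_nonneg ‖pr2 a‖])

lemma abs_coord_le (a : Xs m) (j : Fin m) : |pr2 a j| ≤ ‖a‖ := by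
  refine (EuclideanSpace.norm_eq (pr2 a) ▸ PiLp.norm_apply_le (pr2 a) j : ‖pr2 a j‖ ≤ _).trans ?_
  rw [← EuclideanSpace.norm_eq]
  have := norm_sq_Xs a
  exact (sq_le_sq₀ (norm_nonneg _) (norm_nonneg _)).1 (by nlinarith [sq_nonneg ‖pr1 a‖])

/-- The weight of the Lyapunov functional. -/
def weight (hp : p.Standing) (κ A : ℝ) (B : Fin m → ℝ) (x : ℝ) : Xs m →L[ℝ] Xs m :=
  (A * Real.exp (-κ * x)) • (in1 ∘L mulH (slice hp.lamInv_cont x) ∘L pr1)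
    + in2 ∘L diagE (fun j => B j * Real.exp (1 * x) * (p.mu j x)⁻¹) ∘L pr2

lemma isMult_weight (hp : p.Standing) (κ A : ℝ) (B : Fin m → ℝ) : IsMult (weight hp κ A B) := by
  have h1 : ContinuousOn (fun x => mulH (slice hp.lamInv_cont x)) (Icc 0 1) :=
    (mulH.continuous.comp (continuous_slice hp.lamInv_cont)).continuousOn
  have h2 : ContinuousOn (fun x => diagE fun j => B j * Real.exp (1 * x) * (p.mu j x)⁻¹) (Icc 0 1) :=
    continuousOn_diagE fun i => ContinuousOn.mul (by fun_prop)
      ((hp.mu_cont i).inv₀ fun x hx => (hp.mu_pos i x hx).ne')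
  have h3 : ContinuousOn (fun x => A * Real.exp (-κ * x)) (Icc 0 1) := by fun_prop
  exact IsMult.of_continuousOn ((h3.smul (continuousOn_const.clm_comp
    (h1.clm_comp continuousOn_const))).add
    (continuousOn_const.clm_comp (h2.clm_comp continuousOn_const)))

lemma inner_weight (hp : p.Standing) (κ A : ℝ) (B : Fin m → ℝ) (x : ℝ) (a b : Xs m) :
    inner ℝ (weight hp κ A B x a) b
      = A * Real.exp (-κ * x) * inner ℝ (mulH (slice hp.lamInv_cont x) (pr1 a)) (pr1 b)
        + ∑ j, B j * Real.exp (1 * x) * (p.mu j x)⁻¹ * (pr2 a j * pr2 b j) := by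
  rw [inner_Xs]
  congr 1
  · simp [weight, inner_smul_left]
  · rw [PiLp.inner_apply]
    refine Finset.sum_congr rfl fun j _ => ?_
    simp [weight]
    ring

/-- One constant `l` bounds all reciprocal speeds; it enters the Young inequalities and the final
decay rate. -/
lemma exists_inv_bound (hp : p.Standing) : ∃ l : ℝ, 1 ≤ l ∧ ∀ x ∈ Icc (0 : ℝ) 1,
    ‖mulH (slice hp.lamInv_cont x)‖ ≤ l ∧ ∀ j, (p.mu j x)⁻¹ ≤ l := by
  obtain ⟨l₁, h1⟩ := (isCompact_Icc (a := (0 : ℝ)) (b := 1)).exists_bound_of_continuousOn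
    (mulH.continuous.comp (continuous_slice hp.lamInv_cont)).continuousOn
  have h2 : ∀ j, ∃ C, ∀ x ∈ Icc (0 : ℝ) 1, ‖(p.mu j x)⁻¹‖ ≤ C := fun j =>
    isCompact_Icc.exists_bound_of_continuousOn
      ((hp.mu_cont j).inv₀ fun x hx => (hp.mu_pos j x hx).ne')
  choose c hc using h2
  refine ⟨max 1 l₁ + ∑ j, |c j|, ?_, fun x hx => ⟨?_, fun j => ?_⟩⟩
  · have := le_max_left 1 l₁
    have : 0 ≤ ∑ j, |c j| := by positivity
    linarith
  · have := (h1 x hx).trans (le_max_right 1 l₁)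
    have h3 : 0 ≤ ∑ j, |c j| := by positivity
    exact this.trans (by linarith)
  · have h3 := (le_abs_self _).trans (hc j x hx)
    have h4 : |c j| ≤ ∑ j, |c j| :=
      Finset.single_le_sum (f := fun j => |c j|) (fun _ _ => abs_nonneg _) (Finset.mem_univ j)
    have h5 := le_max_left 1 l₁
    linarith [le_abs_self (c j)]

/-- Bound of the weighted norm of the remainder of the target system. -/
lemma exists_remainder_bound (hp : p.Standing) (hMN : IsObserverKernel p n M N) :
    ∃ κ₀ C : ℝ, 0 ≤ C ∧ ∀ κ, κ₀ ≤ κ → 0 < κ → ∀ (z : ℝ → Xs m) (h : Lp (Xs m) 2 muI),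
      MemLp z 2 muI → (∀ᵐ x ∂muI, h x + volterraOp hMN h x = bOp p x (in1 (pr1 (z x)))) →
      ∫ x in (0 : ℝ)..1, Real.exp (-κ * x) * ‖h x‖ ^ 2
        ≤ C * ∫ x in (0 : ℝ)..1, Real.exp (-κ * x) * ‖pr1 (z x)‖ ^ 2 := by
  have h1mem : (1 : ℝ) ∈ Icc (0 : ℝ) 1 := right_mem_Icc.2 zero_le_one
  obtain ⟨C, hC0, hC⟩ := (isVolt_volterraOp hMN).exists_weighted_le
  obtain ⟨D, hD⟩ := hp.isMult_bOp.2
  -- For `κ ≥ 4 C` the weighted estimate makes `2 ∫ e^{-κx} ‖V h‖²` at most half of `q`. Absorbing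
  -- it turns `q ≤ 2 D² a + q / 2` into `q ≤ 4 D² a`, with a constant independent of `κ`.
  refine ⟨4 * C, 4 * D ^ 2, by positivity, fun κ hκ hκ0 z h hz hh => ?_⟩
  have c1 : Continuous fun x : ℝ => Real.exp (-κ * x) := by fun_prop
  have i1 := integrable_mul_continuous (integrable_norm_sq (Lp.memLp h)) c1
  have i2 := integrable_mul_continuous (integrable_norm_sq (Lp.memLp (volterraOp hMN h))) c1
  have i3 : Integrable (fun x => Real.exp (-κ * x) * ‖pr1 (z x)‖ ^ 2) muI :=
    integrable_mul_continuous (integrable_norm_sq (pr1.comp_memLp' hz)) c1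
  have hle : ∫ x in (0 : ℝ)..1, Real.exp (-κ * x) * ‖h x‖ ^ 2 ≤ ∫ x in (0 : ℝ)..1,
      (2 * D ^ 2 * (Real.exp (-κ * x) * ‖pr1 (z x)‖ ^ 2)
        + 2 * (Real.exp (-κ * x) * ‖volterraOp hMN h x‖ ^ 2)) := by
    refine integral_mono_muI i1 ((i3.const_mul _).add (i2.const_mul _)) ?_ h1mem
    filter_upwards [hh, hD] with x hx hx' _
    beta_reduce
    rw [Pi.add_apply]
    have e0 : ‖h x‖ ≤ D * ‖pr1 (z x)‖ + ‖volterraOp hMN h x‖ := by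
      have e1 : h x = bOp p x (in1 (pr1 (z x))) - volterraOp hMN h x := by rw [← hx]; abel
      rw [e1]
      refine (norm_sub_le _ _).trans (add_le_add ?_ le_rfl)
      have := (bOp p x).le_of_opNorm_le hx' (in1 (pr1 (z x)))
      rwa [norm_in1] at this
    have e2 : ‖h x‖ ^ 2 ≤ 2 * D ^ 2 * ‖pr1 (z x)‖ ^ 2 + 2 * ‖volterraOp hMN h x‖ ^ 2 := by
      have := pow_le_pow_left₀ (norm_nonneg _) e0 2
      nlinarith [sq_nonneg (D * ‖pr1 (z x)‖ - ‖volterraOp hMN h x‖)]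
    have := mul_le_mul_of_nonneg_left e2 (Real.exp_pos (-κ * x)).le
    linarith
  rw [intervalIntegral.integral_add ((integrable_muI.1 i3).const_mul _)
    ((integrable_muI.1 i2).const_mul _), intervalIntegral.integral_const_mul,
    intervalIntegral.integral_const_mul] at hle
  have h2 := hC κ hκ0 h
  set q := ∫ x in (0 : ℝ)..1, Real.exp (-κ * x) * ‖h x‖ ^ 2
  have hq : 0 ≤ q := intervalIntegral.integral_nonneg zero_le_one fun x _ => by positivity
  have h3 : C / κ * q ≤ 1 / 4 * q := by
    refine mul_le_mul_of_nonneg_right ?_ hq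
    rw [div_le_iff₀ hκ0]; linarith
  linarith

/-- Triangularity leaves only the indices `j > i`. Cauchy–Schwarz over at most `m` of them and then
over `[0,1]` gives the constant, and `1 ≤ e^x` inserts the weight. -/
lemma sq_sum_integral_le {g : ℝ} {γ : Fin m → ℝ → ℝ} (i : Fin m)
    (h0 : ∀ j, j ≤ i → ∀ᵐ ξ ∂muI, γ j ξ = 0) (hγ : ∀ j, ∀ ξ ∈ Icc (0 : ℝ) 1, |γ j ξ| ≤ g)
    {β : ℝ → Eu m} (hβ : MemLp β 2 muI) :
    (∑ j, ∫ ξ in (0 : ℝ)..1, β ξ j * γ j ξ) ^ 2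
      ≤ m * g ^ 2 * ∑ j with i < j, ∫ x in (0 : ℝ)..1, Real.exp (1 * x) * ‖β x j‖ ^ 2 := by
  have h1mem : (1 : ℝ) ∈ Icc (0 : ℝ) 1 := right_mem_Icc.2 zero_le_one
  have e : ∑ j, ∫ ξ in (0 : ℝ)..1, β ξ j * γ j ξ
      = ∑ j with i < j, ∫ ξ in (0 : ℝ)..1, β ξ j * γ j ξ := by
    refine (Finset.sum_filter_of_ne fun j _ hj => ?_).symm
    by_contra hij
    refine hj ?_
    rw [integral_congr_muI (g := fun _ => (0 : ℝ)) ?_ h1mem]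
    · simp
    · filter_upwards [h0 j (not_lt.1 hij)] with ξ hξ
      rw [hξ, mul_zero]
  rw [e]
  refine sq_sum_le_card_mul_sum_sq.trans ?_
  have hcard : ((Finset.univ.filter fun j => i < j).card : ℝ) ≤ m := by
    exact_mod_cast (Finset.card_filter_le _ _).trans (by simp)
  rw [mul_assoc, Finset.mul_sum (a := g ^ 2)]
  refine mul_le_mul hcard (Finset.sum_le_sum fun j _ => ?_) (by positivity) (by positivity)
  have hbj := memLp_coord hβ j
  have i1 := integrable_norm_sq hbj
  have c1 : Continuous fun x : ℝ => Real.exp (1 * x) := by fun_prop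
  have h1 : |∫ ξ in (0 : ℝ)..1, β ξ j * γ j ξ| ≤ g * ∫ ξ in (0 : ℝ)..1, ‖β ξ j‖ := by
    rw [← intervalIntegral.integral_const_mul, ← Real.norm_eq_abs]
    refine intervalIntegral.norm_integral_le_of_norm_le zero_le_one (ae_of_all _ fun s hs => ?_)
      ((integrable_muI.1 (hbj.integrable one_le_two)).norm.const_mul g)
    rw [norm_mul, mul_comm]
    exact mul_le_mul_of_nonneg_right (hγ j s ⟨hs.1.le, hs.2⟩) (norm_nonneg _)
  have h2 : (∫ ξ in (0 : ℝ)..1, β ξ j * γ j ξ) ^ 2 ≤ (g * ∫ ξ in (0 : ℝ)..1, ‖β ξ j‖) ^ 2 := by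
    rw [← sq_abs]; exact pow_le_pow_left₀ (abs_nonneg _) h1 2
  refine h2.trans ?_
  rw [mul_pow]
  refine mul_le_mul_of_nonneg_left ((sq_integral_norm_le hbj h1mem).trans ?_) (sq_nonneg _)
  refine integral_mono_muI i1 (integrable_mul_continuous i1 c1)
    (ae_muI_of_forall fun s hs _ => ?_) h1mem
  exact le_mul_of_one_le_left (sq_nonneg _) (Real.one_le_exp (by linarith [hs.1]))

/-- Dissipativity of the target system. -/
lemma exists_dissipative_weight (hp : p.Standing) (hMN : IsObserverKernel p n M N) :
    ∃ (κ A : ℝ) (B : Fin m → ℝ) (c : ℝ), 0 < A ∧ (∀ j, 0 < B j) ∧ 0 < c ∧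
      ∀ (z z' : ℝ → Xs m) (h : Lp (Xs m) 2 muI), IsH1 z z' →
        (∀ᵐ x ∂muI, h x + volterraOp hMN h x = bOp p x (in1 (pr1 (z x)))) → pr1 (z 0) = 0 →
        (∀ i, pr2 (z 1) i = inner ℝ (p.R i) (pr1 (z 1))
          - ∑ j, ∫ ξ in (0 : ℝ)..1, pr2 (z ξ) j * mismatch p M N i j ξ) →
        ∫ x in (0 : ℝ)..1, inner ℝ (weight hp κ A B x (-aOp hp x (z' x) + h x)) (z x)
          ≤ -c * ∫ x in (0 : ℝ)..1, inner ℝ (weight hp κ A B x (z x)) (z x) := by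
  have h1mem : (1 : ℝ) ∈ Icc (0 : ℝ) 1 := right_mem_Icc.2 zero_le_one
  obtain ⟨l, hl1, hl⟩ := exists_inv_bound hp
  obtain ⟨κ₀, C, hC0, hC⟩ := exists_remainder_bound hp hMN
  obtain ⟨g, hg0, hg⟩ := hMN.mismatch_bound
  set r : ℝ := ∑ i, ‖p.R i‖
  have hr0 : 0 ≤ r := by positivity
  have hl0 : 0 ≤ l := by linarith
  obtain ⟨κ, A, B, hκ₀, hκ, hA, hB, hw⟩ := exists_weights m (r := 2 * r ^ 2) (g := 2 * (m * g ^ 2))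
    (l := l) (C := C) (κ₀ := κ₀) (by positivity) (by positivity) hl0 hC0
  -- The balance from `exists_weights` is for twice the form, so the form is at most `-(1/8) (A a +
  -- ∑ B_j b_j)`; the weighted squared norm is at most `l (A a + ∑ B_j b_j)`.
  refine ⟨κ, A, B, 1 / (8 * l), hA, hB, by positivity, fun z z' h hz hh hz0 htr => ?_⟩
  have mz := hz.memLp
  have hα : IsH1 (fun x => pr1 (z x)) (fun x => pr1 (z' x)) := hz.clm pr1
  have hβ : ∀ j, IsH1 (fun x => pr2 (z x) j) (fun x => pr2 (z' x) j) := fun j =>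
    hz.clm (coordE j ∘L pr2)
  set a := ∫ x in (0 : ℝ)..1, Real.exp (-κ * x) * ‖pr1 (z x)‖ ^ 2 with ha
  set q := ∫ x in (0 : ℝ)..1, Real.exp (-κ * x) * ‖h x‖ ^ 2 with hq
  set b : Fin m → ℝ := fun j => ∫ x in (0 : ℝ)..1, Real.exp (1 * x) * ‖pr2 (z x) j‖ ^ 2 with hb
  set u : Fin m → ℝ := fun j => ‖pr2 (z 1) j‖ ^ 2 with hu
  have c1 : Continuous fun x : ℝ => Real.exp (-κ * x) := by fun_prop
  have c2 : Continuous fun x : ℝ => Real.exp (1 * x) := by fun_prop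
  have i1 := integrable_mul_continuous (integrable_inner_of_memLp hα.1 hα.memLp) c1
  have i2 := fun j => integrable_mul_continuous (integrable_inner_of_memLp (hβ j).1 (hβ j).memLp) c2
  have i3 := integrable_mul_continuous (integrable_norm_sq (Lp.memLp h)) c1
  have i4 := integrable_mul_continuous (integrable_norm_sq hα.memLp) c1
  have i5 := fun j => integrable_mul_continuous (integrable_norm_sq (hβ j).memLp) c2
  have mF : MemLp (fun x => -aOp hp x (z' x) + h x) 2 muI :=
    ((isMult_aOp hp).memLp hz.1).neg.add (Lp.memLp h)
  have iF := integrable_inner_of_memLp ((isMult_weight hp κ A B).memLp mF) mz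
  have iz := integrable_inner_of_memLp ((isMult_weight hp κ A B).memLp mz) mz
  -- The exponents have opposite signs because the components travel in opposite directions: each
  -- weight decreases along the direction of propagation, and so both energy identities produce a
  -- negative volume term.
  have E1 := hα.isPrim.energy (-κ)
  have E2 := fun j => (hβ j).isPrim.energy 1
  rw [hz0] at E1
  have ha0 : 0 ≤ a := intervalIntegral.integral_nonneg zero_le_one fun x _ => by positivity
  have hb0 : ∀ j, 0 ≤ b j := fun j =>
    intervalIntegral.integral_nonneg zero_le_one fun x _ => by positivity
  have hqa : q ≤ C * a := hC κ hκ₀ hκ z h mz hh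
  have hub : ∀ i, u i ≤ 2 * r ^ 2 * ‖pr1 (z 1)‖ ^ 2 + 2 * (m * g ^ 2) * ∑ j with i < j, b j := by
    intro i
    have h1 := sq_sum_integral_le i (fun j hj => hMN.mismatch_zero hj) (hg i)
      (β := fun x => pr2 (z x)) (pr2.comp_memLp' mz)
    have h2 : (inner ℝ (p.R i) (pr1 (z 1))) ^ 2 ≤ r ^ 2 * ‖pr1 (z 1)‖ ^ 2 := by
      rw [← sq_abs, ← mul_pow]
      refine pow_le_pow_left₀ (abs_nonneg _) ((abs_real_inner_le_norm _ _).trans ?_) 2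
      exact mul_le_mul_of_nonneg_right (Finset.single_le_sum (f := fun i => ‖p.R i‖)
        (fun i _ => norm_nonneg _) (Finset.mem_univ i)) (norm_nonneg _)
    have h3 : u i = (inner ℝ (p.R i) (pr1 (z 1))
        - ∑ j, ∫ ξ in (0 : ℝ)..1, pr2 (z ξ) j * mismatch p M N i j ξ) ^ 2 := by
      rw [hu, ← htr i]; exact sq_abs _
    rw [h3]
    nlinarith [sq_nonneg (inner ℝ (p.R i) (pr1 (z 1))
      + ∑ j, ∫ ξ in (0 : ℝ)..1, pr2 (z ξ) j * mismatch p M N i j ξ)]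
  have hN := hw (‖pr1 (z 1)‖ ^ 2) a q b u (sq_nonneg _) ha0 hb0 hqa hub
  set E := Real.exp (1 + κ)
  -- Compares the two weights, since the source in the `β` equations is controlled only in the
  -- weight of `α`.
  have hE : ∀ x ∈ Icc (0 : ℝ) 1, Real.exp (1 * x) ≤ E * Real.exp (-κ * x) := by
    intro x hx
    rw [← Real.exp_add]
    refine Real.exp_le_exp.2 ?_
    nlinarith [hx.1, hx.2]
  -- The factor `a⁻¹` in the weight cancels the transport speed up to sign and leaves pure
  -- derivatives for the energy identities. The source terms are estimated by Young's inequality,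
  -- with `1/4` for each `β_j` so that the volume term `-b_j` still wins.
  have upper : ∫ x in (0 : ℝ)..1, inner ℝ (weight hp κ A B x (-aOp hp x (z' x) + h x)) (z x)
      ≤ ∫ x in (0 : ℝ)..1, (-A * (Real.exp (-κ * x) * inner ℝ (pr1 (z' x)) (pr1 (z x)))
        + (∑ j, B j * (Real.exp (1 * x) * inner ℝ (pr2 (z' x) j) (pr2 (z x) j)))
        + A * l / 2 * (Real.exp (-κ * x) * ‖h x‖ ^ 2 + Real.exp (-κ * x) * ‖pr1 (z x)‖ ^ 2)
        + ∑ j, B j * (1 / 4 * (Real.exp (1 * x) * ‖pr2 (z x) j‖ ^ 2)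
          + l ^ 2 * E * (Real.exp (-κ * x) * ‖h x‖ ^ 2))) := by
    refine integral_mono_muI iF ((((i1.const_mul _).add (integrable_finsetSum _ fun j _ =>
      (i2 j).const_mul _)).add ((i3.add i4).const_mul _)).add (integrable_finsetSum _ fun j _ =>
      (((i5 j).const_mul _).add (i3.const_mul _)).const_mul _))
      (ae_muI_of_forall fun x hx _ => ?_) h1mem
    simp only [Pi.add_apply]
    rw [inner_weight]
    simp only [map_add, map_neg, pr1_aOp, pr2_aOp, neg_neg, mulH_lamInv_lam hp, PiLp.add_apply,
      diagE_apply, inner_add_left, inner_neg_left]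
    have g1 : inner ℝ (mulH (slice hp.lamInv_cont x) (pr1 (h x))) (pr1 (z x))
        ≤ l / 2 * (‖h x‖ ^ 2 + ‖pr1 (z x)‖ ^ 2) := by
      refine (real_inner_le_norm _ _).trans ?_
      have g2 := (mulH (slice hp.lamInv_cont x)).le_of_opNorm_le (hl x hx).1 (pr1 (h x))
      have g3 := mul_le_mul_of_nonneg_left (norm_pr1_le (h x)) hl0
      refine (mul_le_mul_of_nonneg_right (g2.trans g3) (norm_nonneg _)).trans ?_
      nlinarith [mul_nonneg hl0 (sq_nonneg (‖h x‖ - ‖pr1 (z x)‖))]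
    have hAe : 0 ≤ A * Real.exp (-κ * x) := by positivity
    have g4 := mul_le_mul_of_nonneg_left g1 hAe
    have g5 : ∀ j, B j * Real.exp (1 * x) * (p.mu j x)⁻¹ *
        ((p.mu j x * pr2 (z' x) j + pr2 (h x) j) * pr2 (z x) j)
        ≤ B j * (Real.exp (1 * x) * inner ℝ (pr2 (z' x) j) (pr2 (z x) j))
          + B j * (1 / 4 * (Real.exp (1 * x) * ‖pr2 (z x) j‖ ^ 2)
            + l ^ 2 * E * (Real.exp (-κ * x) * ‖h x‖ ^ 2)) := by
      intro j
      have hmu := hp.mu_pos j x hx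
      set v := pr2 (z x) j
      set w := pr2 (h x) j
      have hw1 : |w| ≤ ‖h x‖ := abs_coord_le _ _
      have k1 : (p.mu j x)⁻¹ * (w * v) ≤ 1 / 4 * ‖v‖ ^ 2 + l ^ 2 * ‖h x‖ ^ 2 := by
        have k2 : (p.mu j x)⁻¹ * (w * v) ≤ l * ‖h x‖ * |v| := by
          refine (le_abs_self _).trans ?_
          rw [abs_mul, abs_mul, abs_of_pos (inv_pos.2 hmu), ← mul_assoc]
          exact mul_le_mul_of_nonneg_right (mul_le_mul ((hl x hx).2 j) hw1 (abs_nonneg _) hl0)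
            (abs_nonneg _)
        have k3 : ‖v‖ = |v| := rfl
        rw [k3]
        nlinarith [sq_nonneg (|v| / 2 - l * ‖h x‖)]
      have k4 : Real.exp (1 * x) * ((p.mu j x)⁻¹ * (w * v))
          ≤ 1 / 4 * (Real.exp (1 * x) * ‖v‖ ^ 2) + l ^ 2 * E * (Real.exp (-κ * x) * ‖h x‖ ^ 2) := by
        have k5 := mul_le_mul_of_nonneg_left k1 (Real.exp_pos (1 * x)).le
        have k6 := mul_le_mul_of_nonneg_right (hE x hx) (show 0 ≤ l ^ 2 * ‖h x‖ ^ 2 by positivity)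
        linarith
      have k7 : B j * Real.exp (1 * x) * (p.mu j x)⁻¹ * ((p.mu j x * pr2 (z' x) j + w) * v)
          = B j * (Real.exp (1 * x) * (v * pr2 (z' x) j))
            + B j * (Real.exp (1 * x) * ((p.mu j x)⁻¹ * (w * v))) := by
        field_simp
      rw [k7]
      exact add_le_add le_rfl (mul_le_mul_of_nonneg_left k4 (hB j).le)
    have g6 := Finset.sum_le_sum fun j (_ : j ∈ Finset.univ) => g5 j
    rw [Finset.sum_add_distrib] at g6
    linarith
  have lower : ∫ x in (0 : ℝ)..1, inner ℝ (weight hp κ A B x (z x)) (z x)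
      ≤ ∫ x in (0 : ℝ)..1, (A * l * (Real.exp (-κ * x) * ‖pr1 (z x)‖ ^ 2)
        + ∑ j, B j * l * (Real.exp (1 * x) * ‖pr2 (z x) j‖ ^ 2)) := by
    refine integral_mono_muI iz ((i4.const_mul _).add (integrable_finsetSum _ fun j _ =>
      (i5 j).const_mul _)) (ae_muI_of_forall fun x hx _ => ?_) h1mem
    rw [inner_weight]
    refine add_le_add ?_ (Finset.sum_le_sum fun j _ => ?_)
    · have g2 := (mulH (slice hp.lamInv_cont x)).le_of_opNorm_le (hl x hx).1 (pr1 (z x))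
      have g1 : inner ℝ (mulH (slice hp.lamInv_cont x) (pr1 (z x))) (pr1 (z x))
          ≤ l * ‖pr1 (z x)‖ ^ 2 := by
        refine (real_inner_le_norm _ _).trans ?_
        have := mul_le_mul_of_nonneg_right g2 (norm_nonneg (pr1 (z x)))
        linarith [sq (‖pr1 (z x)‖)]
      have := mul_le_mul_of_nonneg_left g1 (show 0 ≤ A * Real.exp (-κ * x) by positivity)
      linarith
    · have k3 : ‖pr2 (z x) j‖ ^ 2 = pr2 (z x) j * pr2 (z x) j := by
        rw [← sq]; exact sq_abs _
      rw [k3]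
      have := mul_le_mul_of_nonneg_left ((hl x hx).2 j)
        (show 0 ≤ B j * Real.exp (1 * x) * (pr2 (z x) j * pr2 (z x) j) from
          mul_nonneg (mul_nonneg (hB j).le (Real.exp_pos _).le) (mul_self_nonneg _))
      linarith
  have I1 := integrable_muI.1 i1
  have I2 := fun j => integrable_muI.1 (i2 j)
  have I3 := integrable_muI.1 i3
  have I4 := integrable_muI.1 i4
  have I5 := fun j => integrable_muI.1 (i5 j)
  have S1 := integrable_muI.1 (integrable_finsetSum Finset.univ fun j _ => (i2 j).const_mul (B j))
  have S0 : ∀ j, IntervalIntegrable (fun x => B j * (1 / 4 * (Real.exp (1 * x) * ‖pr2 (z x) j‖ ^ 2)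
      + l ^ 2 * E * (Real.exp (-κ * x) * ‖h x‖ ^ 2))) volume 0 1 := fun j =>
    (((I5 j).const_mul (1 / 4)).add (I3.const_mul (l ^ 2 * E))).const_mul (B j)
  have S2 : IntervalIntegrable (fun x => ∑ j, B j * (1 / 4 * (Real.exp (1 * x) * ‖pr2 (z x) j‖ ^ 2)
      + l ^ 2 * E * (Real.exp (-κ * x) * ‖h x‖ ^ 2))) volume 0 1 :=
    integrable_muI.1 (integrable_finsetSum Finset.univ fun j _ => integrable_muI.2 (S0 j))
  have S4 : IntervalIntegrable (fun x => A * l / 2 * (Real.exp (-κ * x) * ‖h x‖ ^ 2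
      + Real.exp (-κ * x) * ‖pr1 (z x)‖ ^ 2)) volume 0 1 := (I3.add I4).const_mul _
  have S3 := integrable_muI.1 (integrable_finsetSum Finset.univ fun j _ => (i5 j).const_mul (B j * l))
  rw [intervalIntegral.integral_add (((I1.const_mul _).add S1).add S4) S2,
    intervalIntegral.integral_add ((I1.const_mul _).add S1) S4,
    intervalIntegral.integral_add (I1.const_mul _) S1,
    intervalIntegral.integral_finsetSum (fun j _ => (I2 j).const_mul _),
    intervalIntegral.integral_finsetSum (fun j _ => S0 j),
    intervalIntegral.integral_const_mul, intervalIntegral.integral_const_mul,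
    intervalIntegral.integral_add I3 I4] at upper
  rw [intervalIntegral.integral_add (I4.const_mul _) S3,
    intervalIntegral.integral_finsetSum (fun j _ => (I5 j).const_mul _),
    intervalIntegral.integral_const_mul] at lower
  have e1 : ∀ j, ∫ x in (0 : ℝ)..1, B j * (1 / 4 * (Real.exp (1 * x) * ‖pr2 (z x) j‖ ^ 2)
      + l ^ 2 * E * (Real.exp (-κ * x) * ‖h x‖ ^ 2)) = B j * (1 / 4 * b j + l ^ 2 * E * q) := by
    intro j
    rw [intervalIntegral.integral_const_mul, intervalIntegral.integral_add ((I5 j).const_mul _)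
      (I3.const_mul _), intervalIntegral.integral_const_mul, intervalIntegral.integral_const_mul]
  have e2 : ∀ j, ∫ x in (0 : ℝ)..1, B j * (Real.exp (1 * x) * inner ℝ (pr2 (z' x) j) (pr2 (z x) j))
      ≤ B j * (1 / 2 * (Real.exp 1 * u j - b j)) := by
    intro j
    rw [intervalIntegral.integral_const_mul]
    refine mul_le_mul_of_nonneg_left ?_ (hB j).le
    have := E2 j
    have h0 := sq_nonneg ‖pr2 (z 0) j‖
    simp only [hu, hb]
    linarith
  have e3 : ∀ j, ∫ x in (0 : ℝ)..1, B j * l * (Real.exp (1 * x) * ‖pr2 (z x) j‖ ^ 2)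
      = l * (B j * b j) := by
    intro j
    rw [intervalIntegral.integral_const_mul, hb]; ring
  have e4 := Finset.sum_le_sum fun j (_ : j ∈ Finset.univ) => e2 j
  have e5 : ∑ j, B j * (1 / 2 * (Real.exp 1 * u j - b j))
      = 1 / 2 * ∑ j, B j * (Real.exp 1 * u j - b j) := by
    rw [Finset.mul_sum]; exact Finset.sum_congr rfl fun j _ => by ring
  have e6 : ∑ j, B j * (1 / 4 * b j + l ^ 2 * E * q)
      = 1 / 2 * ∑ j, B j * (1 / 2 * b j + 2 * l ^ 2 * E * q) := by
    rw [Finset.mul_sum]; exact Finset.sum_congr rfl fun j _ => by ring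
  simp only [e1] at upper
  simp only [e3] at lower
  rw [← ha] at lower
  rw [← Finset.mul_sum] at lower
  rw [e5] at e4
  rw [e6] at upper
  simp only [norm_zero] at E1
  have hlow : 1 / (8 * l) * ∫ x in (0 : ℝ)..1, inner ℝ (weight hp κ A B x (z x)) (z x)
      ≤ 1 / 8 * (A * a + ∑ j, B j * b j) := by
    have hl' : 0 < l := by linarith
    have := mul_le_mul_of_nonneg_left lower (show 0 ≤ 1 / (8 * l) by positivity)
    refine this.trans_eq ?_
    field_simp
  have E3 := congrArg (fun t => A * t) E1
  linarith

end Lyapunov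

/-! ### The weighted inner product as a change of variables. -/

section SquareRoot

variable {m : ℕ} {p : Params m}

/-- Multiplication by functions in both blocks. -/
def blockE (f : C(UI, ℝ)) (d : Fin m → ℝ) : Xs m →L[ℝ] Xs m :=
  in1 ∘L mulH f ∘L pr1 + in2 ∘L diagE d ∘L pr2

@[simp] lemma pr1_blockE (f : C(UI, ℝ)) (d : Fin m → ℝ) (a : Xs m) :
    pr1 (blockE f d a) = mulH f (pr1 a) := by simp [blockE]

@[simp] lemma pr2_blockE (f : C(UI, ℝ)) (d : Fin m → ℝ) (a : Xs m) :
    pr2 (blockE f d a) = diagE d (pr2 a) := by simp [blockE]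

lemma isMult_blockE {F : ℝ → ℝ → ℝ}
    (hF : ContinuousOn (fun q : ℝ × ℝ => F q.1 q.2) (Icc 0 1 ×ˢ Icc 0 1)) {d : Fin m → ℝ → ℝ}
    (hd : ∀ j, ContinuousOn (d j) (Icc 0 1)) :
    IsMult fun x => (blockE (slice hF x) fun j => d j x : Xs m →L[ℝ] Xs m) := by
  have h1 : ContinuousOn (fun x => mulH (slice hF x)) (Icc 0 1) :=
    (mulH.continuous.comp (continuous_slice hF)).continuousOn
  exact IsMult.of_continuousOn ((continuousOn_const.clm_comp (h1.clm_comp continuousOn_const)).add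
    (continuousOn_const.clm_comp ((continuousOn_diagE hd).clm_comp continuousOn_const)))

/-- Multiplication operators with pointwise inverses are invertible. -/
lemma exists_equiv_of_isMult {X : Type*} [NormedAddCommGroup X] [InnerProductSpace ℝ X]
    [CompleteSpace X] {d e : ℝ → X →L[ℝ] X} (hd : IsMult d) (he : IsMult e)
    (h1 : ∀ x ∈ Icc (0 : ℝ) 1, ∀ v, e x (d x v) = v) (h2 : ∀ x ∈ Icc (0 : ℝ) 1, ∀ v, d x (e x v) = v) :
    ∃ D : Lp X 2 muI ≃L[ℝ] Lp X 2 muI, ∀ f, D f =ᵐ[muI] fun x => d x (f x) := by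
  refine ⟨ContinuousLinearEquiv.equivOfInverse hd.op he.op (fun f => Lp.ext ?_)
    (fun f => Lp.ext ?_), fun f => hd.op_ae f⟩
  · filter_upwards [he.op_ae_of (hd.op_ae f), ae_muI_of_forall h1] with x a1 a2
    rw [a1, a2]
  · filter_upwards [hd.op_ae_of (he.op_ae f), ae_muI_of_forall h2] with x a1 a2
    rw [a1, a2]

/-- The weight is diagonal and positive, so multiplication by its square root is invertible and
carries the weighted inner product to the standard one. Dissipativity in the weight can then be used
in the abstract generation theorem. -/
lemma exists_sqrt_weight (hp : p.Standing) {κ A : ℝ} {B : Fin m → ℝ} (hA : 0 < A)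
    (hB : ∀ j, 0 < B j) :
    ∃ D : Lp (Xs m) 2 muI ≃L[ℝ] Lp (Xs m) 2 muI, ∀ f g : Lp (Xs m) 2 muI,
      inner ℝ (D f) (D g) = ∫ x in (0 : ℝ)..1, inner ℝ (weight hp κ A B x (f x)) (g x) := by
  set F : ℝ → ℝ → ℝ := fun x y => Real.sqrt (A * Real.exp (-κ * x) * p.lamInv x y) with hF
  set d : Fin m → ℝ → ℝ := fun j x => Real.sqrt (B j * Real.exp (1 * x) * (p.mu j x)⁻¹) with hd
  have posF : ∀ x ∈ Icc (0 : ℝ) 1, ∀ y ∈ Icc (0 : ℝ) 1, 0 < A * Real.exp (-κ * x) * p.lamInv x y :=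
    fun x hx y hy => mul_pos (by positivity) (inv_pos.2 (hp.lam_pos x hx y hy))
  have posd : ∀ j, ∀ x ∈ Icc (0 : ℝ) 1, 0 < B j * Real.exp (1 * x) * (p.mu j x)⁻¹ := fun j x hx =>
    mul_pos (mul_pos (hB j) (Real.exp_pos _)) (inv_pos.2 (hp.mu_pos j x hx))
  have cF : ContinuousOn (fun q : ℝ × ℝ => F q.1 q.2) (Icc 0 1 ×ˢ Icc 0 1) :=
    (ContinuousOn.mul (by fun_prop) hp.lamInv_cont).sqrt
  have cd : ∀ j, ContinuousOn (d j) (Icc 0 1) := fun j => (ContinuousOn.mul (by fun_prop)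
    ((hp.mu_cont j).inv₀ fun x hx => (hp.mu_pos j x hx).ne')).sqrt
  set F' : ℝ → ℝ → ℝ := fun x y => (F x y)⁻¹ with hF'
  have cF' : ContinuousOn (fun q : ℝ × ℝ => F' q.1 q.2) (Icc 0 1 ×ˢ Icc 0 1) :=
    cF.inv₀ fun q hq => (Real.sqrt_pos.2 (posF _ hq.1 _ hq.2)).ne'
  have cd' : ∀ j, ContinuousOn (fun x => (d j x)⁻¹) (Icc 0 1) := fun j =>
    (cd j).inv₀ fun x hx => (Real.sqrt_pos.2 (posd j x hx)).ne'
  have sF : ∀ x, slice cF x * slice cF' x = 1 := fun x => by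
    ext y
    exact mul_inv_cancel₀ (Real.sqrt_pos.2 (posF _ (projIcc 0 1 zero_le_one x).2 _ y.2)).ne'
  have sd : ∀ j, ∀ x ∈ Icc (0 : ℝ) 1, d j x * (d j x)⁻¹ = 1 := fun j x hx =>
    mul_inv_cancel₀ (Real.sqrt_pos.2 (posd j x hx)).ne'
  obtain ⟨D, hD⟩ := exists_equiv_of_isMult (isMult_blockE cF cd) (isMult_blockE cF' cd')
    (fun x hx v => Xs_ext
      (by rw [pr1_blockE, pr1_blockE, ← mulH_mul, mul_comm, sF, mulH_one])
      (by rw [pr2_blockE, pr2_blockE]; ext j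
          rw [diagE_apply, diagE_apply, ← mul_assoc, mul_comm (d j x)⁻¹, sd j x hx, one_mul]))
    (fun x hx v => Xs_ext
      (by rw [pr1_blockE, pr1_blockE, ← mulH_mul, sF, mulH_one])
      (by rw [pr2_blockE, pr2_blockE]; ext j
          rw [diagE_apply, diagE_apply, ← mul_assoc, sd j x hx, one_mul]))
  refine ⟨D, fun f g => ?_⟩
  rw [L2.inner_def, integral_muI]
  refine integral_congr_muI ?_ (right_mem_Icc.2 zero_le_one)
  filter_upwards [hD f, hD g, ae_muI_of_forall fun x hx => hx] with x a1 a2 hx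
  rw [a1, a2, inner_Xs, inner_weight, pr1_blockE, pr1_blockE, pr2_blockE, pr2_blockE]
  congr 1
  · rw [← inner_mulH, ← mulH_mul]
    have e : slice cF x * slice cF x = (A * Real.exp (-κ * x)) • slice hp.lamInv_cont x := by
      ext y
      have hx' : (projIcc 0 1 zero_le_one x : ℝ) = x := by rw [projIcc_of_mem _ hx]
      have := Real.mul_self_sqrt (posF x hx y y.2).le
      simpa [slice, hx', hF] using this
    rw [e, map_smul, smul_apply, real_inner_smul_left]
  · rw [PiLp.inner_apply]
    refine Finset.sum_congr rfl fun j _ => ?_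
    rw [diagE_apply, diagE_apply]
    have := Real.mul_self_sqrt (posd j x hx).le
    rw [← this]
    change d j x * pr2 (g x) j * (d j x * pr2 (f x) j) = d j x * d j x * (pr2 (f x) j * pr2 (g x) j)
    ring

end SquareRoot

/-! ### Dissipativity, single-valuedness and resolvent of the error generator. -/

section Generator

variable {m : ℕ} {p : Params m} {n : Fin m → Fin m → ℝ → ℝ} {M : Fin m → ℝ → ℝ → H}
  {N : ℝ → ℝ → Matrix (Fin m) (Fin m) ℝ}

/-- The operator of the estimation error dynamics is dissipative in an equivalent inner product. -/
lemma exists_dissipative (hp : p.Standing) (hMN : IsObserverKernel p n M N) :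
    ∃ (S : Lp (Xs m) 2 muI ≃L[ℝ] Lp (Xs m) 2 muI) (c : ℝ), 0 < c ∧
      ∀ Y F, IsGen hp M N Y F → inner ℝ (S F) (S Y) ≤ -c * ‖S Y‖ ^ 2 := by
  obtain ⟨κ, A, B, c, hA, hB, hc, hw⟩ := exists_dissipative_weight hp hMN
  obtain ⟨D, hD⟩ := exists_sqrt_weight hp (κ := κ) hA hB
  -- First undo the backstepping, then pass to the weighted norm.
  refine ⟨(backstepping hMN).symm.trans D, c, hc, fun Y F hYF => ?_⟩
  obtain ⟨z, z', h, hz, eY, eF, hh, hz0, htr⟩ := hYF.exists_target hp hMN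
  have h1mem : (1 : ℝ) ∈ Icc (0 : ℝ) 1 := right_mem_Icc.2 zero_le_one
  rw [← real_inner_self_eq_norm_sq, ContinuousLinearEquiv.trans_apply,
    ContinuousLinearEquiv.trans_apply, hD, hD]
  have e1 : ∫ x in (0 : ℝ)..1, inner ℝ (weight hp κ A B x ((backstepping hMN).symm F x))
      ((backstepping hMN).symm Y x)
      = ∫ x in (0 : ℝ)..1, inner ℝ (weight hp κ A B x (-aOp hp x (z' x) + h x)) (z x) := by
    refine integral_congr_muI ?_ h1mem
    filter_upwards [eY, eF] with x a1 a2
    rw [a1, a2]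
  have e2 : ∫ x in (0 : ℝ)..1, inner ℝ (weight hp κ A B x ((backstepping hMN).symm Y x))
      ((backstepping hMN).symm Y x)
      = ∫ x in (0 : ℝ)..1, inner ℝ (weight hp κ A B x (z x)) (z x) := by
    refine integral_congr_muI ?_ h1mem
    filter_upwards [eY] with x a1
    rw [a1]
  rw [e1, e2]
  exact hw z z' h hz hh hz0 htr

lemma IsH1.eqOn_zero {X : Type*} [NormedAddCommGroup X] [NormedSpace ℝ X] [CompleteSpace X]
    {y y' : ℝ → X} (hy : IsH1 y y') (h0 : ∀ᵐ x ∂muI, y x = 0) : EqOn y 0 (Icc 0 1) :=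
  Measure.eqOn_Icc_of_ae_eq volume zero_ne_one h0 hy.isPrim.continuousOn continuousOn_const

/-- Integrating `(g y)'` against a compactly supported test function `g`, with `y` zero throughout
`[0,1]` including the end points, leaves `∫ g y' = 0`. -/
lemma IsH1.deriv_eq_zero {X : Type*} [NormedAddCommGroup X] [NormedSpace ℝ X] [CompleteSpace X]
    {y y' : ℝ → X} (hy : IsH1 y y') (h0 : ∀ᵐ x ∂muI, y x = 0) : ∀ᵐ x ∂muI, y' x = 0 := by
  have hz := hy.eqOn_zero h0
  have h1mem : (1 : ℝ) ∈ Icc (0 : ℝ) 1 := right_mem_Icc.2 zero_le_one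
  refine ae_eq_zero_of_integral_contDiff_smul_eq_zero
    (hy.1.integrable one_le_two).locallyIntegrable fun g hg _ => ?_
  have hg1 : IsPrim g (deriv g) := isPrim_of_hasDerivAt
    (fun x => ((hg.differentiable (by simp)) x).hasDerivAt) (hg.continuous_deriv (by simp))
  have hb := (hg1.bilin (ContinuousLinearMap.lsmul ℝ ℝ) hy.isPrim).2 1 h1mem
  simp only [ContinuousLinearMap.lsmul_apply, hz h1mem, hz (left_mem_Icc.2 zero_le_one),
    Pi.zero_apply, smul_zero, zero_add] at hb
  rw [integral_muI, hb]
  refine integral_congr_muI (ae_muI_of_forall fun x hx => ?_) h1mem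
  rw [hz hx, Pi.zero_apply, smul_zero, zero_add]

lemma IsGen.eq_zero (hp : p.Standing) {F : Lp (Xs m) 2 muI} (h : IsGen hp M N 0 F) : F = 0 := by
  obtain ⟨y, y', hy, hY, h0, h1, hF⟩ := h
  have hy0 : ∀ᵐ x ∂muI, y x = 0 := by
    filter_upwards [hY, Lp.coeFn_zero (Xs m) 2 muI] with x a1 a2
    rw [← a1, a2]; rfl
  refine Lp.ext ?_
  filter_upwards [hF, hy0, hy.deriv_eq_zero hy0, Lp.coeFn_zero (Xs m) 2 muI] with x a1 a2 a3 a4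
  rw [a1, a2, a3, a4, hy.eqOn_zero hy0 (left_mem_Icc.2 zero_le_one)]
  simp

lemma IsH1.add {X : Type*} [NormedAddCommGroup X] [NormedSpace ℝ X] [CompleteSpace X]
    {y y' z z' : ℝ → X} (hy : IsH1 y y') (hz : IsH1 z z') :
    IsH1 (fun x => y x + z x) (fun x => y' x + z' x) := by
  refine ⟨hy.1.add hz.1, fun x hx => ?_⟩
  rw [intervalIntegral.integral_add (hy.isPrim.intervalIntegrable hx)
    (hz.isPrim.intervalIntegrable hx)]
  simp only [hy.2 x hx, hz.2 x hx]
  abel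

/-- The graph of the operator of the estimation error dynamics as a subspace. -/
def genGraph (hp : p.Standing) (M : Fin m → ℝ → ℝ → H) (N : ℝ → ℝ → Matrix (Fin m) (Fin m) ℝ) :
    Submodule ℝ (Lp (Xs m) 2 muI × Lp (Xs m) 2 muI) where
  carrier := {q | IsGen hp M N q.1 q.2}
  zero_mem' := by
    refine ⟨fun _ => 0, fun _ => 0, ⟨MemLp.zero', fun x _ => by simp⟩, Lp.coeFn_zero _ _ _, by simp,
      by simp, ?_⟩
    filter_upwards [Lp.coeFn_zero (Xs m) 2 muI] with x a1
    simp only [Prod.snd_zero, a1, map_zero]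
    simp
  add_mem' := by
    rintro ⟨Y, F⟩ ⟨Z, G⟩ ⟨y, y', hy, hY, h0, h1, hF⟩ ⟨z, z', hz, hZ, k0, k1, hG⟩
    refine ⟨_, _, hy.add hz, ?_, by rw [map_add, h0, k0, add_zero],
      by rw [map_add, map_add, map_add, h1, k1], ?_⟩
    · filter_upwards [hY, hZ, Lp.coeFn_add Y Z] with x a1 a2 a3
      rw [Prod.mk_add_mk, a3, Pi.add_apply, a1, a2]
    · filter_upwards [hF, hG, Lp.coeFn_add F G] with x a1 a2 a3
      rw [Prod.mk_add_mk, a3, Pi.add_apply, a1, a2]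
      simp only [map_add]
      abel
  smul_mem' := by
    rintro r ⟨Y, F⟩ ⟨y, y', hy, hY, h0, h1, hF⟩
    have hr := hy.clm (r • ContinuousLinearMap.id ℝ (Xs m))
    simp only [smul_apply, ContinuousLinearMap.id_apply] at hr
    refine ⟨_, _, hr, ?_, by rw [map_smul, h0, smul_zero], by rw [map_smul, map_smul, map_smul, h1], ?_⟩
    · filter_upwards [hY, Lp.coeFn_smul r Y] with x a1 a3
      rw [Prod.smul_mk, a3, Pi.smul_apply, a1]
    · filter_upwards [hF, Lp.coeFn_smul r F] with x a1 a3
      rw [Prod.smul_mk, a3, Pi.smul_apply, a1]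
      simp only [map_smul, smul_sub, smul_add, smul_neg]

lemma mem_genGraph (hp : p.Standing) {Y F : Lp (Xs m) 2 muI} :
    (Y, F) ∈ genGraph hp M N ↔ IsGen hp M N Y F := Iff.rfl

/-- The gain is the edge value `k(x,0) Λ₋(0)` of the kernel, hence it inherits measurability and
boundedness on `ξ = 0`. -/
lemma pOp_eq (x : ℝ) : pOp p M N x = kop M N x 0 ∘L diagE fun j => p.mu j 0 := by
  ext1 v
  rw [pOp_apply, ContinuousLinearMap.comp_apply, kop_apply]
  simp only [diagE_apply]

lemma IsObserverKernel.isMult_pOp (hMN : IsObserverKernel p n M N) : IsMult (pOp p M N) := by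
  obtain ⟨hm, C, hC0, hC⟩ := hMN.isKer_kop
  set d : Eu m →L[ℝ] Eu m := diagE fun j => p.mu j 0
  have h1 : StronglyMeasurable fun x => kop M N x 0 :=
    hm.comp_measurable (g := fun x : ℝ => (x, (0 : ℝ))) (measurable_id.prodMk measurable_const)
  have h2 : StronglyMeasurable fun x => kop M N x 0 ∘L d :=
    ((ContinuousLinearMap.compL ℝ (Eu m) (Eu m) (Xs m)).flip d).continuous.comp_stronglyMeasurable h1
  rw [show pOp p M N = fun x => kop M N x 0 ∘L d from funext pOp_eq]
  refine ⟨h2.aestronglyMeasurable, C * ‖d‖, ae_muI_of_forall fun x hx => ?_⟩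
  exact (ContinuousLinearMap.opNorm_comp_le _ _).trans
    (mul_le_mul_of_nonneg_right (hC x hx 0 ⟨le_rfl, hx.1⟩) (norm_nonneg _))

/-- Solution of the resolvent equation for given value `q` of the second component at `0`. -/
lemma exists_resolvent_ode (hp : p.Standing) (hMN : IsObserverKernel p n M N) (s : ℝ) :
    ∃ Γ : Eu m × Lp (Xs m) 2 muI →L[ℝ] Lp (Xs m) 2 muI, ∀ q F, ∀ᵐ x ∂muI,
      aOp hp x (Γ (q, F) x) = F x + bOp p x (in2 q + ∫ t in (0 : ℝ)..x, Γ (q, F) t)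
        - s • (in2 q + ∫ t in (0 : ℝ)..x, Γ (q, F) t) - pOp p M N x q := by
  -- The resolvent equation reads `a y' = F + (b - s) y - P q`. With `y = in2 q + ∫₀ˣ γ` it is a
  -- Volterra equation for `γ = y'`, and its solution is linear and continuous in `(q, F)`.
  set B : ℝ → Xs m →L[ℝ] Xs m := fun x => bOp p x - s • ContinuousLinearMap.id ℝ (Xs m) with hBdef
  have hB : IsMult B := by
    obtain ⟨h1, C, hC⟩ := hp.isMult_bOp
    refine ⟨h1.sub aestronglyMeasurable_const, C + ‖s • ContinuousLinearMap.id ℝ (Xs m)‖, ?_⟩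
    filter_upwards [hC] with x hx
    exact (norm_sub_le _ _).trans (add_le_add hx le_rfl)
  have ha := isMult_aInv hp
  have hV : IsVolt (ha.op ∘L (hB.op ∘L primOp)) :=
    (isVolt_primOp.mult_comp hB).mult_comp ha
  obtain ⟨u, hu⟩ := hV.isUnit_one_sub
  set cst : Eu m →L[ℝ] Lp (Eu m) 2 muI := Lp.constL 2 muI ℝ
  set hE : IsMult fun _ : ℝ => (in2 : Eu m →L[ℝ] Xs m) := isMult_const in2
  set r : Eu m × Lp (Xs m) 2 muI →L[ℝ] Lp (Xs m) 2 muI :=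
    ha.op ∘L (ContinuousLinearMap.snd ℝ (Eu m) (Lp (Xs m) 2 muI)
      + ((hB.op ∘L hE.op - hMN.isMult_pOp.op) ∘L cst) ∘L ContinuousLinearMap.fst ℝ _ _) with hr
  refine ⟨(↑u⁻¹ : Lp (Xs m) 2 muI →L[ℝ] Lp (Xs m) 2 muI) ∘L r, fun q F => ?_⟩
  set γ := ((↑u⁻¹ : Lp (Xs m) 2 muI →L[ℝ] Lp (Xs m) 2 muI) ∘L r) (q, F) with hγ
  have e1 : γ - ha.op (hB.op (primOp γ)) = r (q, F) := by
    have : (u : Lp (Xs m) 2 muI →L[ℝ] Lp (Xs m) 2 muI) γ = r (q, F) :=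
      DFunLike.congr_fun (Units.mul_inv u) (r (q, F))
    rw [hu] at this
    exact this
  have e2 : r (q, F) = ha.op (F + (hB.op (hE.op (cst q)) - hMN.isMult_pOp.op (cst q))) := rfl
  have hc : cst q =ᵐ[muI] fun _ => q := Lp.coeFn_const ..
  set P1 := hB.op (hE.op (cst q))
  set P2 := hMN.isMult_pOp.op (cst q)
  have e3 : γ = ha.op (F + (P1 - P2)) + ha.op (hB.op (primOp γ)) := by rw [← e2, ← e1]; abel
  have e4 := congrArg (fun f : Lp (Xs m) 2 muI => (f : ℝ → Xs m)) e3
  filter_upwards [Lp.coeFn_add (ha.op (F + (P1 - P2))) (ha.op (hB.op (primOp γ))),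
    ha.op_ae (F + (P1 - P2)), ha.op_ae (hB.op (primOp γ)), hB.op_ae_of (primOp_ae γ),
    hB.op_ae_of (hE.op_ae_of hc), hMN.isMult_pOp.op_ae_of hc, Lp.coeFn_add F (P1 - P2),
    Lp.coeFn_sub P1 P2, ae_muI_of_forall fun x hx => hx] with x a1 a2 a3 a4 a5 a6 a7 a8 hx
  have e5 := congrFun e4 x
  rw [a1, Pi.add_apply, a2, a3, a4, a7, Pi.add_apply, a8, Pi.sub_apply, a5, a6, ← map_add] at e5
  rw [e5, aOp_aInv hp hx]
  simp only [hBdef, sub_apply, smul_apply, ContinuousLinearMap.id_apply, map_add, smul_add]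
  abel

/-- Positive numbers belong to the resolvent set. -/
lemma exists_isGen_resolvent (hp : p.Standing) (hMN : IsObserverKernel p n M N) {s : ℝ} (hs : 0 < s)
    (F : Lp (Xs m) 2 muI) : ∃ Y W, IsGen hp M N Y W ∧ s • Y - W = F := by
  obtain ⟨Γ, hΓ⟩ := exists_resolvent_ode hp hMN s
  obtain ⟨S, c, hc, hS⟩ := exists_dissipative hp hMN
  have h1mem : (1 : ℝ) ∈ Icc (0 : ℝ) 1 := right_mem_Icc.2 zero_le_one
  -- The defect in the boundary condition at `x = 1` of the solution that starts from `(0, q)` at `x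
  -- = 0`. Solving the resolvent equation amounts to finding a zero in `q`.
  set Φ : Eu m × Lp (Xs m) 2 muI →L[ℝ] Eu m :=
    ContinuousLinearMap.fst ℝ _ _ + (pr2 - rOp p ∘L pr1) ∘L intOp ∘L Γ with hΦ
  have hΦ_apply : ∀ q F, Φ (q, F) = q + (pr2 (intOp (Γ (q, F))) - rOp p (pr1 (intOp (Γ (q, F))))) :=
    fun q F => rfl
  have solve : ∀ q F, Φ (q, F) = 0 → ∃ y y' : ℝ → Xs m, ∃ Y W : Lp (Xs m) 2 muI, IsH1 y y' ∧
      Y =ᵐ[muI] y ∧ pr2 (y 0) = q ∧ IsGen hp M N Y W ∧ s • Y - W = F := by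
    intro q F h
    set y : ℝ → Xs m := fun x => in2 q + ∫ t in (0 : ℝ)..x, Γ (q, F) t with hy
    have hH : IsH1 y (Γ (q, F)) := isH1_primitive (Lp.memLp _) _
    have hy0 : y 0 = in2 q := by simp [hy]
    have hy1 : y 1 = in2 q + intOp (Γ (q, F)) := by rw [hy, intOp_eq]
    set Y := hH.memLp.toLp with hY
    have hYe : Y =ᵐ[muI] y := hH.memLp.coeFn_toLp
    refine ⟨y, Γ (q, F), Y, s • Y - F, hH, hYe, by rw [hy0, pr2_in2],
      ⟨y, Γ (q, F), hH, hYe, by rw [hy0, pr1_in2], ?_, ?_⟩, by abel⟩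
    · rw [hΦ_apply] at h
      rw [hy1, map_add, map_add, pr1_in2, pr2_in2, zero_add, ← sub_eq_zero, ← h]
      abel
    · filter_upwards [hΓ q F, hYe, Lp.coeFn_sub (s • Y) F, Lp.coeFn_smul s Y] with x a1 a2 a3 a4
      rw [a3, Pi.sub_apply, a4, Pi.smul_apply, a2, a1, hy0, pr2_in2]
      simp only [hy]
      abel
  -- A kernel vector yields `(Y, s Y)` in the graph, so `s ‖S Y‖² ≤ -c ‖S Y‖²` and `Y = 0`, hence `q
  -- = 0`. In the finite-dimensional space `ℝᵐ` injectivity gives surjectivity.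
  have hinj : Function.Injective
      ((Φ ∘L ContinuousLinearMap.inl ℝ (Eu m) (Lp (Xs m) 2 muI) : Eu m →L[ℝ] Eu m) :
        Eu m →ₗ[ℝ] Eu m) := by
    rw [← LinearMap.ker_eq_bot, LinearMap.ker_eq_bot']
    intro q hq
    obtain ⟨y, y', Y, W, hy, hYe, hyq, hG, hW⟩ := solve q 0 hq
    rw [sub_eq_zero] at hW
    have h1 := hS Y W hG
    rw [← hW, map_smul, real_inner_smul_left, real_inner_self_eq_norm_sq] at h1
    have h2 : ‖S Y‖ ^ 2 = 0 := by
      have : 0 ≤ ‖S Y‖ ^ 2 := sq_nonneg _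
      nlinarith
    have h3 : Y = 0 := by
      have : S Y = 0 := by simpa using h2
      simpa using this
    have h4 : ∀ᵐ x ∂muI, y x = 0 := by
      filter_upwards [hYe, Lp.coeFn_zero (Xs m) 2 muI] with x a1 a2
      rw [← a1, h3, a2]; rfl
    rw [← hyq, hy.eqOn_zero h4 (left_mem_Icc.2 zero_le_one)]
    simp
  obtain ⟨q, hq⟩ := (LinearMap.injective_iff_surjective.1 hinj) (-Φ (0, F))
  have h0 : Φ (q, F) = 0 := by
    have e : ((q, F) : Eu m × Lp (Xs m) 2 muI) = (q, 0) + (0, F) := by simp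
    rw [e, map_add]
    have : Φ (q, 0) = -Φ (0, F) := hq
    rw [this, neg_add_cancel]
  obtain ⟨y, y', Y, W, -, -, -, hG, hW⟩ := solve q F h0
  exact ⟨Y, W, hG, hW⟩

/-- Exponential stability on `L²([0,1]; H × ℝᵐ)`. -/
lemma isExponentiallyStable_genGraph (hp : p.Standing) (hMN : IsObserverKernel p n M N) :
    IsExponentiallyStable (genGraph hp M N : Set (Lp (Xs m) 2 muI × Lp (Xs m) 2 muI)) := by
  obtain ⟨S, c, hc, hS⟩ := exists_dissipative hp hMN
  refine IsExponentiallyStable.of_equiv S ?_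
  refine isExponentiallyStable_of_dissipative ((genGraph hp M N).comap
    ((S.symm : Lp (Xs m) 2 muI →ₗ[ℝ] Lp (Xs m) 2 muI).prodMap
      (S.symm : Lp (Xs m) 2 muI →ₗ[ℝ] Lp (Xs m) 2 muI))) hc ?_ ?_ ?_
  · intro z w h
    have := hS _ _ ((mem_genGraph hp).1 h)
    simpa using this
  · intro w h
    have h1 : IsGen hp M N (S.symm 0) (S.symm w) := h
    rw [map_zero] at h1
    have h2 := h1.eq_zero hp
    simpa using h2
  · intro s hs f
    obtain ⟨Y, W, hG, hW⟩ := exists_isGen_resolvent hp hMN hs (S.symm f)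
    refine ⟨S Y, S W, ?_, ?_⟩
    · change IsGen hp M N (S.symm (S Y)) (S.symm (S W))
      simpa using hG
    · rw [← map_smul, ← map_sub, hW, ContinuousLinearEquiv.apply_symm_apply]

end Generator

/-! ### Identification of the error dynamics with the abstract generator. -/

section ErrorGraph

variable {m : ℕ} {p : Params m} {n : Fin m → Fin m → ℝ → ℝ} {M : Fin m → ℝ → ℝ → H}
  {N : ℝ → ℝ → Matrix (Fin m) (Fin m) ℝ}

/-- The identification of `E_c` with `L²([0,1]; H × ℝᵐ)`. -/
def stateEquiv : Ec m ≃L[ℝ] Lp (Xs m) 2 muI :=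
  (WithLp.prodContinuousLinearEquiv 2 ℝ (Lp H 2 muI) (Lp (Eu m) 2 muI)).trans
    (ContinuousLinearEquiv.equivOfInverse
      ((isMult_const (in1 (m := m))).op.coprod (isMult_const (in2 (m := m))).op)
      ((isMult_const (pr1 (m := m))).op.prod (isMult_const (pr2 (m := m))).op)
      (fun q => by
        have h1 := (isMult_const (in1 (m := m))).op_ae q.1
        have h2 := (isMult_const (in2 (m := m))).op_ae q.2
        have h3 := Lp.coeFn_add ((isMult_const (in1 (m := m))).op q.1)
          ((isMult_const (in2 (m := m))).op q.2)
        refine Prod.ext (Lp.ext ?_) (Lp.ext ?_)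
        · filter_upwards [h1, h2, h3, (isMult_const (pr1 (m := m))).op_ae
            ((isMult_const (in1 (m := m))).op q.1 + (isMult_const (in2 (m := m))).op q.2)]
            with x a1 a2 a3 a4
          refine a4.trans ?_
          rw [a3, Pi.add_apply, a1, a2]
          simp
        · filter_upwards [h1, h2, h3, (isMult_const (pr2 (m := m))).op_ae
            ((isMult_const (in1 (m := m))).op q.1 + (isMult_const (in2 (m := m))).op q.2)]
            with x a1 a2 a3 a4
          refine a4.trans ?_
          rw [a3, Pi.add_apply, a1, a2]
          simp)
      (fun Y => by
        refine Lp.ext ?_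
        filter_upwards [(isMult_const (in1 (m := m))).op_ae_of ((isMult_const (pr1 (m := m))).op_ae Y),
          (isMult_const (in2 (m := m))).op_ae_of ((isMult_const (pr2 (m := m))).op_ae Y),
          Lp.coeFn_add ((isMult_const (in1 (m := m))).op ((isMult_const (pr1 (m := m))).op Y))
            ((isMult_const (in2 (m := m))).op ((isMult_const (pr2 (m := m))).op Y))] with x a1 a2 a3
        refine a3.trans ?_
        rw [Pi.add_apply, a1, a2, in1_pr1_add]))

lemma stateEquiv_ae (z : Ec m) :
    ∀ᵐ x ∂muI, pr1 (stateEquiv z x) = z.fst x ∧ pr2 (stateEquiv z x) = z.snd x := by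
  filter_upwards [(isMult_const (in1 (m := m))).op_ae z.fst, (isMult_const (in2 (m := m))).op_ae z.snd,
    Lp.coeFn_add ((isMult_const (in1 (m := m))).op z.fst)
      ((isMult_const (in2 (m := m))).op z.snd)] with x a1 a2 a3
  have e : stateEquiv z x = in1 (z.fst x) + in2 (z.snd x) := by
    refine a3.trans ?_
    rw [Pi.add_apply, a1, a2]
  rw [e]
  simp

lemma coeFn_sum_smul (c : Fin m → ℝ) (f : Fin m → H) :
    ∀ᵐ y ∂muI, (∑ j, c j • f j : H) y = ∑ j, f j y * c j := by
  filter_upwards [Lp.coeFn_fun_finsetSum Finset.univ fun j => c j • f j,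
    ae_all_iff.2 fun j => Lp.coeFn_smul (c j) (f j)] with y h1 h2
  rw [h1]
  refine Finset.sum_congr rfl fun j _ => ?_
  rw [h2, Pi.smul_apply, smul_eq_mul, mul_comm]

/-- Passes between equality of `L²` classes in `y` and the pointwise equation of the error dynamics,
at a fixed `x`. -/
lemma pr1_equation_iff (hp : p.Standing) {x : ℝ} (hx : x ∈ Icc (0 : ℝ) 1) (f u u' : H) (v v₀ : Eu m) :
    (∀ᵐ y ∂muI, f y = -p.lam x y * u' y - (∑ j, gainPlus p M j x y * v₀ j)
        + (∫ η, p.sigma x (y, η) * u η ∂muI) + ∑ j, p.W j x y * v j)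
      ↔ f = -mulH (slice hp.lam_cont x) u' + (hsOp (p.sigma x) u + wOp p x v)
        - ∑ j, v₀ j • gainPlus p M j x := by
  set g := -mulH (slice hp.lam_cont x) u' + (hsOp (p.sigma x) u + wOp p x v)
        - ∑ j, v₀ j • gainPlus p M j x with hg
  have key : ∀ᵐ y ∂muI, g y = -p.lam x y * u' y - (∑ j, gainPlus p M j x y * v₀ j)
        + (∫ η, p.sigma x (y, η) * u η ∂muI) + ∑ j, p.W j x y * v j := by
    rw [wOp_apply] at hg
    filter_upwards [mulH_ae (slice hp.lam_cont x) u', hsOp_ae (p.sigma x) u,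
      coeFn_sum_smul v (fun j => p.W j x), coeFn_sum_smul v₀ (fun j => gainPlus p M j x),
      Lp.coeFn_neg (mulH (slice hp.lam_cont x) u'),
      Lp.coeFn_add (hsOp (p.sigma x) u) (∑ j, v j • p.W j x),
      Lp.coeFn_add (-mulH (slice hp.lam_cont x) u') (hsOp (p.sigma x) u + ∑ j, v j • p.W j x),
      Lp.coeFn_sub (-mulH (slice hp.lam_cont x) u' + (hsOp (p.sigma x) u + ∑ j, v j • p.W j x))
        (∑ j, v₀ j • gainPlus p M j x), ae_muI_of_forall fun y hy => hy]
      with y a1 a2 a3 a4 a5 a6 a7 a8 hy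
    rw [hg, a8, Pi.sub_apply, a7, Pi.add_apply, a6, Pi.add_apply, a5, Pi.neg_apply, a1, a2, a3, a4,
      slice_apply hp.lam_cont hx hy]
    ring
  constructor
  · intro h
    refine Lp.ext ?_
    filter_upwards [h, key] with y a1 a2
    rw [a1, a2]
  · rintro rfl
    exact key

lemma pr1_pOp (x : ℝ) (v : Eu m) : pr1 (pOp p M N x v) = ∑ j, v j • gainPlus p M j x := by
  rw [pOp_apply, map_sum]
  refine Finset.sum_congr rfl fun j _ => ?_
  rw [map_smul, pr1_kcol, gainPlus, smul_smul, mul_comm]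

lemma pr2_pOp (x : ℝ) (v : Eu m) (i : Fin m) :
    pr2 (pOp p M N x v) i = ∑ j, gainMinus p N x i j * v j := by
  rw [pOp_apply, map_sum, WithLp.ofLp_sum, Finset.sum_apply]
  refine Finset.sum_congr rfl fun j _ => ?_
  rw [map_smul, PiLp.smul_apply, pr2_kcol, gainMinus, Matrix.mul_diagonal, smul_eq_mul]
  ring

/-- The pointwise form of the operator of the estimation error dynamics. -/
lemma equation_iff (hp : p.Standing) {x : ℝ} (hx : x ∈ Icc (0 : ℝ) 1) (f y y' y₀ : Xs m) :
    f = -aOp hp x y' + bOp p x y - pOp p M N x (pr2 y₀) ↔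
      (∀ᵐ η ∂muI, pr1 f η = -p.lam x η * pr1 y' η - (∑ j, gainPlus p M j x η * pr2 y₀ j)
        + (∫ ζ, p.sigma x (η, ζ) * pr1 y ζ ∂muI) + ∑ j, p.W j x η * pr2 y j) ∧
      ∀ i, pr2 f i = p.mu i x * pr2 y' i - (∑ j, gainMinus p N x i j * pr2 y₀ j)
        + (∫ η, p.Theta i x η * pr1 y η ∂muI) + ∑ j, p.Psi x i j * pr2 y j := by
  rw [pr1_equation_iff hp hx]
  have e1 : pr1 (-aOp hp x y' + bOp p x y - pOp p M N x (pr2 y₀))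
      = -mulH (slice hp.lam_cont x) (pr1 y') + (hsOp (p.sigma x) (pr1 y) + wOp p x (pr2 y))
        - ∑ j, pr2 y₀ j • gainPlus p M j x := by
    rw [map_sub, map_add, map_neg, pr1_aOp, pr1_bOp, pr1_pOp]
  have e2 : ∀ i, pr2 (-aOp hp x y' + bOp p x y - pOp p M N x (pr2 y₀)) i
      = p.mu i x * pr2 y' i - (∑ j, gainMinus p N x i j * pr2 y₀ j)
        + (∫ η, p.Theta i x η * pr1 y η ∂muI) + ∑ j, p.Psi x i j * pr2 y j := by
    intro i
    rw [map_sub, map_add, map_neg, pr2_aOp, pr2_bOp, neg_neg, PiLp.sub_apply, PiLp.add_apply,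
      PiLp.add_apply, pr2_pOp, thetaOp_apply, psiOp_apply, diagE_apply, inner_H]
    ring
  constructor
  · rintro rfl
    exact ⟨e1, e2⟩
  · rintro ⟨h1, h2⟩
    refine Xs_ext (h1.trans e1.symm) ?_
    ext i
    rw [h2 i, e2 i]

/-- The pair of `H¹` functions `(u, v)` is the same datum as one `H¹` function with values in the
fibre, and the boundary conditions and the equations correspond componentwise. Since exponential
stability is invariant under linear homeomorphisms, this reduces the theorem to
`isExponentiallyStable_genGraph`. -/
lemma errorGraph_iff (hp : p.Standing) (z w : Ec m) :
    (z, w) ∈ errorGraph p (gainPlus p M) (gainMinus p N) ↔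
      IsGen hp M N (stateEquiv z) (stateEquiv w) := by
  constructor
  · rintro ⟨u, u', v, v', hu, hv, hzu, hzv, hu0, hv1, hf, hg⟩
    refine ⟨_, _, (hu.clm in1).add (hv.clm in2), ?_, by simp [hu0], ?_, ?_⟩
    · filter_upwards [stateEquiv_ae z, hzu, hzv] with x a1 a2 a3
      exact Xs_ext (by simp [a1.1, a2]) (by simp [a1.2, a3])
    · ext i
      simp only [map_add, pr1_in1, pr1_in2, pr2_in1, pr2_in2, zero_add, add_zero, rOp_apply, hv1,
        inner_H]
    · filter_upwards [stateEquiv_ae w, hf, hg, ae_muI_of_forall fun x hx => hx] with x a1 a2 a3 hx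
      rw [equation_iff hp hx, a1.1, a1.2]
      simp only [map_add, pr1_in1, pr1_in2, pr2_in1, pr2_in2, zero_add, add_zero]
      exact ⟨a2, a3⟩
  · rintro ⟨y, y', hy, hz, h0, h1, hF⟩
    refine ⟨_, _, _, _, hy.clm pr1, hy.clm pr2, ?_, ?_, h0, fun j => ?_, ?_, ?_⟩
    · filter_upwards [stateEquiv_ae z, hz] with x a1 a2
      rw [← a1.1, a2]
    · filter_upwards [stateEquiv_ae z, hz] with x a1 a2
      rw [← a1.2, a2]
    · rw [h1, rOp_apply, inner_H]
    · filter_upwards [stateEquiv_ae w, hF, ae_muI_of_forall fun x hx => hx] with x a1 a2 hx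
      rw [equation_iff hp hx, a1.1] at a2
      exact a2.1
    · filter_upwards [stateEquiv_ae w, hF, ae_muI_of_forall fun x hx => hx] with x a1 a2 hx
      rw [equation_iff hp hx, a1.2] at a2
      exact a2.2

end ErrorGraph

end ContinuumPDE

end

theorem lemma1 {m : ℕ} (p : ContinuumPDE.Params m) (hp : p.Standing)
    (n : Fin m → Fin m → ℝ → ℝ)
    (M : Fin m → ℝ → ℝ → ContinuumPDE.H) (N : ℝ → ℝ → Matrix (Fin m) (Fin m) ℝ)
    (hMN : ContinuumPDE.IsObserverKernel p n M N) :
    ContinuumPDE.IsExponentiallyStable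
      (ContinuumPDE.errorGraph p (ContinuumPDE.gainPlus p M) (ContinuumPDE.gainMinus p N)) := by
  refine ContinuumPDE.IsExponentiallyStable.of_equiv ContinuumPDE.stateEquiv ?_
  convert ContinuumPDE.isExponentiallyStable_genGraph hp hMN using 1
  ext ⟨Y, F⟩
  refine (ContinuumPDE.errorGraph_iff hp _ _).trans ?_
  rw [ContinuousLinearEquiv.apply_symm_apply, ContinuousLinearEquiv.apply_symm_apply]
  rfl
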